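/- Let $\alpha>-1/2$, let $d\mu_\alpha(x)=(2\pi)^{\alpha+1}x^{2\alpha+1}\,dx$ on $\mathbb{R}^+=[0,\infty)$, and let $L^p_\alpha=L^p(\mathbb{R}^+,\mu_\alpha)$ (complex-valued functions). For $f\in L^1_\alpha$ the Fourier–Bessel transform is $$\mathcal{F}_\alpha f(y)=\int_0^\infty f(x)\,j_\alpha(2\pi xy)\,d\mu_\alpha(x),\qquad j_\alpha(x)=\frac{1}{2^\alpha}\sum_{n=0}^\infty\frac{(-1)^n}{n!\,\Gamma(n+\alpha+1)}\Big(\frac{x}{2}\Big)^{2n}.$$ For $\varepsilon>0$, a measurable set $S\subset\mathbb{R}^+$ is called $(\varepsilon,\alpha)$-thin if $$\mu_\alpha(S\cap[x,x+1])\le\varepsilon\,\mu_\alpha([x,x+1])\quad(0\le x\le 1)$$ and $$\mu_\alpha\big(S\cap[x,x+\tfrac1x]\big)\le\varepsilon\,\mu_\alpha\big([x,x+\tfrac1x]\big)\quad(x\ge 2).$$ Then $\mathcal{F}_\alpha$ extends by continuity from $L^1_\alpha\cap L^2_\alpha$ to $L^2_\alpha$, and, writing $\mathcal{F}_\alpha$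 also for the extension, there exists $\varepsilon_0>0$ such that for every $0<\varepsilon<\varepsilon_0$ there is a constant $C>0$, depending only on $\varepsilon$ and $\alpha$, such that for all $(\varepsilon,\alpha)$-thin sets $S,\Sigma\subset\mathbb{R}^+$ and all $f\in L^2_\alpha$, $$\|f\|_{L^2_\alpha}\le C\Big(\|f\|_{L^2_\alpha(S^c)}+\|\mathcal{F}_\alpha f\|_{L^2_\alpha(\Sigma^c)}\Big),$$ where $A^c=\mathbb{R}^+\setminus A$. -/

import Mathlib

open MeasureTheory Filter Topology Set
open scoped ENNReal

noncomputable section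

namespace FourierBessel

/-- The measure `dμ_α(x) = (2π)^(α+1) x^(2α+1) dx` on the half-line, as a measure on `ℝ` carried by
`(0, ∞)`. -/
def mu (α : ℝ) : Measure ℝ :=
  (volume.restrict (Ioi 0)).withDensity
    fun x => ENNReal.ofReal ((2 * Real.pi) ^ (α + 1) * x ^ (2 * α + 1))

instance (α : ℝ) : SFinite (mu α) := by
  unfold mu; infer_instance

/-- The normalized Bessel function `j_α(x) = J_α(x) / x^α`, by its power series. -/
def j (α x : ℝ) : ℝ :=
  1 / (2 : ℝ) ^ α *
    ∑' n : ℕ, (-1 : ℝ) ^ n / ((n.factorial : ℝ) * Real.Gamma (n + α + 1)) * (x / 2) ^ (2 * n)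

/-- The Fourier–Bessel transform of an integrable function, as an integral. -/
def transform (α : ℝ) (f : ℝ → ℂ) (y : ℝ) : ℂ :=
  ∫ x, f x * (j α (2 * Real.pi * x * y) : ℂ) ∂(mu α)

/-- `L²_α(ℝ⁺)`. -/
abbrev L2 (α : ℝ) : Type := Lp ℂ 2 (mu α)

/-- The subset `L¹_α ∩ L²_α` of `L²_α`. -/
def L1L2 (α : ℝ) : Set (L2 α) := {h | Integrable h (mu α)}

/-- `g` is the Fourier–Bessel transform of `f` in the `L²` sense: as `h` tends to `f` in `L²_α`
within `L¹_α ∩ L²_α`, the integral transform of `h` tends to `g` in `L²_α`. The norm takes values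
in `[0, ∞]`, so this forces the transform of `h` to be square integrable for `h` near `f`. -/
def IsTransformL2 (α : ℝ) (f g : L2 α) : Prop :=
  Tendsto (fun h : L2 α => eLpNorm (fun y => transform α h y - g y) 2 (mu α))
    (𝓝[L1L2 α] f) (𝓝 0)

open Classical in
/-- The Fourier–Bessel transform on `L²_α`: the extension by continuity of the integral transform
from `L¹_α ∩ L²_α`. The limit is unique by `IsTransformL2.unique` below; the value `0` is a formal
default for the case that there is no limit. -/
def transformL2 (α : ℝ) (f : L2 α) : L2 α :=
  if h : ∃ g, IsTransformL2 α f g then h.choose else 0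

/-- `(ε, α)`-thin subsets of the half-line. -/
def IsThin (ε α : ℝ) (S : Set ℝ) : Prop :=
  (∀ x : ℝ, 0 ≤ x → x ≤ 1 →
    mu α (S ∩ Icc x (x + 1)) ≤ ENNReal.ofReal ε * mu α (Icc x (x + 1))) ∧
  (∀ x : ℝ, 2 ≤ x →
    mu α (S ∩ Icc x (x + 1 / x)) ≤ ENNReal.ofReal ε * mu α (Icc x (x + 1 / x)))

/-! The `L²` transform is well defined. -/

theorem dense_L1L2 (α : ℝ) : Dense (L1L2 α) := by
  refine (Lp.simpleFunc.dense (E := ℂ) (μ := mu α) (p := 2) (by simp)).mono ?_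
  intro h hh
  have h1 := Lp.simpleFunc.memLp ⟨h, hh⟩
  rw [SimpleFunc.memLp_iff_integrable (by simp) (by simp)] at h1
  exact h1.congr (Lp.simpleFunc.toSimpleFunc_eq_toFun ⟨h, hh⟩)

theorem summable_j {α : ℝ} (hα : -1 / 2 < α) (x : ℝ) :
    Summable fun n : ℕ =>
      (-1 : ℝ) ^ n / ((n.factorial : ℝ) * Real.Gamma (n + α + 1)) * (x / 2) ^ (2 * n) := by
  refine Summable.of_norm_bounded_eventually_nat (Real.summable_pow_div_factorial ((x / 2) ^ 2)) ?_
  filter_upwards [eventually_ge_atTop 2] with n hn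
  have hn' : (2 : ℝ) ≤ n := by exact_mod_cast hn
  have hG : 1 ≤ Real.Gamma (n + α + 1) := by
    have := Real.Gamma_strictMonoOn_Ici.monotoneOn (a := 2) (b := (n : ℝ) + α + 1)
      (by simp) (by simp only [mem_Ici]; linarith) (by linarith)
    rwa [Real.Gamma_two] at this
  have hf : (0 : ℝ) < n.factorial := by positivity
  rw [norm_mul, norm_div, norm_pow, norm_neg, norm_one, one_pow, norm_mul, pow_mul,
    Real.norm_of_nonneg hf.le, Real.norm_of_nonneg (by linarith : 0 ≤ Real.Gamma (n + α + 1)),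
    Real.norm_of_nonneg (by positivity : 0 ≤ ((x / 2) ^ 2) ^ n), div_mul_eq_mul_div, one_mul]
  gcongr
  nlinarith

theorem measurable_j {α : ℝ} (hα : -1 / 2 < α) : Measurable (j α) := by
  refine Measurable.const_mul ?_ _
  refine measurable_of_tendsto_metrizable
    (f := fun N x => ∑ n ∈ Finset.range N,
      (-1 : ℝ) ^ n / ((n.factorial : ℝ) * Real.Gamma (n + α + 1)) * (x / 2) ^ (2 * n)) ?_ ?_
  · intro N; fun_prop
  · exact tendsto_pi_nhds.2 fun x => (summable_j hα x).hasSum.tendsto_sum_nat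

theorem aestronglyMeasurable_transform {α : ℝ} (hα : -1 / 2 < α) (h : L2 α) :
    AEStronglyMeasurable (transform α h) (mu α) := by
  have hj : Measurable fun p : ℝ × ℝ => ((j α (2 * Real.pi * p.2 * p.1) : ℝ) : ℂ) :=
    Complex.measurable_ofReal.comp ((measurable_j hα).comp (by fun_prop))
  exact StronglyMeasurable.aestronglyMeasurable (StronglyMeasurable.integral_prod_right'
    (f := fun p : ℝ × ℝ => h p.2 * ((j α (2 * Real.pi * p.2 * p.1) : ℝ) : ℂ))
    (((Lp.stronglyMeasurable h).comp_measurable measurable_snd).mul hj.stronglyMeasurable))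

theorem IsTransformL2.unique {α : ℝ} (hα : -1 / 2 < α) {f g₁ g₂ : L2 α}
    (h₁ : IsTransformL2 α f g₁) (h₂ : IsTransformL2 α f g₂) : g₁ = g₂ := by
  have : (𝓝[L1L2 α] f).NeBot := mem_closure_iff_nhdsWithin_neBot.1 (dense_L1L2 α f)
  have key : eLpNorm (fun y => g₁ y - g₂ y) 2 (mu α) = 0 := by
    refine le_antisymm (ge_of_tendsto (add_zero (0 : ℝ≥0∞) ▸ h₂.add h₁) ?_) bot_le
    refine Eventually.of_forall fun h => ?_
    have hm := aestronglyMeasurable_transform hα h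
    have := eLpNorm_sub_le (p := 2) (hm.sub (Lp.aestronglyMeasurable g₂))
      (hm.sub (Lp.aestronglyMeasurable g₁)) (by norm_num)
    refine le_trans (le_of_eq ?_) this
    congr 1
    ext y
    simp
  replace key := (eLpNorm_eq_zero_iff
    ((Lp.aestronglyMeasurable g₁).sub (Lp.aestronglyMeasurable g₂)) (by simp)).1 key
  refine Lp.ext ?_
  filter_upwards [key] with y hy using sub_eq_zero.1 hy

end FourierBessel

end

noncomputable section
namespace FourierBessel

open scoped ComplexConjugate

/-! Write `F` for the transform, `e_s` for the Gaussian `exp (-π s x ^ 2)`, and `P_s` for the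
integral operator with kernel `heat α s`, so that `F` turns multiplication by `e_s` into `P_s`. The
proof splits phase space into the regions where the frequency `ξ` is below, respectively above, the
position `y`. The operator `K = ∫ P_s (π y ^ 2 e_s) ds` over `s > 0`, whose kernel is
`cutoffKernel`, formally has the symbol `y ^ 2 / (y ^ 2 + ξ ^ 2)`. The same operator applied on the
side of `F f` has the complementary symbol.

That the two cutoffs add up to the identity is made exact by the pairing `G(s) = ⟨e_s F f, F (e_s
f)⟩`. It tends to `0` as `s → ∞`, it approximates `‖f‖ ^ 2` as `s → 0`, and `-G'` is a form in `f`
plus a form in `F f`. Integrating in `s` and using that the heat kernel is positive, one gets `‖f‖ ^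
2 ≤ ⟨K|f|, |f|⟩ + ⟨K|F f|, |F f|⟩`, which is `lintegral_enorm_sq_le_cutoffForm`.

The integral of `K(x, y)` in `x` is at most `1`, and in `y` it is bounded uniformly in `x`. If `y`
is restricted to a thin set it is small (`exists_isThin_setLIntegral_cutoffKernel_le`). Indeed times
`s < δ / y ^ 2` contribute `O(δ)` for any set, while for `s ≥ δ / y ^ 2` a Harnack inequality
(`cutoffSlice_le`) shows that moving `y` by `1 / y`, the length in the definition of thinness, costs
only a constant factor and a change of scale. So a thin set receives at most a multiple of `ε`. The
Schur test (`cutoffForm_le`) then bounds both forms by a small multiple of `‖f‖ ^ 2` plus the mass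
outside the thin sets, and the small multiple is absorbed.

The analytic input is an explicit positive heat kernel, obtained from Weber's integral, and
Plancherel's identity, obtained from the heat kernel being an approximate identity. All pointwise
bounds on Bessel functions come from `monotone_besselJ_sq_sub`. -/

/-! ### The Bessel series: derivative, recurrence and bounds. -/

/-- The entire function `∑ wⁿ / (n! Γ(n + β))`, a common form of the Bessel functions `J` (at
`w < 0`) and `I` (at `w > 0`) of order `β - 1`. -/
def besselJ (β w : ℝ) : ℝ := ∑' n : ℕ, w ^ n / ((n.factorial : ℝ) * Real.Gamma (n + β))

theorem Gamma_natCast_add_pos {β : ℝ} (hβ : 0 < β) (n : ℕ) : 0 < Real.Gamma (n + β) :=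
  Real.Gamma_pos_of_pos (by positivity)

theorem Gamma_natCast_add_succ {β : ℝ} (hβ : 0 < β) (n : ℕ) :
    Real.Gamma ((n + 1 : ℕ) + β) = (n + β) * Real.Gamma (n + β) := by
  rw [← Real.Gamma_add_one (by positivity)]
  push_cast
  ring_nf

theorem summable_besselJ {β : ℝ} (hβ : 0 < β) (w : ℝ) :
    Summable fun n : ℕ => w ^ n / ((n.factorial : ℝ) * Real.Gamma (n + β)) := by
  refine Summable.of_norm_bounded_eventually_nat (Real.summable_pow_div_factorial |w|) ?_
  filter_upwards [eventually_ge_atTop 2] with n hn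
  have hn' : (2 : ℝ) ≤ n := by exact_mod_cast hn
  have hG : 1 ≤ Real.Gamma (n + β) := by
    have := Real.Gamma_strictMonoOn_Ici.monotoneOn (a := 2) (b := (n : ℝ) + β)
      (by simp) (by simp only [mem_Ici]; linarith) (by linarith)
    rwa [Real.Gamma_two] at this
  have hf : (0 : ℝ) < n.factorial := by positivity
  rw [norm_div, norm_pow, norm_mul, Real.norm_of_nonneg hf.le,
    Real.norm_of_nonneg (by linarith : 0 ≤ Real.Gamma (n + β)), Real.norm_eq_abs]
  gcongr
  nlinarith

theorem hasSum_besselJ {β : ℝ} (hβ : 0 < β) (w : ℝ) :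
    HasSum (fun n : ℕ => w ^ n / ((n.factorial : ℝ) * Real.Gamma (n + β))) (besselJ β w) :=
  (summable_besselJ hβ w).hasSum

theorem besselJ_zero {β : ℝ} : besselJ β 0 = 1 / Real.Gamma β := by
  rw [besselJ, tsum_eq_single 0]
  · simp
  · intro n hn
    simp [hn]

theorem besselJ_zero_pos {β : ℝ} (hβ : 0 < β) : 0 < besselJ β 0 := by
  rw [besselJ_zero]
  have := Real.Gamma_pos_of_pos hβ
  positivity

theorem besselJ_mono {β : ℝ} (hβ : 0 < β) {v w : ℝ} (hv : 0 ≤ v) (hvw : v ≤ w) :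
    besselJ β v ≤ besselJ β w := by
  refine (summable_besselJ hβ v).tsum_le_tsum (fun n => ?_) (summable_besselJ hβ w)
  have := Gamma_natCast_add_pos hβ n
  gcongr

theorem besselJ_pos {β : ℝ} (hβ : 0 < β) {w : ℝ} (hw : 0 ≤ w) : 0 < besselJ β w :=
  (besselJ_zero_pos hβ).trans_le (besselJ_mono hβ le_rfl hw)

theorem hasDerivAt_besselJ {β : ℝ} (hβ : 0 < β) (w : ℝ) :
    HasDerivAt (besselJ β) (besselJ (β + 1) w) w := by
  set R := |w| + 1 with hR
  have hshift : ∀ (z : ℝ) (n : ℕ),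
      ((n + 1 : ℕ) : ℝ) * z ^ (n + 1 - 1) / (((n + 1).factorial : ℝ) * Real.Gamma ((n + 1 : ℕ) + β))
        = z ^ n / ((n.factorial : ℝ) * Real.Gamma (n + (β + 1))) := by
    intro z n
    have h1 : ((n + 1 : ℕ) : ℝ) + β = n + (β + 1) := by push_cast; ring
    have h2 := Gamma_natCast_add_pos (by linarith : 0 < β + 1) n
    rw [h1, Nat.factorial_succ, Nat.add_sub_cancel]
    push_cast
    field_simp
  have hsum : ∀ z : ℝ, Summable fun n : ℕ =>
      (n : ℝ) * z ^ (n - 1) / ((n.factorial : ℝ) * Real.Gamma (n + β)) := by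
    intro z
    rw [← summable_nat_add_iff 1]
    simpa only [hshift] using summable_besselJ (by linarith : 0 < β + 1) z
  have key := hasDerivAt_tsum_of_isPreconnected (t := Metric.ball (0 : ℝ) R) (y₀ := 0) (y := w)
    (g := fun (n : ℕ) z => z ^ n / ((n.factorial : ℝ) * Real.Gamma (n + β)))
    (g' := fun (n : ℕ) z => (n : ℝ) * z ^ (n - 1) / ((n.factorial : ℝ) * Real.Gamma (n + β)))
    (hsum R) Metric.isOpen_ball (convex_ball (0 : ℝ) R).isPreconnected
    (fun n z _ => (hasDerivAt_pow n z).div_const _) (fun n z hz => ?_)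
    (Metric.mem_ball_self (by positivity)) (summable_besselJ hβ 0)
    (by simp [hR])
  · convert! key using 1
    rw [(hsum w).tsum_eq_zero_add]
    simp only [hshift]
    simp [besselJ]
  · have := Gamma_natCast_add_pos hβ n
    rw [mem_ball_zero_iff, Real.norm_eq_abs] at hz
    rw [norm_div, norm_mul, norm_pow, norm_mul, Real.norm_of_nonneg this.le, Real.norm_natCast,
      Real.norm_natCast, Real.norm_eq_abs]
    gcongr

theorem continuous_besselJ {β : ℝ} (hβ : 0 < β) : Continuous (besselJ β) :=
  continuous_iff_continuousAt.2 fun w => (hasDerivAt_besselJ hβ w).continuousAt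

/-- Coefficientwise this is `Γ (n + β + 1) = (n + β) Γ (n + β)`: the summand `β` gives the first
term, and the summand `n` cancels against the factorial and gives the second. -/
theorem besselJ_recurrence {β : ℝ} (hβ : 0 < β) (w : ℝ) :
    besselJ β w = β * besselJ (β + 1) w + w * besselJ (β + 1 + 1) w := by
  have h1 := (hasSum_besselJ (by linarith : 0 < β + 1) w).mul_left β
  have h2 : HasSum (fun n : ℕ => n * w ^ n / ((n.factorial : ℝ) * Real.Gamma (n + (β + 1))))
      (w * besselJ (β + 1 + 1) w) := by
    rw [← hasSum_nat_add_iff' 1]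
    simp only [Finset.range_one, Finset.sum_singleton, CharP.cast_eq_zero, zero_mul, zero_div,
      sub_zero]
    convert! (hasSum_besselJ (by linarith : 0 < β + 1 + 1) w).mul_left w using 2 with n
    have h1 : ((n + 1 : ℕ) : ℝ) + (β + 1) = n + (β + 1 + 1) := by push_cast; ring
    have h2 := Gamma_natCast_add_pos (by linarith : 0 < β + 1 + 1) n
    rw [h1, Nat.factorial_succ]
    push_cast
    field_simp
    ring
  refine (HasSum.tsum_eq ?_ : besselJ β w = _)
  convert! h1.add h2 using 2 with n
  have h3 := Gamma_natCast_add_pos hβ n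
  have h4 : Real.Gamma (n + (β + 1)) = (n + β) * Real.Gamma (n + β) := by
    rw [← Gamma_natCast_add_succ hβ n]; push_cast; ring_nf
  rw [h4]
  have : (0 : ℝ) < n + β := by positivity
  field_simp
  ring

/-- By the recurrence the derivative collapses to `(2β - 1)` times a square, which is where the
lower bound on the order enters. Comparison with the value at `0` controls the oscillating side `w ≤
0` and the growing side `w ≥ 0` at once. -/
theorem monotone_besselJ_sq_sub {β : ℝ} (hβ : 1 / 2 ≤ β) :
    Monotone fun w => besselJ β w ^ 2 - w * besselJ (β + 1) w ^ 2 := by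
  have hd : ∀ w, HasDerivAt (fun w => besselJ β w ^ 2 - w * besselJ (β + 1) w ^ 2)
      ((2 * β - 1) * besselJ (β + 1) w ^ 2) w := by
    intro w
    have h1 := (hasDerivAt_besselJ (by linarith : 0 < β) w).pow 2
    have h2 := (hasDerivAt_id' w).mul ((hasDerivAt_besselJ (by linarith : 0 < β + 1) w).pow 2)
    convert! h1.sub h2 using 1
    have := besselJ_recurrence (by linarith : 0 < β) w
    simp only [Nat.cast_ofNat, Nat.add_one_sub_one, pow_one, Pi.pow_apply]
    rw [this]
    ring
  refine monotone_of_deriv_nonneg (fun w => (hd w).differentiableAt) fun w => ?_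
  rw [(hd w).deriv]
  have : 0 ≤ 2 * β - 1 := by linarith
  positivity

theorem abs_besselJ_le_of_nonpos {β : ℝ} (hβ : 1 / 2 ≤ β) {w : ℝ} (hw : w ≤ 0) :
    |besselJ β w| ≤ besselJ β 0 := by
  refine abs_le_of_sq_le_sq ?_ (besselJ_zero_pos (by linarith)).le
  have := monotone_besselJ_sq_sub hβ hw
  simp only [zero_mul, sub_zero] at this
  nlinarith [sq_nonneg (besselJ (β + 1) w)]

/-- The sign of the derivative is that of `z * besselJ (β + 1) (z ^ 2) - besselJ β (z ^ 2)`, which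
is nonpositive because the monotone quantity above is nonnegative at `z ^ 2`. This is the source of
every pointwise comparison of heat kernels. -/
theorem antitoneOn_exp_mul_besselJ {β : ℝ} (hβ : 1 / 2 ≤ β) :
    AntitoneOn (fun z => Real.exp (-2 * z) * besselJ β (z ^ 2)) (Ici 0) := by
  have hd : ∀ z, HasDerivAt (fun z => Real.exp (-2 * z) * besselJ β (z ^ 2))
      (Real.exp (-2 * z) * (2 * (z * besselJ (β + 1) (z ^ 2) - besselJ β (z ^ 2)))) z := by
    intro z
    have h1 : HasDerivAt (fun z => Real.exp (-2 * z)) (Real.exp (-2 * z) * (-2)) z := by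
      simpa using ((hasDerivAt_id' z).const_mul (-2)).exp
    have h2 := (hasDerivAt_besselJ (by linarith : 0 < β) (z ^ 2)).comp z (hasDerivAt_pow 2 z)
    convert! h1.mul h2 using 1
    simp
    ring
  refine antitoneOn_of_deriv_nonpos (convex_Ici 0)
    (fun z _ => (hd z).continuousAt.continuousWithinAt)
    (fun z _ => (hd z).differentiableAt.differentiableWithinAt) fun z hz => ?_
  rw [interior_Ici, mem_Ioi] at hz
  rw [(hd z).deriv]
  have h0 := monotone_besselJ_sq_sub hβ (sq_nonneg z)
  simp only [zero_mul, sub_zero] at h0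
  have : z * besselJ (β + 1) (z ^ 2) ≤ besselJ β (z ^ 2) := by
    refine abs_le_of_sq_le_sq' ?_ (besselJ_pos (by linarith) (sq_nonneg z)).le |>.2
    rw [mul_pow]
    nlinarith [sq_nonneg (besselJ β 0)]
  exact mul_nonpos_of_nonneg_of_nonpos (Real.exp_pos _).le (by linarith)

theorem abs_besselJ_le {β : ℝ} (hβ : 1 / 2 ≤ β) (w : ℝ) :
    |besselJ β w| ≤ besselJ β 0 * Real.exp (2 * √|w|) := by
  rcases le_total w 0 with hw | hw
  · refine (abs_besselJ_le_of_nonpos hβ hw).trans ?_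
    exact le_mul_of_one_le_right (besselJ_zero_pos (by linarith)).le
      (Real.one_le_exp (by positivity))
  · rw [abs_of_pos (besselJ_pos (by linarith) hw), abs_of_nonneg hw]
    have := antitoneOn_exp_mul_besselJ hβ (mem_Ici.2 le_rfl) (mem_Ici.2 (Real.sqrt_nonneg w))
      (Real.sqrt_nonneg w)
    simp only [mul_zero, Real.exp_zero, one_mul, Real.sq_sqrt hw, ne_eq, OfNat.ofNat_ne_zero,
      not_false_eq_true, zero_pow] at this
    calc besselJ β w = Real.exp (2 * √w) * (Real.exp (-2 * √w) * besselJ β w) := by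
          rw [← mul_assoc, ← Real.exp_add]; simp
      _ ≤ Real.exp (2 * √w) * besselJ β 0 := by gcongr
      _ = _ := mul_comm _ _

theorem j_eq_besselJ (α x : ℝ) : j α x = 1 / (2 : ℝ) ^ α * besselJ (α + 1) (-(x / 2) ^ 2) := by
  simp only [j, besselJ]
  congr 1
  refine tsum_congr fun n => ?_
  rw [neg_pow ((x / 2) ^ 2), pow_mul, add_assoc]
  ring

/-! ### Gamma quotients summed against the exponential series. -/

/-- A Vandermonde identity: the rising factorial of `n + β` is expanded in falling factorials of
`n`, because the latter can be summed against `r ^ n / n!`. -/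
theorem Gamma_add_div_Gamma_eq_sum {β : ℝ} (hβ : 0 < β) (n m : ℕ) :
    Real.Gamma ((n + m : ℕ) + β) / Real.Gamma (n + β) =
      ∑ k ∈ Finset.range (m + 1),
        (m.choose k : ℝ) * n.descFactorial k * (Real.Gamma (m + β) / Real.Gamma (k + β)) := by
  have hG := Gamma_natCast_add_pos hβ
  induction m with
  | zero =>
    have h0 := (hG n).ne'
    have h1 := (Real.Gamma_pos_of_pos hβ).ne'
    simp [h0, h1]
  | succ m ih =>
    have hD : ∀ k : ℕ, (n.descFactorial (k + 1) : ℝ) = (n - k) * n.descFactorial k := by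
      intro k
      rw [Nat.descFactorial_succ]
      rcases le_or_gt k n with h | h
      · push_cast [h]; rfl
      · simp [Nat.descFactorial_of_lt h]
    have hC : ∀ k : ℕ, ((m.choose (k + 1) : ℕ) : ℝ) * (k + 1) = m.choose k * (m - k) := by
      intro k
      have := Nat.choose_succ_right_eq m k
      rcases le_or_gt k m with h | h
      · have h2 := congrArg (Nat.cast (R := ℝ)) this
        push_cast [h] at h2
        exact h2
      · simp [Nat.choose_eq_zero_of_lt h, Nat.choose_eq_zero_of_lt (h.trans (Nat.lt_succ_self k))]
    set g : ℕ → ℝ := fun k => Real.Gamma (k + β) with hg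
    have hgs : ∀ k, g (k + 1) = (k + β) * g k := fun k => Gamma_natCast_add_succ hβ k
    have hgp : ∀ k, 0 < g k := hG
    have ih' : g (n + m) / g n = ∑ k ∈ Finset.range (m + 1),
        (m.choose k : ℝ) * n.descFactorial k * (g m / g k) := ih
    change g (n + (m + 1)) / g n = ∑ k ∈ Finset.range (m + 1 + 1),
        ((m + 1).choose k : ℝ) * n.descFactorial k * (g (m + 1) / g k)
    set t : ℕ → ℝ := fun k => (m.choose k : ℝ) * n.descFactorial k * (g m / g k) with ht
    have htop : t (m + 1) = 0 := by simp [ht]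
    have e1 : ∑ k ∈ Finset.range (m + 1), t k
        = (∑ k ∈ Finset.range (m + 1), t (k + 1)) + t 0 := by
      rw [← Finset.sum_range_succ', Finset.sum_range_succ _ (m + 1), htop, add_zero]
    have e2 : ∑ k ∈ Finset.range (m + 1), (k : ℝ) * t k
        = ∑ k ∈ Finset.range (m + 1), ((k : ℝ) + 1) * t (k + 1) := by
      have h1 := Finset.sum_range_succ' (fun k : ℕ => (k : ℝ) * t k) (m + 1)
      rw [Finset.sum_range_succ _ (m + 1), htop] at h1
      push_cast at h1
      simpa using h1
    -- Pascal's rule gives the first term; in the other part `m + β` is written as `(k + β) + (m -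
    -- k)`. After summation the sums weighted by `k` cancel through `e2`, leaving the factor `n + m
    -- + β`.
    have e3 : ∀ k : ℕ, ((m + 1).choose (k + 1) : ℝ) * n.descFactorial (k + 1) *
        (g (m + 1) / g (k + 1)) = (m + β) * t (k + 1) + ((k : ℝ) + 1) * t (k + 1)
          + (n - k) * t k := by
      intro k
      have h1 := hC k
      have h2 := hgp k
      have hk : (0 : ℝ) < k + β := by positivity
      simp only [ht]
      rw [Nat.choose_succ_succ, hD, hgs, hgs]
      push_cast
      have h3 : (m.choose (k + 1) : ℝ) = m.choose k * (m - k) / (k + 1) := by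
        rw [← h1]; field_simp
      rw [h3]
      field_simp
      ring
    have e4 : ((m + 1).choose 0 : ℝ) * n.descFactorial 0 * (g (m + 1) / g 0) = (m + β) * t 0 := by
      simp only [ht, hgs]
      simp
      ring
    rw [Finset.sum_range_succ', Finset.sum_congr rfl fun k _ => e3 k, Finset.sum_add_distrib,
      Finset.sum_add_distrib, ← e2, ← Finset.mul_sum, e4,
      show n + (m + 1) = (n + m) + 1 by ring, hgs, mul_div_assoc, ih']
    have e5 : ∑ k ∈ Finset.range (m + 1), ((n : ℝ) - k) * t k =
        n * ∑ k ∈ Finset.range (m + 1), t k - ∑ k ∈ Finset.range (m + 1), (k : ℝ) * t k := by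
      simp only [sub_mul, Finset.sum_sub_distrib, Finset.mul_sum]
    rw [e5]
    push_cast
    linear_combination (m + β) * e1

theorem hasSum_pow_div_factorial_mul_descFactorial (r : ℝ) (k : ℕ) :
    HasSum (fun n : ℕ => r ^ n / (n.factorial : ℝ) * n.descFactorial k) (r ^ k * Real.exp r) := by
  rw [← hasSum_nat_add_iff' k, Finset.sum_eq_zero, sub_zero]
  · have h := (Real.exp_eq_exp_ℝ ▸ NormedSpace.expSeries_div_hasSum_exp (𝔸 := ℝ) r :
      HasSum (fun n : ℕ => r ^ n / (n.factorial : ℝ)) (Real.exp r)).mul_left (r ^ k)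
    convert! h using 2 with n
    have h1 := Nat.factorial_mul_descFactorial (Nat.le_add_left k n)
    rw [Nat.add_sub_cancel] at h1
    rw [← h1, pow_add]
    have h2 : ((n + k).descFactorial k : ℝ) ≠ 0 := by
      rw [Nat.cast_ne_zero]; intro h3
      rw [h3, mul_zero] at h1
      exact (Nat.factorial_ne_zero _) h1.symm
    push_cast
    field_simp
  · intro n hn
    simp [Nat.descFactorial_of_lt (Finset.mem_range.1 hn)]

theorem hasSum_pow_mul_Gamma_div_Gamma {β : ℝ} (hβ : 0 < β) (r : ℝ) (m : ℕ) :
    HasSum (fun n : ℕ => r ^ n / (n.factorial : ℝ) *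
        (Real.Gamma ((n + m : ℕ) + β) / Real.Gamma (n + β)))
      (Real.exp r * ∑ k ∈ Finset.range (m + 1),
        (m.choose k : ℝ) * r ^ k * (Real.Gamma (m + β) / Real.Gamma (k + β))) := by
  simp only [Gamma_add_div_Gamma_eq_sum hβ, Finset.mul_sum]
  refine hasSum_sum fun k _ => ?_
  convert! (hasSum_pow_div_factorial_mul_descFactorial r k).mul_left
    ((m.choose k : ℝ) * (Real.Gamma (m + β) / Real.Gamma (k + β))) using 1
  · ext n; ring
  · ring

/-! ### Gaussian moments and Weber's exponential integrals. -/

theorem ae_mu_pos (α : ℝ) : ∀ᵐ x ∂mu α, 0 < x :=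
  (withDensity_absolutelyContinuous _ _).ae_le (ae_restrict_mem measurableSet_Ioi)

theorem measurable_density (α : ℝ) :
    Measurable fun x : ℝ => ENNReal.ofReal ((2 * Real.pi) ^ (α + 1) * x ^ (2 * α + 1)) := by
  fun_prop

theorem integrable_mu_iff {α : ℝ} {f : ℝ → ℝ} :
    Integrable f (mu α) ↔
      IntegrableOn (fun x => (2 * Real.pi) ^ (α + 1) * x ^ (2 * α + 1) * f x) (Ioi 0) := by
  rw [mu, integrable_withDensity_iff_integrable_smul' (measurable_density α)
    (Eventually.of_forall fun x => ENNReal.ofReal_lt_top)]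
  refine integrableOn_congr_fun (fun x hx => ?_) measurableSet_Ioi
  have : 0 ≤ x := (mem_Ioi.1 hx).le
  rw [smul_eq_mul, ENNReal.toReal_ofReal (by positivity)]

theorem integral_mu (α : ℝ) (f : ℝ → ℝ) :
    ∫ x, f x ∂mu α = ∫ x in Ioi 0, (2 * Real.pi) ^ (α + 1) * x ^ (2 * α + 1) * f x := by
  rw [mu, integral_withDensity_eq_integral_toReal_smul (measurable_density α)
    (Eventually.of_forall fun x => ENNReal.ofReal_lt_top)]
  refine setIntegral_congr_fun measurableSet_Ioi (fun x hx => ?_)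
  have : 0 ≤ x := (mem_Ioi.1 hx).le
  rw [smul_eq_mul, ENNReal.toReal_ofReal (by positivity)]

theorem density_mul_pow {α : ℝ} (b : ℝ) (n : ℕ) {x : ℝ} (hx : 0 < x) :
    (2 * Real.pi) ^ (α + 1) * x ^ (2 * α + 1) * (x ^ (2 * n) * Real.exp (-b * x ^ 2)) =
      (2 * Real.pi) ^ (α + 1) *
        (x ^ (2 * α + 1 + (2 * n : ℕ)) * Real.exp (-b * x ^ (2 : ℝ))) := by
  rw [Real.rpow_add hx (2 * α + 1), Real.rpow_natCast, Real.rpow_ofNat]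
  ring

theorem integrable_pow_mul_exp {α : ℝ} (hα : -1 / 2 < α) {b : ℝ} (hb : 0 < b) (n : ℕ) :
    Integrable (fun x => x ^ (2 * n) * Real.exp (-b * x ^ 2)) (mu α) := by
  rw [integrable_mu_iff]
  have h := (integrableOn_rpow_mul_exp_neg_mul_rpow (p := 2) (s := 2 * α + 1 + (2 * n : ℕ)) (b := b)
    (by push_cast; linarith [(Nat.cast_nonneg n : (0 : ℝ) ≤ n)]) (by norm_num) hb).const_mul
    ((2 * Real.pi) ^ (α + 1))
  exact IntegrableOn.congr_fun h (fun x hx => (density_mul_pow b n hx).symm) measurableSet_Ioi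

/-- The mass of `exp (-b x ^ 2)`, divided by `Γ (α + 1)`. -/
def gaussMass (α b : ℝ) : ℝ := 2 ^ α * (Real.pi / b) ^ (α + 1)

theorem gaussMass_pos {α b : ℝ} (hb : 0 < b) : 0 < gaussMass α b := by
  unfold gaussMass; positivity

theorem integral_pow_mul_exp {α : ℝ} (hα : -1 / 2 < α) {b : ℝ} (hb : 0 < b) (n : ℕ) :
    ∫ x, x ^ (2 * n) * Real.exp (-b * x ^ 2) ∂mu α =
      gaussMass α b * (Real.Gamma (n + (α + 1)) / b ^ n) := by
  rw [integral_mu, setIntegral_congr_fun measurableSet_Ioi (fun x hx => density_mul_pow b n hx),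
    integral_const_mul, integral_rpow_mul_exp_neg_mul_rpow (by norm_num)
      (by push_cast; linarith [(Nat.cast_nonneg n : (0 : ℝ) ≤ n)]) hb]
  have h1 : (2 * α + 1 + (2 * n : ℕ) + 1) / 2 = (n : ℝ) + (α + 1) := by push_cast; ring
  rw [neg_div, h1, gaussMass, Real.rpow_neg hb.le, Real.rpow_add hb, Real.rpow_natCast,
    Real.mul_rpow (by norm_num) Real.pi_pos.le, Real.div_rpow Real.pi_pos.le hb.le,
    Real.rpow_add_one (by norm_num : (2 : ℝ) ≠ 0)]
  have : 0 < b ^ (α + 1) := by positivity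
  field_simp

theorem abs_exp_mul_besselJ_le {β : ℝ} (hβ : 1 / 2 ≤ β) {b : ℝ} (hb : 0 < b) (A : ℝ) {x : ℝ}
    (hx : 0 < x) :
    Real.exp (-b * x ^ 2) * |besselJ β (A * x ^ 2)| ≤
      besselJ β 0 * Real.exp (2 * |A| / b) * Real.exp (-(b / 2) * x ^ 2) := by
  have h1 := abs_besselJ_le hβ (A * x ^ 2)
  have h0 := besselJ_zero_pos (by linarith : 0 < β)
  have hs : √|A * x ^ 2| = √|A| * x := by
    rw [abs_mul, abs_of_nonneg (sq_nonneg x), Real.sqrt_mul (abs_nonneg A), Real.sqrt_sq hx.le]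
  -- By AM-GM, half of the Gaussian absorbs the exponential growth of the Bessel factor.
  have h2 : 2 * (√|A| * x) ≤ 2 * |A| / b + b / 2 * x ^ 2 := by
    have hA := Real.sq_sqrt (abs_nonneg A)
    rw [div_add' _ _ _ hb.ne', le_div_iff₀ hb]
    nlinarith [sq_nonneg (2 * √|A| - b * x)]
  calc Real.exp (-b * x ^ 2) * |besselJ β (A * x ^ 2)|
      ≤ Real.exp (-b * x ^ 2) * (besselJ β 0 * Real.exp (2 * |A| / b + b / 2 * x ^ 2)) := by
        gcongr
        refine h1.trans ?_
        rw [hs]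
        gcongr
    _ = _ := by
        rw [mul_left_comm, ← Real.exp_add, mul_assoc, ← Real.exp_add]
        ring_nf

theorem measurable_besselJ {β : ℝ} (hβ : 0 < β) : Measurable (besselJ β) :=
  (continuous_besselJ hβ).measurable

theorem integrable_pow_mul_exp_mul_besselJ {α : ℝ} (hα : -1 / 2 < α) {b : ℝ} (hb : 0 < b) (n : ℕ)
    (A : ℝ) :
    Integrable (fun x => x ^ (2 * n) * Real.exp (-b * x ^ 2) * besselJ (α + 1) (A * x ^ 2))
      (mu α) := by
  have hJ := continuous_besselJ (by linarith : 0 < α + 1)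
  refine ((integrable_pow_mul_exp hα (half_pos hb) n).const_mul
    (besselJ (α + 1) 0 * Real.exp (2 * |A| / b))).mono'
      (by fun_prop) ?_
  filter_upwards [ae_mu_pos α] with x hx
  have := abs_exp_mul_besselJ_le (by linarith : 1 / 2 ≤ α + 1) hb A hx
  rw [Real.norm_eq_abs, abs_mul, abs_mul, abs_of_pos (Real.exp_pos _), mul_assoc,
    abs_of_nonneg (by positivity : 0 ≤ x ^ (2 * n))]
  refine (mul_le_mul_of_nonneg_left this (by positivity)).trans_eq ?_
  ring

/-- Termwise integration produces Gaussian moments, and the remaining series of Gamma quotients is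
summed by `hasSum_pow_mul_Gamma_div_Gamma`. The case `m = 1` is also used alone, for the second
moment of the heat kernel. -/
theorem integral_pow_mul_exp_mul_besselJ {α : ℝ} (hα : -1 / 2 < α) {b : ℝ} (hb : 0 < b) (m : ℕ)
    (B : ℝ) :
    ∫ x, x ^ (2 * m) * Real.exp (-b * x ^ 2) * besselJ (α + 1) (B * x ^ 2) ∂mu α =
      gaussMass α b / b ^ m * (Real.exp (B / b) * ∑ k ∈ Finset.range (m + 1),
        (m.choose k : ℝ) * (B / b) ^ k *
          (Real.Gamma (m + (α + 1)) / Real.Gamma (k + (α + 1)))) := by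
  have hβ : 0 < α + 1 := by linarith
  set F : ℕ → ℝ → ℝ := fun n x => B ^ n / ((n.factorial : ℝ) * Real.Gamma (n + (α + 1))) *
    (x ^ (2 * (n + m)) * Real.exp (-b * x ^ 2)) with hF
  have hFi : ∀ n, Integrable (F n) (mu α) := fun n =>
    (integrable_pow_mul_exp hα hb (n + m)).const_mul _
  have hc : ∀ (B : ℝ) (n : ℕ), B ^ n / ((n.factorial : ℝ) * Real.Gamma (n + (α + 1))) *
      (gaussMass α b * (Real.Gamma ((n + m : ℕ) + (α + 1)) / b ^ (n + m))) =
      gaussMass α b / b ^ m * ((B / b) ^ n / (n.factorial : ℝ) *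
        (Real.Gamma ((n + m : ℕ) + (α + 1)) / Real.Gamma (n + (α + 1)))) := by
    intro B n
    have := Gamma_natCast_add_pos hβ n
    rw [pow_add, div_pow]
    field_simp
  have hint : ∀ n, ∫ x, F n x ∂mu α = gaussMass α b / b ^ m * ((B / b) ^ n / (n.factorial : ℝ) *
        (Real.Gamma ((n + m : ℕ) + (α + 1)) / Real.Gamma (n + (α + 1)))) := by
    intro n
    rw [integral_const_mul, integral_pow_mul_exp hα hb, hc]
  have hnorm : ∀ n, ∫ x, ‖F n x‖ ∂mu α = gaussMass α b / b ^ m *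
      ((|B| / b) ^ n / (n.factorial : ℝ) *
        (Real.Gamma ((n + m : ℕ) + (α + 1)) / Real.Gamma (n + (α + 1)))) := by
    intro n
    have h1 : ∀ x, ‖F n x‖ = |B| ^ n / ((n.factorial : ℝ) * Real.Gamma (n + (α + 1))) *
        (x ^ (2 * (n + m)) * Real.exp (-b * x ^ 2)) := by
      intro x
      have := Gamma_natCast_add_pos hβ n
      rw [hF, norm_mul, norm_div, norm_pow, Real.norm_eq_abs, Real.norm_of_nonneg (by positivity),
        Real.norm_of_nonneg (mul_nonneg (by rw [pow_mul]; positivity) (Real.exp_pos _).le)]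
    simp only [h1]
    rw [integral_const_mul, integral_pow_mul_exp hα hb, hc]
  have key := hasSum_integral_of_summable_integral_norm hFi (by
    simp only [hnorm]
    exact ((hasSum_pow_mul_Gamma_div_Gamma hβ (|B| / b) m).summable).mul_left _)
  simp only [hint] at key
  rw [← key.unique ((hasSum_pow_mul_Gamma_div_Gamma hβ (B / b) m).mul_left _)]
  congr 1
  ext x
  have h2 := ((hasSum_besselJ hβ (B * x ^ 2)).mul_left
    (x ^ (2 * m) * Real.exp (-b * x ^ 2))).tsum_eq
  rw [← h2]
  refine tsum_congr fun n => ?_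
  simp only [hF]
  rw [mul_add, pow_add, mul_pow, ← pow_mul]
  ring

/-- `Γ (m + β)` cancels and the binomial coefficient splits `m!`, so up to the factor `exp r` this
is the Cauchy product of the Bessel series at `a * r` with the exponential series at `a`. -/
theorem hasSum_mul_exp_mul_sum {β : ℝ} (hβ : 0 < β) (a r : ℝ) :
    HasSum (fun m : ℕ => a ^ m / ((m.factorial : ℝ) * Real.Gamma (m + β)) *
        (Real.exp r * ∑ k ∈ Finset.range (m + 1),
          (m.choose k : ℝ) * r ^ k * (Real.Gamma (m + β) / Real.Gamma (k + β))))
      (Real.exp (a + r) * besselJ β (a * r)) := by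
  have h := (hasSum_sum_range_mul_of_summable_norm
    (f := fun k : ℕ => (a * r) ^ k / ((k.factorial : ℝ) * Real.Gamma (k + β)))
    (g := fun k : ℕ => a ^ k / (k.factorial : ℝ))
    (summable_besselJ hβ (a * r)).norm
    (Real.summable_pow_div_factorial a).norm).mul_left (Real.exp r)
  have he : ∑' n : ℕ, a ^ n / (n.factorial : ℝ) = Real.exp a := by
    rw [Real.exp_eq_exp_ℝ]
    exact (NormedSpace.expSeries_div_hasSum_exp (𝔸 := ℝ) a).tsum_eq
  convert! h using 1
  · ext m
    rw [mul_left_comm, Finset.mul_sum]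
    congr 1
    refine Finset.sum_congr rfl fun k hk => ?_
    have hkm : k ≤ m := by simpa [Nat.lt_succ_iff] using hk
    have h1 := Gamma_natCast_add_pos hβ k
    have h2 := Gamma_natCast_add_pos hβ m
    rw [Nat.cast_choose ℝ hkm, mul_pow]
    conv_lhs => rw [← Nat.add_sub_cancel' hkm, pow_add, Nat.add_sub_cancel' hkm]
    field_simp
  · rw [he, Real.exp_add, besselJ]
    ring

/-- Weber's second exponential integral. -/
theorem integral_exp_mul_besselJ_mul_besselJ {α : ℝ} (hα : -1 / 2 < α) {b : ℝ} (hb : 0 < b)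
    (A B : ℝ) :
    ∫ x, Real.exp (-b * x ^ 2) * besselJ (α + 1) (A * x ^ 2) * besselJ (α + 1) (B * x ^ 2) ∂mu α =
      gaussMass α b * (Real.exp (A / b + B / b) * besselJ (α + 1) (A / b * (B / b))) := by
  have hβ : 0 < α + 1 := by linarith
  have hg := gaussMass_pos (α := α) hb
  set F : ℕ → ℝ → ℝ := fun m x => A ^ m / ((m.factorial : ℝ) * Real.Gamma (m + (α + 1))) *
    (x ^ (2 * m) * Real.exp (-b * x ^ 2) * besselJ (α + 1) (B * x ^ 2)) with hF
  have hFi : ∀ m, Integrable (F m) (mu α) := fun m =>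
    (integrable_pow_mul_exp_mul_besselJ hα hb m B).const_mul _
  have hc : ∀ (A B : ℝ) (m : ℕ), A ^ m / ((m.factorial : ℝ) * Real.Gamma (m + (α + 1))) *
      (∫ x, x ^ (2 * m) * Real.exp (-b * x ^ 2) * besselJ (α + 1) (B * x ^ 2) ∂mu α) =
      gaussMass α b * ((A / b) ^ m / ((m.factorial : ℝ) * Real.Gamma (m + (α + 1))) *
        (Real.exp (B / b) * ∑ k ∈ Finset.range (m + 1), (m.choose k : ℝ) * (B / b) ^ k *
          (Real.Gamma (m + (α + 1)) / Real.Gamma (k + (α + 1))))) := by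
    intro A B m
    rw [integral_pow_mul_exp_mul_besselJ hα hb, div_pow]
    ring
  -- Only the first Bessel factor is expanded. The second one is dominated by its value at `|B|`, so
  -- absolute summability is the same summation formula at `|A|` and `|B|`.
  have hnorm : ∀ m, ∫ x, ‖F m x‖ ∂mu α ≤ |A| ^ m / ((m.factorial : ℝ) * Real.Gamma (m + (α + 1))) *
      (∫ x, x ^ (2 * m) * Real.exp (-b * x ^ 2) * besselJ (α + 1) (|B| * x ^ 2) ∂mu α) := by
    intro m
    rw [← integral_const_mul]
    refine integral_mono (hFi m).norm
      ((integrable_pow_mul_exp_mul_besselJ hα hb m |B|).const_mul _) fun x => ?_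
    have := Gamma_natCast_add_pos hβ m
    have h2 : ‖besselJ (α + 1) (B * x ^ 2)‖ ≤ besselJ (α + 1) (|B| * x ^ 2) := by
      refine tsum_of_norm_bounded (hasSum_besselJ hβ (|B| * x ^ 2)) fun n => ?_
      have := Gamma_natCast_add_pos hβ n
      rw [norm_div, norm_pow, norm_mul, Real.norm_eq_abs, Real.norm_of_nonneg (sq_nonneg x),
        Real.norm_of_nonneg (by positivity)]
    simp only [hF]
    rw [norm_mul, norm_div, norm_pow, Real.norm_eq_abs, Real.norm_of_nonneg (by positivity),
      norm_mul, Real.norm_of_nonneg (mul_nonneg (by rw [pow_mul]; positivity) (Real.exp_pos _).le)]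
    have h3 : 0 ≤ x ^ (2 * m) := by rw [pow_mul]; positivity
    gcongr
  have key := hasSum_integral_of_summable_integral_norm hFi (by
    refine Summable.of_nonneg_of_le (fun m => integral_nonneg fun x => norm_nonneg _) hnorm ?_
    simp only [hc]
    exact ((hasSum_mul_exp_mul_sum hβ (|A| / b) (|B| / b)).summable).mul_left _)
  simp only [hF, integral_const_mul, hc] at key
  rw [← key.unique ((hasSum_mul_exp_mul_sum hβ (A / b) (B / b)).mul_left _)]
  congr 1
  ext x
  have h2 := ((hasSum_besselJ hβ (A * x ^ 2)).mul_left
    (Real.exp (-b * x ^ 2) * besselJ (α + 1) (B * x ^ 2))).tsum_eq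
  rw [mul_right_comm, ← h2]
  refine tsum_congr fun n => ?_
  rw [mul_pow, ← pow_mul]
  ring

/-! ### The heat kernel: spectral formula, mass, moments and pointwise comparison. -/

/-- The heat kernel of the Bessel operator, with multiplier `exp (-π s ξ ^ 2)` under the
Fourier–Bessel transform. -/
def heat (α s x y : ℝ) : ℝ :=
  1 / 2 ^ α * (1 / s) ^ (α + 1) * Real.exp (-(Real.pi * (x ^ 2 + y ^ 2) / s)) *
    besselJ (α + 1) ((Real.pi * x * y / s) ^ 2)

/-- The Gaussian `exp (-π s x ^ 2)`. -/
def gauss (s x : ℝ) : ℝ := Real.exp (-(Real.pi * s) * x ^ 2)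

theorem gauss_pos (s x : ℝ) : 0 < gauss s x := Real.exp_pos _

theorem gauss_le_one {s : ℝ} (hs : 0 ≤ s) (x : ℝ) : gauss s x ≤ 1 := by
  have := Real.pi_pos
  refine Real.exp_le_one_iff.2 ?_
  have : 0 ≤ Real.pi * s * x ^ 2 := by positivity
  linarith

theorem measurable_gauss : Measurable fun p : ℝ × ℝ => gauss p.1 p.2 := by
  unfold gauss; fun_prop

theorem measurable_gauss_right (s : ℝ) : Measurable (gauss s) := by
  unfold gauss; fun_prop

theorem measurable_heat {α : ℝ} (hα : -1 / 2 < α) :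
    Measurable fun p : ℝ × ℝ × ℝ => heat α p.1 p.2.1 p.2.2 := by
  have hJ := measurable_besselJ (by linarith : 0 < α + 1)
  unfold heat
  fun_prop

theorem heat_comm (α s x y : ℝ) : heat α s x y = heat α s y x := by
  unfold heat
  rw [add_comm (x ^ 2), mul_right_comm Real.pi x y]

theorem heat_pos {α : ℝ} (hα : -1 / 2 < α) {s : ℝ} (hs : 0 < s) (x y : ℝ) : 0 < heat α s x y := by
  have := besselJ_pos (by linarith : 0 < α + 1) (sq_nonneg (Real.pi * x * y / s))
  unfold heat
  positivity

theorem heat_eq_mul_exp_mul_besselJ (α s x y : ℝ) :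
    heat α s x y = 1 / 2 ^ α * (1 / s) ^ (α + 1) * Real.exp (-(Real.pi * x ^ 2 / s)) *
      (Real.exp (-(Real.pi / s) * y ^ 2) *
        besselJ (α + 1) ((Real.pi * x / s) ^ 2 * y ^ 2)) := by
  unfold heat
  rw [show -(Real.pi * (x ^ 2 + y ^ 2) / s) = -(Real.pi * x ^ 2 / s) + -(Real.pi / s) * y ^ 2 by
    ring, Real.exp_add, show (Real.pi * x * y / s) ^ 2 = (Real.pi * x / s) ^ 2 * y ^ 2 by ring]
  ring

theorem gaussMass_pi_div {α s : ℝ} (hs : 0 < s) :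
    1 / 2 ^ α * (1 / s) ^ (α + 1) * gaussMass α (Real.pi / s) = 1 := by
  have := Real.pi_pos
  rw [gaussMass, div_div_cancel₀ this.ne', Real.div_rpow zero_le_one hs.le, Real.one_rpow]
  have : 0 < s ^ (α + 1) := by positivity
  have : (0 : ℝ) < 2 ^ α := by positivity
  field_simp

theorem j_two_pi_mul (α x y : ℝ) :
    j α (2 * Real.pi * x * y) = 1 / 2 ^ α * besselJ (α + 1) (-(Real.pi * y) ^ 2 * x ^ 2) := by
  rw [j_eq_besselJ]
  congr 2
  ring

theorem j_zero_pos {α : ℝ} (hα : -1 / 2 < α) : 0 < j α 0 := by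
  have := besselJ_zero_pos (by linarith : 0 < α + 1)
  rw [j_eq_besselJ]
  simp only [zero_div, ne_eq, OfNat.ofNat_ne_zero, not_false_eq_true, zero_pow, neg_zero]
  positivity

theorem abs_j_le {α : ℝ} (hα : -1 / 2 < α) (x : ℝ) : |j α x| ≤ j α 0 := by
  rw [j_eq_besselJ, j_eq_besselJ, abs_mul, abs_of_pos (by positivity)]
  have := abs_besselJ_le_of_nonpos (by linarith : 1 / 2 ≤ α + 1)
    (neg_nonpos.2 (sq_nonneg (x / 2)))
  gcongr
  simpa using this

/-- Weber's integral at two negative parameters. Their product is positive, so two oscillating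
factors integrate to a positive kernel. -/
theorem integral_gauss_mul_j_mul_j {α : ℝ} (hα : -1 / 2 < α) {s : ℝ} (hs : 0 < s) (y z : ℝ) :
    ∫ x, gauss s x * j α (2 * Real.pi * x * y) * j α (2 * Real.pi * x * z) ∂mu α =
      heat α s y z := by
  have hb : 0 < Real.pi * s := by positivity
  have h := integral_exp_mul_besselJ_mul_besselJ hα hb (-(Real.pi * y) ^ 2) (-(Real.pi * z) ^ 2)
  have h2 : (0 : ℝ) < 2 ^ α := by positivity
  calc _ = ∫ x, 1 / 2 ^ α * (1 / 2 ^ α) * (Real.exp (-(Real.pi * s) * x ^ 2) *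
        besselJ (α + 1) (-(Real.pi * y) ^ 2 * x ^ 2) *
        besselJ (α + 1) (-(Real.pi * z) ^ 2 * x ^ 2)) ∂mu α := by
        congr 1; ext x; rw [j_two_pi_mul, j_two_pi_mul, gauss]; ring
    _ = _ := by
        rw [integral_const_mul, h, gaussMass, heat, div_mul_cancel_left₀ Real.pi_ne_zero,
          one_div s,
          show -(Real.pi * y) ^ 2 / (Real.pi * s) + -(Real.pi * z) ^ 2 / (Real.pi * s) =
            -(Real.pi * (y ^ 2 + z ^ 2) / s) by field_simp; ring,
          show -(Real.pi * y) ^ 2 / (Real.pi * s) * (-(Real.pi * z) ^ 2 / (Real.pi * s)) =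
            (Real.pi * y * z / s) ^ 2 by field_simp]
        field_simp

theorem integrable_heat {α : ℝ} (hα : -1 / 2 < α) {s : ℝ} (hs : 0 < s) (x : ℝ) :
    Integrable (heat α s x) (mu α) := by
  have hb : 0 < Real.pi / s := by positivity
  have h := (integrable_pow_mul_exp_mul_besselJ hα hb 0 ((Real.pi * x / s) ^ 2)).const_mul
    (1 / 2 ^ α * (1 / s) ^ (α + 1) * Real.exp (-(Real.pi * x ^ 2 / s)))
  refine h.congr (Eventually.of_forall fun y => ?_)
  simp only [heat_eq_mul_exp_mul_besselJ α s x y, mul_zero, pow_zero, one_mul]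

/-- Weber's integral at parameters of opposite sign: the functions `j α` are eigenfunctions of the
heat flow. At `z = 0` this says that the flow preserves mass. -/
theorem integral_heat_mul_j {α : ℝ} (hα : -1 / 2 < α) {s : ℝ} (hs : 0 < s) (x z : ℝ) :
    ∫ y, heat α s x y * j α (2 * Real.pi * y * z) ∂mu α = gauss s z * j α (2 * Real.pi * x * z) := by
  have hb : 0 < Real.pi / s := by positivity
  have h := integral_exp_mul_besselJ_mul_besselJ hα hb ((Real.pi * x / s) ^ 2) (-(Real.pi * z) ^ 2)
  have hm := gaussMass_pi_div (α := α) hs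
  calc _ = ∫ y, 1 / 2 ^ α * (1 / s) ^ (α + 1) * Real.exp (-(Real.pi * x ^ 2 / s)) * (1 / 2 ^ α) *
        (Real.exp (-(Real.pi / s) * y ^ 2) * besselJ (α + 1) ((Real.pi * x / s) ^ 2 * y ^ 2) *
          besselJ (α + 1) (-(Real.pi * z) ^ 2 * y ^ 2)) ∂mu α := by
        congr 1; ext y; rw [j_two_pi_mul, heat_eq_mul_exp_mul_besselJ α s]; ring
    _ = 1 / 2 ^ α * (1 / s) ^ (α + 1) * gaussMass α (Real.pi / s) *
        (Real.exp (-(Real.pi * x ^ 2 / s)) *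
          Real.exp ((Real.pi * x / s) ^ 2 / (Real.pi / s) + -(Real.pi * z) ^ 2 / (Real.pi / s))) *
        (1 / 2 ^ α * besselJ (α + 1)
          ((Real.pi * x / s) ^ 2 / (Real.pi / s) * (-(Real.pi * z) ^ 2 / (Real.pi / s)))) := by
        rw [integral_const_mul, h]; ring
    _ = _ := by
        rw [hm, ← Real.exp_add, one_mul, gauss, j_two_pi_mul]
        congr 3
        · field_simp; ring
        · field_simp

theorem integral_heat {α : ℝ} (hα : -1 / 2 < α) {s : ℝ} (hs : 0 < s) (x : ℝ) :
    ∫ y, heat α s x y ∂mu α = 1 := by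
  have h := integral_heat_mul_j hα hs x 0
  have h0 := (j_zero_pos hα).ne'
  simp only [mul_zero, integral_mul_const] at h
  exact mul_right_cancel₀ h0 (by simpa [gauss] using h)

theorem lintegral_heat {α : ℝ} (hα : -1 / 2 < α) {s : ℝ} (hs : 0 < s) (x : ℝ) :
    ∫⁻ y, ENNReal.ofReal (heat α s x y) ∂mu α = 1 := by
  rw [← ofReal_integral_eq_lintegral_ofReal (integrable_heat hα hs x)
    (Eventually.of_forall fun y => (heat_pos hα hs x y).le), integral_heat hα hs,
    ENNReal.ofReal_one]

theorem lintegral_heat_left {α : ℝ} (hα : -1 / 2 < α) {s : ℝ} (hs : 0 < s) (y : ℝ) :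
    ∫⁻ x, ENNReal.ofReal (heat α s x y) ∂mu α = 1 := by
  simp only [heat_comm α s _ y]
  exact lintegral_heat hα hs y

/-- Multiplying the heat kernel by `gauss t` only changes the Gaussian rate in `y` to `π (1 + s t) /
s`, so this is the second moment in the Weber-type formula above with `m = 1`. -/
theorem lintegral_heat_mul_sq_mul_gauss {α : ℝ} (hα : -1 / 2 < α) {s t : ℝ} (hs : 0 < s)
    (ht : 0 ≤ t) (x : ℝ) :
    ∫⁻ y, ENNReal.ofReal (heat α s x y * (y ^ 2 * gauss t y)) ∂mu α =
      ENNReal.ofReal ((1 / (1 + s * t)) ^ (α + 1) / (1 + s * t) *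
        Real.exp (-(Real.pi * t * x ^ 2 / (1 + s * t))) *
          ((α + 1) * s / Real.pi + x ^ 2 / (1 + s * t))) := by
  have hq : 0 < 1 + s * t := by positivity
  have hb : 0 < Real.pi * (1 + s * t) / s := by positivity
  have hi := integrable_pow_mul_exp_mul_besselJ hα hb 1 ((Real.pi * x / s) ^ 2)
  have h := integral_pow_mul_exp_mul_besselJ hα hb 1 ((Real.pi * x / s) ^ 2)
  have hG := Real.Gamma_pos_of_pos (by linarith : 0 < α + 1)
  have hβ : 0 < α + 1 := by linarith
  have hfun : ∀ y, heat α s x y * (y ^ 2 * gauss t y) =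
      1 / 2 ^ α * (1 / s) ^ (α + 1) * Real.exp (-(Real.pi * x ^ 2 / s)) *
        (y ^ (2 * 1) * Real.exp (-(Real.pi * (1 + s * t) / s) * y ^ 2) *
          besselJ (α + 1) ((Real.pi * x / s) ^ 2 * y ^ 2)) := by
    intro y
    rw [heat_eq_mul_exp_mul_besselJ α s, gauss,
      show -(Real.pi * (1 + s * t) / s) * y ^ 2 =
        -(Real.pi / s) * y ^ 2 + -(Real.pi * t) * y ^ 2 by field_simp; ring, Real.exp_add]
    ring
  rw [← ofReal_integral_eq_lintegral_ofReal]
  · congr 1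
    simp only [hfun]
    rw [integral_const_mul, h, gaussMass, Finset.sum_range_succ, Finset.sum_range_one]
    have e1 : Real.pi / (Real.pi * (1 + s * t) / s) = s * (1 / (1 + s * t)) := by field_simp
    have e2 : Real.exp (-(Real.pi * x ^ 2 / s)) *
        Real.exp ((Real.pi * x / s) ^ 2 / (Real.pi * (1 + s * t) / s)) =
        Real.exp (-(Real.pi * t * x ^ 2 / (1 + s * t))) := by
      rw [← Real.exp_add]; congr 1; field_simp; ring
    have e3 : Real.Gamma ((1 : ℕ) + (α + 1)) = (α + 1) * Real.Gamma (α + 1) := by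
      rw [← Real.Gamma_add_one hβ.ne']; push_cast; ring_nf
    have e4 : (1 / s) ^ (α + 1) * s ^ (α + 1) = 1 := by
      rw [← Real.mul_rpow (by positivity) hs.le, one_div_mul_cancel hs.ne', Real.one_rpow]
    rw [← e2, e1, Real.mul_rpow hs.le (by positivity), e3]
    simp only [Nat.choose_zero_right, Nat.choose_self, Nat.cast_one, Nat.cast_zero, pow_zero,
      pow_one, one_mul, zero_add]
    set E1 := Real.exp (-(Real.pi * x ^ 2 / s))
    set E2 := Real.exp ((Real.pi * x / s) ^ 2 / (Real.pi * (1 + s * t) / s))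
    set Q := (1 / (1 + s * t)) ^ (α + 1)
    have h2 : (0 : ℝ) < 2 ^ α := by positivity
    calc _ = ((1 / s) ^ (α + 1) * s ^ (α + 1)) * (Q / (1 + s * t) * (E1 * E2) *
          ((α + 1) * s / Real.pi + x ^ 2 / (1 + s * t))) := by
          field_simp
      _ = _ := by rw [e4, one_mul]
  · refine (hi.const_mul _).congr (Eventually.of_forall fun y => (hfun y).symm)
  · refine Eventually.of_forall fun y => ?_
    have h1 := heat_pos hα hs x y
    have h2 := gauss_pos t y
    positivity

/-- The form in which the off-diagonal decay is separated from the function shown antitone in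
`antitoneOn_exp_mul_besselJ`. -/
theorem heat_eq_exp_sq_sub (α s x y : ℝ) :
    heat α s x y = 1 / 2 ^ α * (1 / s) ^ (α + 1) * Real.exp (-(Real.pi * (x - y) ^ 2 / s)) *
      (Real.exp (-2 * (Real.pi * x * y / s)) * besselJ (α + 1) ((Real.pi * x * y / s) ^ 2)) := by
  unfold heat
  rw [show -(Real.pi * (x ^ 2 + y ^ 2) / s) =
    -(Real.pi * (x - y) ^ 2 / s) + -2 * (Real.pi * x * y / s) by ring, Real.exp_add]
  ring

theorem heat_le {α : ℝ} (hα : -1 / 2 < α) {s : ℝ} (hs : 0 < s) {x y : ℝ} (hx : 0 ≤ x)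
    (hy : 0 ≤ y) : heat α s x y ≤ j α 0 * (1 / s) ^ (α + 1) := by
  have h := antitoneOn_exp_mul_besselJ (by linarith : 1 / 2 ≤ α + 1) (mem_Ici.2 le_rfl)
    (mem_Ici.2 (by positivity : 0 ≤ Real.pi * x * y / s)) (by positivity)
  have h0 := besselJ_zero_pos (by linarith : 0 < α + 1)
  have hJ := besselJ_pos (by linarith : 0 < α + 1) (sq_nonneg (Real.pi * x * y / s))
  simp only [mul_zero, Real.exp_zero, one_mul, ne_eq, OfNat.ofNat_ne_zero,
      not_false_eq_true, zero_pow] at h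
  rw [heat_eq_exp_sq_sub, j_eq_besselJ]
  calc _ ≤ 1 / 2 ^ α * (1 / s) ^ (α + 1) * 1 * besselJ (α + 1) 0 := by
        gcongr
        exact Real.exp_le_one_iff.2 (neg_nonpos.2 (by positivity))
    _ = _ := by simp; ring

/-- Doubling the time and moving `y` to `y' ≤ 2 * y` does not increase the Bessel argument, so the
antitone factor can only grow. Only the Gaussian exponents, compared in `hu`, and the power of `s`
remain. -/
theorem heat_le_heat_two_mul {α : ℝ} (hα : -1 / 2 < α) {s : ℝ} (hs : 0 < s) {x y y' : ℝ}
    (hx : 0 ≤ x) (hy' : 0 ≤ y') (hyy : y' ≤ 2 * y) {u : ℝ}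
    (hu : Real.pi * (x - y') ^ 2 / (2 * s) ≤ Real.pi * (x - y) ^ 2 / s + u) :
    heat α s x y ≤ 2 ^ (α + 1) * Real.exp u * heat α (2 * s) x y' := by
  have hy : 0 ≤ y := by linarith
  have h := antitoneOn_exp_mul_besselJ (by linarith : 1 / 2 ≤ α + 1)
    (mem_Ici.2 (by positivity : 0 ≤ Real.pi * x * y' / (2 * s)))
    (mem_Ici.2 (by positivity : 0 ≤ Real.pi * x * y / s)) (by
      rw [div_le_div_iff₀ (by positivity) hs]
      have : 0 ≤ Real.pi * x * s := by positivity
      nlinarith)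
  simp only at h
  have hJ := besselJ_pos (by linarith : 0 < α + 1) (sq_nonneg (Real.pi * x * y / s))
  rw [heat_eq_exp_sq_sub, heat_eq_exp_sq_sub]
  have e : (1 / s) ^ (α + 1) = 2 ^ (α + 1) * (1 / (2 * s)) ^ (α + 1) := by
    rw [← Real.mul_rpow (by norm_num) (by positivity)]; congr 1; field_simp
  calc _ ≤ 1 / 2 ^ α * (1 / s) ^ (α + 1) *
        Real.exp (u + -(Real.pi * (x - y') ^ 2 / (2 * s))) *
        (Real.exp (-2 * (Real.pi * x * y' / (2 * s))) *
          besselJ (α + 1) ((Real.pi * x * y' / (2 * s)) ^ 2)) := by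
        gcongr
        linarith
    _ = _ := by rw [Real.exp_add, e]; ring

/-- A Harnack inequality. -/
theorem heat_le_exp_mul_heat {α : ℝ} (hα : -1 / 2 < α) {s : ℝ} (hs : 0 < s) {x y y' : ℝ}
    (hx : 0 ≤ x) (hy' : 0 ≤ y') (hyy : y' ≤ 2 * y) :
    heat α s x y ≤
      2 ^ (α + 1) * Real.exp (Real.pi * (y - y') ^ 2 / s) * heat α (2 * s) x y' := by
  refine heat_le_heat_two_mul hα hs hx hy' hyy ?_
  rw [← add_div, div_le_div_iff₀ (by positivity) hs]
  have : 0 ≤ Real.pi * s := by positivity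
  nlinarith [mul_nonneg this (sq_nonneg ((x - y) - (y - y')))]

/-- Half of the Gaussian exponent absorbs the square, through `v * exp (-v) ≤ 1`. This gives second
moments of order `s` and hence concentration on the diagonal. -/
theorem sq_sub_mul_heat_le {α : ℝ} (hα : -1 / 2 < α) {s : ℝ} (hs : 0 < s) {x y : ℝ}
    (hx : 0 ≤ x) (hy : 0 ≤ y) :
    (x - y) ^ 2 * heat α s x y ≤ 2 ^ (α + 1) * (2 * s / Real.pi) * heat α (2 * s) x y := by
  have h := heat_le_heat_two_mul hα hs hx hy (by linarith : y ≤ 2 * y)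
    (u := -(Real.pi * (x - y) ^ 2 / (2 * s))) (le_of_eq (by field_simp; ring))
  have hp := heat_pos hα (by positivity : 0 < 2 * s) x y
  set v := Real.pi * (x - y) ^ 2 / (2 * s) with hv
  have hv' : (x - y) ^ 2 = 2 * s / Real.pi * v := by rw [hv]; field_simp
  have hve : v * Real.exp (-v) ≤ 1 := by
    rw [Real.exp_neg, ← div_eq_mul_inv, div_le_one (Real.exp_pos _)]
    linarith [Real.add_one_le_exp v]
  calc (x - y) ^ 2 * heat α s x y
      ≤ (x - y) ^ 2 * (2 ^ (α + 1) * Real.exp (-v) * heat α (2 * s) x y) := by gcongr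
    _ = 2 ^ (α + 1) * (2 * s / Real.pi) * (v * Real.exp (-v)) * heat α (2 * s) x y := by
        rw [hv']; ring
    _ ≤ 2 ^ (α + 1) * (2 * s / Real.pi) * 1 * heat α (2 * s) x y := by gcongr
    _ = _ := by ring

/-! ### The energy form and its vanishing for small times. -/

theorem eLpNorm_two_sq {μ : Measure ℝ} (f : ℝ → ℂ) :
    eLpNorm f 2 μ ^ 2 = ∫⁻ x, ‖f x‖ₑ ^ 2 ∂μ := by
  have := eLpNorm_nnreal_pow_eq_lintegral (f := f) (μ := μ) (p := 2) (by norm_num)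
  simpa using this

theorem lintegral_enorm_sq_lt_top {μ : Measure ℝ} {f : ℝ → ℂ} (hf : MemLp f 2 μ) :
    ∫⁻ x, ‖f x‖ₑ ^ 2 ∂μ < ∞ := by
  rw [← eLpNorm_two_sq]
  exact ENNReal.pow_lt_top hf.eLpNorm_lt_top

theorem measurable_heat_right {α : ℝ} (hα : -1 / 2 < α) (s : ℝ) :
    Measurable fun p : ℝ × ℝ => heat α s p.1 p.2 :=
  (measurable_heat hα).comp (measurable_const.prodMk measurable_id)

theorem measurable_heat_apply {α : ℝ} (hα : -1 / 2 < α) (s x : ℝ) : Measurable (heat α s x) := by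
  have hJ := measurable_besselJ (by linarith : 0 < α + 1)
  unfold heat
  fun_prop

theorem lintegral_prod_heat_mul_fst {α : ℝ} (hα : -1 / 2 < α) {s : ℝ} (hs : 0 < s) {u : ℝ → ℝ≥0∞}
    (hu : Measurable u) :
    ∫⁻ p, ENNReal.ofReal (heat α s p.1 p.2) * u p.1 ∂(mu α).prod (mu α) = ∫⁻ x, u x ∂mu α := by
  have hm := measurable_heat_right hα s
  rw [lintegral_prod _ (by fun_prop)]
  refine lintegral_congr fun x => ?_
  dsimp only
  rw [lintegral_mul_const _ (measurable_heat_apply hα s x).ennreal_ofReal,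
    lintegral_heat hα hs, one_mul]

theorem lintegral_prod_heat_mul_snd {α : ℝ} (hα : -1 / 2 < α) {s : ℝ} (hs : 0 < s) {u : ℝ → ℝ≥0∞}
    (hu : Measurable u) :
    ∫⁻ p, ENNReal.ofReal (heat α s p.1 p.2) * u p.2 ∂(mu α).prod (mu α) = ∫⁻ x, u x ∂mu α := by
  have hm := measurable_heat_right hα s
  rw [lintegral_prod_symm _ (by fun_prop)]
  refine lintegral_congr fun y => ?_
  dsimp only
  simp only [heat_comm α s _ y]
  rw [lintegral_mul_const _ (measurable_heat_apply hα s y).ennreal_ofReal,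
    lintegral_heat hα hs, one_mul]

/-- The Dirichlet-type form `∬ heat(x, y) |f x - f y|²`. -/
def energy (α s : ℝ) (f : ℝ → ℂ) : ℝ≥0∞ :=
  ∫⁻ p, ENNReal.ofReal (heat α s p.1 p.2) * ‖f p.1 - f p.2‖ₑ ^ 2 ∂(mu α).prod (mu α)

theorem enorm_add_sq_le (a b : ℂ) : ‖a + b‖ₑ ^ 2 ≤ 2 * ‖a‖ₑ ^ 2 + 2 * ‖b‖ₑ ^ 2 := by
  have h : ‖a + b‖ ^ 2 ≤ 2 * ‖a‖ ^ 2 + 2 * ‖b‖ ^ 2 := by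
    have := norm_add_le a b
    nlinarith [norm_nonneg (a + b), sq_nonneg (‖a‖ - ‖b‖)]
  have := ENNReal.ofReal_le_ofReal h
  rwa [ENNReal.ofReal_add (by positivity) (by positivity), ENNReal.ofReal_mul zero_le_two,
    ENNReal.ofReal_mul zero_le_two, ENNReal.ofReal_pow (norm_nonneg _),
    ENNReal.ofReal_pow (norm_nonneg _), ENNReal.ofReal_pow (norm_nonneg _), ofReal_norm,
    ofReal_norm, ofReal_norm, ENNReal.ofReal_ofNat] at this

theorem energy_le {α : ℝ} (hα : -1 / 2 < α) {s : ℝ} (hs : 0 < s) {f : ℝ → ℂ} (hf : Measurable f) :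
    energy α s f ≤ 4 * ∫⁻ x, ‖f x‖ₑ ^ 2 ∂mu α := by
  have hm := measurable_heat_right hα s
  calc energy α s f
      ≤ ∫⁻ p, (ENNReal.ofReal (heat α s p.1 p.2) * (2 * ‖f p.1‖ₑ ^ 2) +
          ENNReal.ofReal (heat α s p.1 p.2) * (2 * ‖f p.2‖ₑ ^ 2)) ∂(mu α).prod (mu α) := by
        refine lintegral_mono fun p => ?_
        simp only [← mul_add]
        gcongr
        simpa [sub_eq_add_neg, mul_add] using enorm_add_sq_le (f p.1) (-f p.2)
    _ = _ := by
        rw [lintegral_add_left (by fun_prop),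
          lintegral_prod_heat_mul_fst hα hs (u := fun x => 2 * ‖f x‖ₑ ^ 2) (by fun_prop),
          lintegral_prod_heat_mul_snd hα hs (u := fun x => 2 * ‖f x‖ₑ ^ 2) (by fun_prop),
          lintegral_const_mul _ (by fun_prop), ← add_mul]
        norm_num

theorem energy_add_le {α : ℝ} (hα : -1 / 2 < α) (s : ℝ) {f g : ℝ → ℂ} (hf : Measurable f)
    (hg : Measurable g) :
    energy α s f ≤ 2 * energy α s g + 2 * energy α s (f - g) := by
  have hm := measurable_heat_right hα s
  unfold energy
  rw [← lintegral_const_mul _ (by fun_prop), ← lintegral_const_mul _ (by fun_prop),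
    ← lintegral_add_left (by fun_prop)]
  refine lintegral_mono fun p => ?_
  calc _ ≤ ENNReal.ofReal (heat α s p.1 p.2) * (2 * ‖g p.1 - g p.2‖ₑ ^ 2 +
        2 * ‖(f - g) p.1 - (f - g) p.2‖ₑ ^ 2) := by
        gcongr
        refine le_trans (le_of_eq ?_) (enorm_add_sq_le _ _)
        congr 2
        simp only [Pi.sub_apply]
        ring
    _ = _ := by ring

/-- Since `2α + 1 ≥ 0`, the density is continuous up to `0`. Local finiteness gives finite mass to
compact sets and the approximation of `L²` functions by compactly supported continuous ones. -/
instance (α : ℝ) [Fact (-1 / 2 < α)] : IsLocallyFiniteMeasure (mu α) := by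
  have hα := Fact.out (p := -1 / 2 < α)
  unfold mu
  refine IsLocallyFiniteMeasure.withDensity_ofReal ?_
  exact continuous_const.mul (Real.continuous_rpow_const (by linarith))

theorem tendsto_energy_of_hasCompactSupport {α : ℝ} (hα : -1 / 2 < α) {g : ℝ → ℂ}
    (hg : Continuous g) (hgs : HasCompactSupport g) :
    Tendsto (fun s => energy α s g) (𝓝[>] 0) (𝓝 0) := by
  have : Fact (-1 / 2 < α) := ⟨hα⟩
  obtain ⟨M, hM⟩ := hg.bounded_above_of_compact_support hgs
  have hM0 : 0 ≤ M := (norm_nonneg _).trans (hM 0)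
  set K := tsupport g with hK
  have hKm : MeasurableSet K := (isClosed_tsupport g).measurableSet
  have hKfin : mu α K < ∞ := hgs.measure_lt_top
  set m := (mu α K).toReal with hmdef
  have hmK : mu α K = ENNReal.ofReal m := (ENNReal.ofReal_toReal hKfin.ne).symm
  have hm0 : 0 ≤ m := ENNReal.toReal_nonneg
  have huc := hgs.uniformContinuous_of_continuous hg
  have hbound : ∀ η > 0, ∃ c, 0 ≤ c ∧ ∀ s, 0 < s →
      energy α s g ≤ ENNReal.ofReal (2 * m * (η + c * s)) := by
    intro η hη
    obtain ⟨δ, hδ, hδg⟩ := Metric.uniformContinuous_iff.1 huc √η (Real.sqrt_pos.2 hη)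
    set d := (2 * M) ^ 2 / δ ^ 2 with hd
    have hd0 : 0 ≤ d := by positivity
    refine ⟨d * (2 ^ (α + 1) * (2 / Real.pi)), by positivity, fun s hs => ?_⟩
    -- Uniform continuity handles distances below `δ`; beyond, `d` makes the quadratic term exceed
    -- the trivial bound `(2 * M) ^ 2`.
    have hpt : ∀ x y, ‖g x - g y‖ ^ 2 ≤ η + d * (x - y) ^ 2 := by
      intro x y
      rcases lt_or_ge (dist x y) δ with h | h
      · have := hδg h
        rw [dist_eq_norm] at this
        have h2 := pow_le_pow_left₀ (norm_nonneg _) this.le 2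
        rw [Real.sq_sqrt hη.le] at h2
        have : 0 ≤ d * (x - y) ^ 2 := by positivity
        linarith
      · have h1 : ‖g x - g y‖ ≤ 2 * M := by
          have := norm_sub_le (g x) (g y)
          linarith [hM x, hM y]
        have h2 := pow_le_pow_left₀ (norm_nonneg _) h1 2
        have h3 : δ ^ 2 ≤ (x - y) ^ 2 := by
          rw [← sq_abs (x - y)]
          exact pow_le_pow_left₀ hδ.le h 2
        have h4 : (2 * M) ^ 2 ≤ d * (x - y) ^ 2 := by
          rw [hd, div_mul_eq_mul_div, le_div_iff₀ (by positivity)]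
          gcongr
        linarith
    set c' := 2 ^ (α + 1) * (2 * s / Real.pi) with hc'
    have hc0 : 0 ≤ c' := by positivity
    have hmul : ∀ x y, 0 ≤ x → 0 ≤ y → heat α s x y * ‖g x - g y‖ ^ 2 ≤
        η * heat α s x y + d * c' * heat α (2 * s) x y := by
      intro x y hx hy
      have h1 := sq_sub_mul_heat_le hα hs hx hy
      have h2 := heat_pos hα hs x y
      calc heat α s x y * ‖g x - g y‖ ^ 2 ≤ heat α s x y * (η + d * (x - y) ^ 2) := by
            gcongr; exact hpt x y
        _ = η * heat α s x y + d * ((x - y) ^ 2 * heat α s x y) := by ring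
        _ ≤ η * heat α s x y + d * (c' * heat α (2 * s) x y) := by gcongr
        _ = _ := by ring
    -- The difference vanishes unless one of the two points lies in `K`, so the majorant can be
    -- localized to `K` in one variable and integrated out in the other.
    have hind : ∀ x y, 0 ≤ x → 0 ≤ y → ENNReal.ofReal (heat α s x y) * ‖g x - g y‖ₑ ^ 2 ≤
        (ENNReal.ofReal (heat α s x y) * K.indicator (fun _ => ENNReal.ofReal η) x +
        ENNReal.ofReal (heat α (2 * s) x y) * K.indicator (fun _ => ENNReal.ofReal (d * c')) x) +
        (ENNReal.ofReal (heat α s x y) * K.indicator (fun _ => ENNReal.ofReal η) y +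
        ENNReal.ofReal (heat α (2 * s) x y) * K.indicator (fun _ => ENNReal.ofReal (d * c')) y) := by
      intro x y hx hy
      have h1 := (heat_pos hα hs x y).le
      have h2 := (heat_pos hα (by positivity : 0 < 2 * s) x y).le
      have h3 : ENNReal.ofReal (heat α s x y) * ‖g x - g y‖ₑ ^ 2 ≤
          ENNReal.ofReal (heat α s x y) * ENNReal.ofReal η +
          ENNReal.ofReal (heat α (2 * s) x y) * ENNReal.ofReal (d * c') := by
        have := ENNReal.ofReal_le_ofReal (hmul x y hx hy)
        rw [ENNReal.ofReal_mul h1, ENNReal.ofReal_pow (norm_nonneg _), ofReal_norm,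
          ENNReal.ofReal_add (by positivity) (by positivity), mul_comm η,
          mul_comm (d * c'), ENNReal.ofReal_mul h1, ENNReal.ofReal_mul h2] at this
        exact this
      by_cases hxK : x ∈ K
      · simp only [indicator_of_mem hxK]
        exact h3.trans le_self_add
      · by_cases hyK : y ∈ K
        · simp only [indicator_of_mem hyK]
          exact h3.trans le_add_self
        · simp [image_eq_zero_of_notMem_tsupport hxK, image_eq_zero_of_notMem_tsupport hyK]
    have hm1 := measurable_heat_right hα s
    have hm2 := measurable_heat_right hα (2 * s)
    have hu : ∀ r : ℝ≥0∞, Measurable (K.indicator fun _ => r) := fun r =>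
      measurable_const.indicator hKm
    have hu1 := hu (ENNReal.ofReal η)
    have hu2 := hu (ENNReal.ofReal (d * c'))
    have hs2 : 0 < 2 * s := by positivity
    have hae : ∀ᵐ p ∂(mu α).prod (mu α), 0 ≤ p.1 ∧ 0 ≤ p.2 := by
      have h1 := Measure.quasiMeasurePreserving_fst (μ := mu α) (ν := mu α) |>.ae (ae_mu_pos α)
      have h2 := Measure.quasiMeasurePreserving_snd (μ := mu α) (ν := mu α) |>.ae (ae_mu_pos α)
      filter_upwards [h1, h2] with p h1 h2 using ⟨h1.le, h2.le⟩
    calc energy α s g ≤ _ := lintegral_mono_ae (hae.mono fun p hp => hind p.1 p.2 hp.1 hp.2)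
      _ = ENNReal.ofReal (2 * m * (η + d * c')) := by
          rw [lintegral_add_left (by fun_prop), lintegral_add_left (by fun_prop),
            lintegral_add_left (by fun_prop), lintegral_prod_heat_mul_fst hα hs hu1,
            lintegral_prod_heat_mul_fst hα hs2 hu2, lintegral_prod_heat_mul_snd hα hs hu1,
            lintegral_prod_heat_mul_snd hα hs2 hu2, lintegral_indicator_const hKm,
            lintegral_indicator_const hKm, hmK, ← ENNReal.ofReal_mul hη.le,
            ← ENNReal.ofReal_mul (by positivity), ← ENNReal.ofReal_add (by positivity)
            (by positivity), ← ENNReal.ofReal_add (by positivity) (by positivity)]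
          congr 1
          ring
      _ = _ := by rw [hc']; ring_nf
  rw [ENNReal.tendsto_nhds_zero]
  intro ε hε
  rcases eq_or_ne ε ∞ with rfl | hεt
  · simp
  have hε' := ENNReal.toReal_pos hε.ne' hεt
  set e := ε.toReal with he
  -- `2 * m + 1` and, below, `c + 1` serve as denominators because `m` and `c` may be zero.
  have hm1 : 0 < 2 * m + 1 := by positivity
  obtain ⟨c, hc, hcs⟩ := hbound (e / (2 * (2 * m + 1))) (by positivity)
  have hev : ∀ᶠ s in 𝓝[>] (0 : ℝ), s < e / (2 * (2 * m + 1) * (c + 1)) :=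
    nhdsWithin_le_nhds (eventually_lt_nhds (by positivity))
  filter_upwards [self_mem_nhdsWithin, hev] with s hs0 hs
  refine (hcs s hs0).trans ?_
  rw [← ENNReal.ofReal_toReal hεt, ← he]
  refine ENNReal.ofReal_le_ofReal ?_
  have hs0' : 0 < s := hs0
  have h1 : c * s ≤ e / (2 * (2 * m + 1)) := by
    rw [lt_div_iff₀ (by positivity)] at hs
    rw [le_div_iff₀ (by positivity)]
    nlinarith [mul_pos hs0' hm1]
  calc 2 * m * (e / (2 * (2 * m + 1)) + c * s)
      ≤ (2 * m + 1) * (e / (2 * (2 * m + 1)) + e / (2 * (2 * m + 1))) := by gcongr; linarith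
    _ = e := by field_simp; ring

theorem tendsto_energy {α : ℝ} (hα : -1 / 2 < α) {f : ℝ → ℂ} (hf : Measurable f)
    (hf2 : MemLp f 2 (mu α)) : Tendsto (fun s => energy α s f) (𝓝[>] 0) (𝓝 0) := by
  have : Fact (-1 / 2 < α) := ⟨hα⟩
  rw [ENNReal.tendsto_nhds_zero]
  intro ε hε
  rcases eq_or_ne ε ∞ with rfl | hεt
  · simp
  -- The minimum with `1` makes the square of this number at most `ε / 16`; the final count is `2 *
  -- (ε / 4) + 2 * 4 * (ε / 16) = ε`.
  have hη : min 1 (ε / 16) ≠ 0 := by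
    simp [hε.ne']
  obtain ⟨g, hgs, hfg, hgc, -⟩ := hf2.exists_hasCompactSupport_eLpNorm_sub_le (by simp) hη
  have hfg2 : ∫⁻ x, ‖(f - g) x‖ₑ ^ 2 ∂mu α ≤ ε / 16 := by
    rw [← eLpNorm_two_sq]
    calc eLpNorm (f - g) 2 (mu α) ^ 2 ≤ min 1 (ε / 16) ^ 2 := by gcongr
      _ ≤ 1 * (ε / 16) := by rw [sq]; gcongr <;> simp
      _ = _ := one_mul _
  have hε4 : 0 < ε / 4 := ENNReal.div_pos hε.ne' (by simp)
  have h1 := (ENNReal.tendsto_nhds_zero.1 (tendsto_energy_of_hasCompactSupport hα hgc hgs)) _ hε4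
  filter_upwards [self_mem_nhdsWithin, h1] with s hs hsg
  calc energy α s f ≤ 2 * energy α s g + 2 * energy α s (f - g) :=
        energy_add_le hα s hf hgc.measurable
    _ ≤ 2 * (ε / 4) + 2 * (4 * (ε / 16)) := by
        gcongr
        exact (energy_le hα hs (hf.sub hgc.measurable)).trans (by gcongr)
    _ = ε := by
        rw [← ENNReal.ofReal_toReal hεt]
        rw [show (4 : ℝ≥0∞) = ENNReal.ofReal 4 by simp, show (2 : ℝ≥0∞) = ENNReal.ofReal 2 by simp,
          show (16 : ℝ≥0∞) = ENNReal.ofReal 16 by simp, ← ENNReal.ofReal_div_of_pos (by norm_num),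
          ← ENNReal.ofReal_div_of_pos (by norm_num), ← ENNReal.ofReal_mul (by norm_num),
          ← ENNReal.ofReal_mul (by norm_num), ← ENNReal.ofReal_mul (by norm_num),
          ← ENNReal.ofReal_add (by positivity) (by positivity)]
        congr 1
        ring

/-! ### The integral transform, Plancherel's identity and the extension to `L²`. -/

theorem measurable_j_mul {α : ℝ} (hα : -1 / 2 < α) :
    Measurable fun p : ℝ × ℝ => ((j α (2 * Real.pi * p.1 * p.2) : ℝ) : ℂ) :=
  Complex.measurable_ofReal.comp ((measurable_j hα).comp (by fun_prop))

theorem norm_ofReal_j_le {α : ℝ} (hα : -1 / 2 < α) (x : ℝ) : ‖((j α x : ℝ) : ℂ)‖ ≤ j α 0 := by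
  rw [Complex.norm_real]
  exact abs_j_le hα x

theorem integrable_mul_j {α : ℝ} (hα : -1 / 2 < α) {f : ℝ → ℂ} (hf : Integrable f (mu α)) (y : ℝ) :
    Integrable (fun x => f x * (j α (2 * Real.pi * x * y) : ℂ)) (mu α) :=
  hf.mul_bdd (c := j α 0)
    ((measurable_j_mul hα).comp measurable_prodMk_right).aestronglyMeasurable
    (Eventually.of_forall fun _ => norm_ofReal_j_le hα _)

theorem norm_transform_le {α : ℝ} (hα : -1 / 2 < α) {f : ℝ → ℂ} (hf : Integrable f (mu α)) (y : ℝ) :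
    ‖transform α f y‖ ≤ j α 0 * ∫ x, ‖f x‖ ∂mu α := by
  rw [mul_comm, ← integral_mul_const]
  refine norm_integral_le_of_norm_le (hf.norm.mul_const _) (Eventually.of_forall fun x => ?_)
  rw [norm_mul]
  gcongr
  exact norm_ofReal_j_le hα _

theorem measurable_transform {α : ℝ} (hα : -1 / 2 < α) {f : ℝ → ℂ} (hf : Measurable f) :
    Measurable (transform α f) := by
  have hj := measurable_j_mul hα
  refine StronglyMeasurable.measurable (StronglyMeasurable.integral_prod_right'
    (f := fun p : ℝ × ℝ => f p.2 * ((j α (2 * Real.pi * p.2 * p.1) : ℝ) : ℂ)) ?_)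
  exact ((hf.comp measurable_snd).mul (hj.comp measurable_swap)).stronglyMeasurable

theorem conj_transform (α : ℝ) (f : ℝ → ℂ) (y : ℝ) :
    conj (transform α f y) = transform α (fun x => conj (f x)) y := by
  rw [transform, ← integral_conj]
  simp [transform]

theorem integrable_conj {μ : Measure ℝ} {f : ℝ → ℂ} (hf : Integrable f μ) :
    Integrable (fun x => conj (f x)) μ :=
  Complex.conjCLE.toContinuousLinearMap.integrable_comp hf

theorem integrable_gauss {α : ℝ} (hα : -1 / 2 < α) {s : ℝ} (hs : 0 < s) :
    Integrable (gauss s) (mu α) := by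
  have h := integrable_pow_mul_exp hα (by positivity : 0 < Real.pi * s) 0
  simp only [mul_zero, pow_zero, one_mul] at h
  exact h

/-- Fubini: the Gaussian makes the triple integral absolutely convergent, and the inner integral in
the frequency is the heat kernel. -/
theorem integral_gauss_mul_transform_mul_conj {α : ℝ} (hα : -1 / 2 < α) {s : ℝ} (hs : 0 < s)
    {f g : ℝ → ℂ} (hf : Integrable f (mu α)) (hg : Integrable g (mu α)) :
    ∫ ξ, (gauss s ξ : ℂ) * (transform α f ξ * conj (transform α g ξ)) ∂mu α =
      ∫ p, (heat α s p.1 p.2 : ℂ) * (f p.1 * conj (g p.2)) ∂(mu α).prod (mu α) := by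
  have hj := measurable_j_mul hα
  have hg' : Integrable (fun x => conj (g x)) (mu α) := integrable_conj hg
  have hG : Integrable (fun ξ => (gauss s ξ : ℂ)) (mu α) := (integrable_gauss hα hs).ofReal
  have hint : Integrable (fun q : ℝ × ℝ × ℝ => ((j α (2 * Real.pi * q.2.1 * q.1) : ℝ) : ℂ) *
      ((j α (2 * Real.pi * q.2.2 * q.1) : ℝ) : ℂ) * ((gauss s q.1 : ℂ) *
        (f q.2.1 * conj (g q.2.2)))) ((mu α).prod ((mu α).prod (mu α))) := by
    refine (hG.mul_prod (hf.mul_prod hg')).bdd_mul (c := j α 0 * j α 0) ?_ ?_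
    · refine Measurable.aestronglyMeasurable ?_
      exact (hj.comp (by fun_prop : Measurable fun q : ℝ × ℝ × ℝ => (q.2.1, q.1))).mul
        (hj.comp (by fun_prop : Measurable fun q : ℝ × ℝ × ℝ => (q.2.2, q.1)))
    · refine Eventually.of_forall fun q => ?_
      rw [norm_mul]
      exact mul_le_mul (norm_ofReal_j_le hα _) (norm_ofReal_j_le hα _) (norm_nonneg _)
        (j_zero_pos hα).le
  calc _ = ∫ ξ, ∫ p, ((j α (2 * Real.pi * p.1 * ξ) : ℝ) : ℂ) *
      ((j α (2 * Real.pi * p.2 * ξ) : ℝ) : ℂ) * ((gauss s ξ : ℂ) *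
        (f p.1 * conj (g p.2))) ∂(mu α).prod (mu α) ∂mu α := by
        congr 1
        ext ξ
        rw [conj_transform, transform, transform, ← integral_prod_mul, ← integral_const_mul]
        congr 1
        ext p
        ring
    _ = ∫ p, ∫ ξ, ((j α (2 * Real.pi * p.1 * ξ) : ℝ) : ℂ) *
      ((j α (2 * Real.pi * p.2 * ξ) : ℝ) : ℂ) * ((gauss s ξ : ℂ) *
        (f p.1 * conj (g p.2))) ∂mu α ∂(mu α).prod (mu α) := integral_integral_swap hint
    _ = _ := by
        congr 1
        ext p
        rw [← integral_gauss_mul_j_mul_j hα hs, ← integral_complex_ofReal, ← integral_mul_const]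
        congr 1
        ext ξ
        rw [mul_right_comm _ p.1 ξ, mul_right_comm _ p.2 ξ]
        push_cast
        ring

theorem norm_heat_le_ae {α : ℝ} (hα : -1 / 2 < α) {s : ℝ} (hs : 0 < s) :
    ∀ᵐ p ∂(mu α).prod (mu α), ‖(heat α s p.1 p.2 : ℂ)‖ ≤ j α 0 * (1 / s) ^ (α + 1) := by
  have h1 := Measure.quasiMeasurePreserving_fst (μ := mu α) (ν := mu α) |>.ae (ae_mu_pos α)
  have h2 := Measure.quasiMeasurePreserving_snd (μ := mu α) (ν := mu α) |>.ae (ae_mu_pos α)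
  filter_upwards [h1, h2] with p h1 h2
  rw [Complex.norm_real, Real.norm_of_nonneg (heat_pos hα hs _ _).le]
  exact heat_le hα hs h1.le h2.le

theorem integrable_gauss_mul_norm_transform_sq {α : ℝ} (hα : -1 / 2 < α) {s : ℝ} (hs : 0 < s)
    {f : ℝ → ℂ} (hfm : Measurable f) (hf : Integrable f (mu α)) :
    Integrable (fun ξ => gauss s ξ * ‖transform α f ξ‖ ^ 2) (mu α) := by
  have hFm := measurable_transform hα hfm
  refine (integrable_gauss hα hs).mul_bdd (c := (j α 0 * ∫ x, ‖f x‖ ∂mu α) ^ 2)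
    (by fun_prop) (Eventually.of_forall fun ξ => ?_)
  rw [norm_pow, norm_norm]
  gcongr
  exact norm_transform_le hα hf ξ

theorem lintegral_gauss_mul_enorm_transform_sq {α : ℝ} (hα : -1 / 2 < α) {s : ℝ} (hs : 0 < s)
    {f : ℝ → ℂ} (hfm : Measurable f) (hf : Integrable f (mu α)) :
    ∫⁻ ξ, ENNReal.ofReal (gauss s ξ) * ‖transform α f ξ‖ₑ ^ 2 ∂mu α =
      ENNReal.ofReal (∫ ξ, gauss s ξ * ‖transform α f ξ‖ ^ 2 ∂mu α) := by
  rw [ofReal_integral_eq_lintegral_ofReal (integrable_gauss_mul_norm_transform_sq hα hs hfm hf)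
    (Eventually.of_forall fun ξ => mul_nonneg (gauss_pos _ _).le (sq_nonneg _))]
  refine lintegral_congr fun ξ => ?_
  rw [ENNReal.ofReal_mul (gauss_pos _ _).le, ENNReal.ofReal_pow (norm_nonneg _), ofReal_norm]

/-- Expand `‖f x - f y‖ ^ 2` under the heat kernel: both marginals have mass one, so the squares
give `2 ‖f‖ ^ 2`, and the cross term is the Gaussian-weighted norm of the transform. As `s → 0` the
energy disappears and Plancherel's identity remains. -/
theorem two_mul_lintegral_gauss_add_energy {α : ℝ} (hα : -1 / 2 < α) {s : ℝ} (hs : 0 < s)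
    {f : ℝ → ℂ} (hfm : Measurable f) (hf : Integrable f (mu α)) (hf2 : MemLp f 2 (mu α)) :
    2 * (∫⁻ ξ, ENNReal.ofReal (gauss s ξ) * ‖transform α f ξ‖ₑ ^ 2 ∂mu α) + energy α s f =
      2 * ∫⁻ x, ‖f x‖ₑ ^ 2 ∂mu α := by
  have hm := measurable_heat_right hα s
  have hfin := lintegral_enorm_sq_lt_top hf2
  have hen := (energy_le hα hs hfm).trans_lt (ENNReal.mul_lt_top (by simp) hfin)
  have hsq : ∀ z : ℂ, ‖z‖ₑ ^ 2 = ENNReal.ofReal (‖z‖ ^ 2) := fun z => by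
    rw [ENNReal.ofReal_pow (norm_nonneg z), ofReal_norm]
  have hh : ∀ (p : ℝ × ℝ) (z : ℂ), ENNReal.ofReal (heat α s p.1 p.2) * ‖z‖ₑ ^ 2 =
      ENNReal.ofReal (heat α s p.1 p.2 * ‖z‖ ^ 2) := fun p z => by
    rw [hsq, ENNReal.ofReal_mul (heat_pos hα hs _ _).le]
  have hpos : ∀ (p : ℝ × ℝ) (z : ℂ), 0 ≤ heat α s p.1 p.2 * ‖z‖ ^ 2 := fun p z =>
    mul_nonneg (heat_pos hα hs _ _).le (sq_nonneg _)
  set N := ∫⁻ x, ‖f x‖ₑ ^ 2 ∂mu α with hN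
  have key : ∀ {φ : ℝ × ℝ → ℂ} (_ : Measurable φ) {c : ℝ≥0∞} (_ : c < ∞)
      (_ : ∫⁻ p, ENNReal.ofReal (heat α s p.1 p.2) * ‖φ p‖ₑ ^ 2 ∂(mu α).prod (mu α) = c),
      Integrable (fun p => heat α s p.1 p.2 * ‖φ p‖ ^ 2) ((mu α).prod (mu α)) ∧
      ∫ p, heat α s p.1 p.2 * ‖φ p‖ ^ 2 ∂(mu α).prod (mu α) = c.toReal := by
    intro φ hφ c hc h
    have hmeas : Measurable fun p => heat α s p.1 p.2 * ‖φ p‖ ^ 2 := by fun_prop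
    simp only [hh] at h
    constructor
    · refine ⟨hmeas.aestronglyMeasurable, ?_⟩
      rw [hasFiniteIntegral_iff_ofReal (Eventually.of_forall fun p => hpos p _), h]
      exact hc
    · rw [integral_eq_lintegral_of_nonneg_ae (Eventually.of_forall fun p => hpos p _)
        hmeas.aestronglyMeasurable, h]
  obtain ⟨i1, e1⟩ := key (φ := fun p => f p.1) (by fun_prop) hfin
    (lintegral_prod_heat_mul_fst hα hs (u := fun x => ‖f x‖ₑ ^ 2) (by fun_prop))
  obtain ⟨i2, e2⟩ := key (φ := fun p => f p.2) (by fun_prop) hfin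
    (lintegral_prod_heat_mul_snd hα hs (u := fun x => ‖f x‖ₑ ^ 2) (by fun_prop))
  obtain ⟨i3, e3⟩ := key (φ := fun p => f p.1 - f p.2) (by fun_prop) hen rfl
  have hf' : Integrable (fun x => conj (f x)) (mu α) := integrable_conj hf
  have i4 : Integrable (fun p : ℝ × ℝ => (heat α s p.1 p.2 : ℂ) * (f p.1 * conj (f p.2)))
      ((mu α).prod (mu α)) :=
    (hf.mul_prod hf').bdd_mul (Complex.measurable_ofReal.comp hm).aestronglyMeasurable
      (norm_heat_le_ae hα hs)
  have e4 := integral_gauss_mul_transform_mul_conj hα hs hf hf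
  have i5 := integrable_gauss_mul_norm_transform_sq hα hs hfm hf
  have e5 : ((∫ ξ, gauss s ξ * ‖transform α f ξ‖ ^ 2 ∂mu α : ℝ) : ℂ) =
      ∫ p, (heat α s p.1 p.2 : ℂ) * (f p.1 * conj (f p.2)) ∂(mu α).prod (mu α) := by
    rw [← e4, ← integral_complex_ofReal]
    congr 1
    ext ξ
    rw [Complex.mul_conj, Complex.normSq_eq_norm_sq]
    push_cast
    rfl
  have e6 : ∫ ξ, gauss s ξ * ‖transform α f ξ‖ ^ 2 ∂mu α =
      ∫ p, ((heat α s p.1 p.2 : ℂ) * (f p.1 * conj (f p.2))).re ∂(mu α).prod (mu α) := by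
    have := congrArg Complex.re e5
    rw [Complex.ofReal_re] at this
    rw [this]
    exact (integral_re i4).symm
  have e7 : ∫ p, heat α s p.1 p.2 * ‖f p.1 - f p.2‖ ^ 2 ∂(mu α).prod (mu α) =
      N.toReal + N.toReal - 2 * ∫ ξ, gauss s ξ * ‖transform α f ξ‖ ^ 2 ∂mu α := by
    rw [e6]
    conv_rhs => rw [← e1]
    nth_rewrite 2 [e1]
    rw [← e2, ← integral_const_mul, ← integral_add i1 i2]
    have i4' : Integrable (fun p : ℝ × ℝ => 2 *
        ((heat α s p.1 p.2 : ℂ) * (f p.1 * conj (f p.2))).re) ((mu α).prod (mu α)) :=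
      i4.re.const_mul 2
    refine Eq.trans ?_ (integral_sub (i1.add i2) i4')
    congr 1
    ext p
    have h1 : ((heat α s p.1 p.2 : ℂ) * (f p.1 * conj (f p.2))).re =
        heat α s p.1 p.2 * (f p.1 * conj (f p.2)).re := Complex.re_ofReal_mul _ _
    rw [h1, ← Complex.normSq_eq_norm_sq, ← Complex.normSq_eq_norm_sq, ← Complex.normSq_eq_norm_sq,
      Complex.normSq_sub]
    simp only [Complex.normSq_eq_norm_sq]
    ring
  have e8 := lintegral_gauss_mul_enorm_transform_sq hα hs hfm hf
  have e9 : energy α s f = ENNReal.ofReal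
      (N.toReal + N.toReal - 2 * ∫ ξ, gauss s ξ * ‖transform α f ξ‖ ^ 2 ∂mu α) := by
    rw [← e7, e3, ENNReal.ofReal_toReal hen.ne]
  have hnn : 0 ≤ ∫ ξ, gauss s ξ * ‖transform α f ξ‖ ^ 2 ∂mu α :=
    integral_nonneg fun ξ => mul_nonneg (gauss_pos _ _).le (sq_nonneg _)
  have hnn2 : 0 ≤ N.toReal + N.toReal - 2 * ∫ ξ, gauss s ξ * ‖transform α f ξ‖ ^ 2 ∂mu α := by
    rw [← e7]; exact integral_nonneg fun p => hpos p _
  have e10 : N = ENNReal.ofReal N.toReal := (ENNReal.ofReal_toReal hfin.ne).symm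
  rw [e8, e9]
  conv_rhs => rw [e10]
  rw [show (2 : ℝ≥0∞) = ENNReal.ofReal 2 by simp,
    ← ENNReal.ofReal_mul zero_le_two, ← ENNReal.ofReal_mul zero_le_two,
    ← ENNReal.ofReal_add (by positivity) hnn2]
  congr 1
  ring

theorem tendsto_one_div_add_one_nhdsGT :
    Tendsto (fun n : ℕ => 1 / ((n : ℝ) + 1)) atTop (𝓝[>] 0) :=
  tendsto_nhdsWithin_iff.2 ⟨tendsto_one_div_add_atTop_nhds_zero_nat,
    Eventually.of_forall fun n => mem_Ioi.2 (by positivity)⟩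

theorem continuous_gauss_left (x : ℝ) : Continuous fun s => gauss s x := by
  unfold gauss; fun_prop

theorem tendsto_lintegral_gauss_mul {α : ℝ} {u : ℝ → ℝ≥0∞} (hu : Measurable u)
    (hu' : ∀ x, u x ≠ ∞) :
    Tendsto (fun n : ℕ => ∫⁻ ξ, ENNReal.ofReal (gauss (1 / ((n : ℝ) + 1)) ξ) * u ξ ∂mu α) atTop
      (𝓝 (∫⁻ ξ, u ξ ∂mu α)) := by
  refine lintegral_tendsto_of_tendsto_of_monotone (fun n => ?_)
    (Eventually.of_forall fun ξ n m hnm => ?_) (Eventually.of_forall fun ξ => ?_)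
  · have := measurable_gauss_right (1 / ((n : ℝ) + 1))
    fun_prop
  · simp only
    gcongr
    unfold gauss
    gcongr
  · have h2 : Tendsto (fun n : ℕ => gauss (1 / ((n : ℝ) + 1)) ξ) atTop (𝓝 (gauss 0 ξ)) :=
      ((continuous_gauss_left ξ).tendsto 0).comp tendsto_one_div_add_atTop_nhds_zero_nat
    have h3 := ENNReal.Tendsto.mul_const (b := u ξ) (ENNReal.tendsto_ofReal h2) (Or.inr (hu' ξ))
    simpa [gauss] using h3

/-- The Plancherel identity on `L¹ ∩ L²`. -/
theorem lintegral_enorm_transform_sq {α : ℝ} (hα : -1 / 2 < α)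
    {f : ℝ → ℂ} (hfm : Measurable f) (hf : Integrable f (mu α)) (hf2 : MemLp f 2 (mu α)) :
    ∫⁻ ξ, ‖transform α f ξ‖ₑ ^ 2 ∂mu α = ∫⁻ x, ‖f x‖ₑ ^ 2 ∂mu α := by
  have hFm := measurable_transform hα hfm
  have h1 := tendsto_lintegral_gauss_mul (α := α) (u := fun ξ => ‖transform α f ξ‖ₑ ^ 2)
    (by fun_prop) (by simp)
  have h2 := (ENNReal.Tendsto.const_mul (a := 2) h1 (Or.inr (by simp))).add
    ((tendsto_energy hα hfm hf2).comp tendsto_one_div_add_one_nhdsGT)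
  have h3 : ∀ n : ℕ, 2 * (∫⁻ ξ, ENNReal.ofReal (gauss (1 / ((n : ℝ) + 1)) ξ) *
      ‖transform α f ξ‖ₑ ^ 2 ∂mu α) + energy α (1 / ((n : ℝ) + 1)) f =
      2 * ∫⁻ x, ‖f x‖ₑ ^ 2 ∂mu α := fun n =>
    two_mul_lintegral_gauss_add_energy hα (by positivity) hfm hf hf2
  simp only [Function.comp_apply, h3, add_zero] at h2
  have h4 := tendsto_nhds_unique h2 tendsto_const_nhds
  exact (ENNReal.mul_right_inj (by simp) (by simp)).1 h4

theorem eLpNorm_transform {α : ℝ} (hα : -1 / 2 < α)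
    {f : ℝ → ℂ} (hf : Integrable f (mu α)) (hf2 : MemLp f 2 (mu α)) :
    eLpNorm (transform α f) 2 (mu α) = eLpNorm f 2 (mu α) := by
  obtain ⟨g, hgm, hfg⟩ := hf.aestronglyMeasurable
  have h1 : transform α f = transform α g := by
    ext y
    refine integral_congr_ae (hfg.mono fun x hx => ?_)
    simp only [hx]
  have h := lintegral_enorm_transform_sq hα hgm.measurable (hf.congr hfg) (hf2.ae_eq hfg)
  rw [h1, eLpNorm_congr_ae hfg]
  rw [← eLpNorm_two_sq, ← eLpNorm_two_sq] at h
  exact (ENNReal.pow_right_strictMono two_ne_zero).injective h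

theorem transform_sub {α : ℝ} (hα : -1 / 2 < α) {f g : ℝ → ℂ} (hf : Integrable f (mu α))
    (hg : Integrable g (mu α)) (y : ℝ) :
    transform α (fun x => f x - g x) y = transform α f y - transform α g y := by
  rw [transform, transform, transform,
    ← integral_sub (integrable_mul_j hα hf y) (integrable_mul_j hα hg y)]
  simp only [sub_mul]

/-- Plancherel makes the transform an isometry on the dense set `L1L2 α`, so it maps the filter of
neighbourhoods of `f` in that set to a Cauchy filter, which converges by completeness. -/
theorem exists_isTransformL2 {α : ℝ} (hα : -1 / 2 < α) (f : L2 α) : ∃ g, IsTransformL2 α f g := by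
  classical
  have hmem : ∀ h : L2 α, h ∈ L1L2 α → MemLp (transform α h) 2 (mu α) := fun h hh =>
    ⟨aestronglyMeasurable_transform hα h, by
      rw [eLpNorm_transform hα hh (Lp.memLp h)]; exact (Lp.memLp h).eLpNorm_lt_top⟩
  set U : L2 α → L2 α := fun h => if hh : h ∈ L1L2 α then (hmem h hh).toLp _ else 0 with hU
  have hUe : ∀ h (hh : h ∈ L1L2 α), U h = (hmem h hh).toLp _ := fun h hh => by
    simp only [hU, dif_pos hh]
  have hdist : ∀ h₁ ∈ L1L2 α, ∀ h₂ ∈ L1L2 α, edist (U h₁) (U h₂) = edist h₁ h₂ := by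
    intro h₁ hh₁ h₂ hh₂
    rw [hUe _ hh₁, hUe _ hh₂, Lp.edist_toLp_toLp, Lp.edist_def]
    rw [← eLpNorm_transform (f := (⇑h₁ - ⇑h₂)) hα (hh₁.sub hh₂) ((Lp.memLp h₁).sub (Lp.memLp h₂))]
    congr 1
    ext y
    exact (transform_sub hα hh₁ hh₂ y).symm
  have hne : (𝓝[L1L2 α] f).NeBot := mem_closure_iff_nhdsWithin_neBot.1 (dense_L1L2 α f)
  have hc : Cauchy (map U (𝓝[L1L2 α] f)) := by
    have huc : UniformContinuousOn U (L1L2 α) := by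
      rw [EMetric.uniformContinuousOn_iff]
      intro ε hε
      exact ⟨ε, hε, fun {a} ha {b} hb hab => by rwa [hdist a ha b hb]⟩
    have hcf : Cauchy (𝓝[L1L2 α] f) := cauchy_nhds.mono nhdsWithin_le_nhds
    exact hcf.map_of_le huc inf_le_right
  obtain ⟨g, hg⟩ := CompleteSpace.complete hc
  refine ⟨g, ?_⟩
  have h1 : Tendsto (fun h => edist (U h) g) (𝓝[L1L2 α] f) (𝓝 0) :=
    tendsto_iff_edist_tendsto_0.1 hg
  refine h1.congr' ?_
  filter_upwards [self_mem_nhdsWithin] with h hh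
  rw [hUe _ hh, Lp.edist_def]
  refine eLpNorm_congr_ae ?_
  filter_upwards [(hmem h hh).coeFn_toLp] with y hy
  simp [hy]

theorem isTransformL2_transformL2 {α : ℝ} (hα : -1 / 2 < α) (f : L2 α) :
    IsTransformL2 α f (transformL2 α f) := by
  rw [transformL2, dif_pos (exists_isTransformL2 hα f)]
  exact (exists_isTransformL2 hα f).choose_spec

/-! ### The cutoff kernel and its integrals in each variable. -/

theorem lintegral_Ioi_of_hasDerivAt {g g' : ℝ → ℝ} {l : ℝ}
    (hderiv : ∀ x ∈ Ici (0 : ℝ), HasDerivAt g (g' x) x) (hpos : ∀ x ∈ Ioi (0 : ℝ), 0 ≤ g' x)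
    (hg : Tendsto g atTop (𝓝 l)) :
    ∫⁻ x in Ioi 0, ENNReal.ofReal (g' x) = ENNReal.ofReal (l - g 0) := by
  rw [← integral_Ioi_of_hasDerivAt_of_nonneg' hderiv hpos hg, ofReal_integral_eq_lintegral_ofReal
    (integrableOn_Ioi_deriv_of_nonneg' hderiv hpos hg)]
  filter_upwards [ae_restrict_mem measurableSet_Ioi] with x hx using hpos x hx

theorem lintegral_sq_mul_exp_le {c : ℝ} (hc : 0 < c) (x : ℝ) :
    ∫⁻ s in Ioi 0, ENNReal.ofReal (x ^ 2 * Real.exp (-(c * x ^ 2) * s)) ≤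
      ENNReal.ofReal (1 / c) := by
  rcases eq_or_ne x 0 with rfl | hx
  · simp
  have hb : 0 < c * x ^ 2 := by positivity
  rw [lintegral_Ioi_of_hasDerivAt (l := 0)
    (g := fun s => -(1 / c * Real.exp (-(c * x ^ 2) * s)))]
  · simp
  · intro s _
    have h1 : HasDerivAt (fun s => Real.exp (-(c * x ^ 2) * s))
        (Real.exp (-(c * x ^ 2) * s) * (-(c * x ^ 2))) s := by
      simpa using ((hasDerivAt_id' s).const_mul (-(c * x ^ 2))).exp
    convert! (h1.const_mul (1 / c)).neg using 1
    field_simp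
  · intro s _
    positivity
  · have h1 : Tendsto (fun s : ℝ => -(c * x ^ 2) * s) atTop atBot :=
      tendsto_id.const_mul_atTop_of_neg (by linarith)
    simpa using ((Real.tendsto_exp_atBot.comp h1).const_mul (1 / c)).neg

theorem lintegral_mul_rpow_le {β c γ : ℝ} (hβ : 0 < β) (hc : 0 < c) (hγ : 0 < γ) :
    ∫⁻ s in Ioi 0, ENNReal.ofReal (c * s * ((1 / (1 + c * s * (γ * s))) ^ β /
      (1 + c * s * (γ * s)))) = ENNReal.ofReal (1 / (2 * β * γ)) := by
  have hq : ∀ s : ℝ, 0 < 1 + c * s * (γ * s) := fun s => by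
    have : c * s * (γ * s) = c * γ * s ^ 2 := by ring
    rw [this]; positivity
  rw [lintegral_Ioi_of_hasDerivAt (l := 0)
    (g := fun s => -(1 / (2 * β * γ) * (1 + c * s * (γ * s)) ^ (-β)))]
  · simp
  · intro s _
    have h0 : HasDerivAt (fun s => 1 + c * s * (γ * s)) (2 * c * γ * s) s := by
      have h := (((hasDerivAt_id' s).const_mul c).mul ((hasDerivAt_id' s).const_mul γ)).const_add 1
      convert! h using 1
      ring
    have h1 := (h0.rpow_const (p := -β) (Or.inl (hq s).ne')).const_mul (1 / (2 * β * γ))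
    convert! h1.neg using 1
    rw [one_div, Real.inv_rpow (hq s).le, ← Real.rpow_neg (hq s).le,
      Real.rpow_sub_one (hq s).ne']
    field_simp
  · intro s hs
    have := hq s
    have hs' : 0 < s := hs
    positivity
  · have h1 : Tendsto (fun s : ℝ => 1 + c * s * (γ * s)) atTop atTop := by
      refine tendsto_atTop_add_const_left _ _ ?_
      exact (tendsto_id.const_mul_atTop hc).atTop_mul_atTop₀ (tendsto_id.const_mul_atTop hγ)
    simpa using (((tendsto_rpow_neg_atTop hβ).comp h1).const_mul (1 / (2 * β * γ))).neg

/-- A bound for the rows of the phase-space cutoff kernel. -/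
def rowConst (α : ℝ) : ℝ := 2 / Real.pi + (α + 2) / Real.pi * (1 / (2 * (α + 1)))

theorem rowConst_pos {α : ℝ} (hα : -1 / 2 < α) : 0 < rowConst α := by
  have h1 : 0 < α + 1 := by linarith
  have h2 : 0 < α + 2 := by linarith
  unfold rowConst
  positivity

/-- The bound is independent of `x` and `c` and decays like `1 / γ`. With `γ = 1` it bounds the rows
of the cutoff kernel, with `γ = 1 / δ` it makes the short-time part small, and `c = 2`, `γ = 1 / 2`
is the pair that the Harnack inequality produces. -/
theorem lintegral_lintegral_heat_mul_sq_mul_gauss_le {α : ℝ} (hα : -1 / 2 < α) {c γ : ℝ}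
    (hc : 0 < c) (hγ : 0 < γ) (x : ℝ) :
    ∫⁻ s in Ioi 0, ∫⁻ y, ENNReal.ofReal (heat α (c * s) x y * (y ^ 2 * gauss (γ * s) y)) ∂mu α ≤
      ENNReal.ofReal (rowConst α / γ) := by
  have hβ : 0 < α + 1 := by linarith
  have hβ2 : 0 < α + 2 := by linarith
  have hpt : ∀ s ∈ Ioi (0 : ℝ),
      ∫⁻ y, ENNReal.ofReal (heat α (c * s) x y * (y ^ 2 * gauss (γ * s) y)) ∂mu α ≤
      ENNReal.ofReal (x ^ 2 * Real.exp (-(Real.pi * γ / 2 * x ^ 2) * s)) +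
      ENNReal.ofReal ((α + 2) / Real.pi) * ENNReal.ofReal (c * s *
        ((1 / (1 + c * s * (γ * s))) ^ (α + 1) / (1 + c * s * (γ * s)))) := by
    intro s hs
    have hs' : 0 < s := hs
    rw [lintegral_heat_mul_sq_mul_gauss hα (by positivity) (by positivity),
      ← ENNReal.ofReal_mul (by positivity), ← ENNReal.ofReal_add (by positivity) (by positivity)]
    refine ENNReal.ofReal_le_ofReal ?_
    have hq : 1 ≤ 1 + c * s * (γ * s) := by
      have : 0 < c * s * (γ * s) := by positivity
      linarith
    have hqdef : c * s * (γ * s) = (1 + c * s * (γ * s)) - 1 := by ring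
    set q := 1 + c * s * (γ * s)
    have hq0 : 0 < q := by linarith
    set R := (1 / q) ^ (α + 1) / q with hR
    have hR1 : R ≤ 1 := by
      have h1 : (1 / q) ^ (α + 1) ≤ 1 :=
        Real.rpow_le_one (by positivity) ((div_le_one hq0).2 hq) hβ.le
      rw [hR, div_le_one hq0]
      linarith
    have hR0 : 0 < R := by positivity
    set E := Real.exp (-(Real.pi * (γ * s) * x ^ 2 / q)) with hE
    have hE1 : E ≤ 1 := Real.exp_le_one_iff.2 (neg_nonpos.2 (by positivity))
    have hE0 : 0 < E := Real.exp_pos _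
    -- For `c * γ * s ^ 2 ≤ 1` one has `q ≤ 2` and keeps exponential decay in `s`. Otherwise `E * v
    -- ≤ 1` for the exponent `v` turns `x ^ 2` into `1 / (γ * s) ≤ c * s`, of the same type as the
    -- other term of the second moment.
    have hmain : E * (x ^ 2 / q) * R ≤
        x ^ 2 * Real.exp (-(Real.pi * γ / 2 * x ^ 2) * s) + 1 / Real.pi * (c * s) * R := by
      rcases le_total (c * s * (γ * s)) 1 with h | h
      · have hq2 : q ≤ 2 := by linarith
        have h1 : E ≤ Real.exp (-(Real.pi * γ / 2 * x ^ 2) * s) := by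
          refine Real.exp_le_exp.2 ?_
          rw [neg_mul, neg_le_neg_iff, le_div_iff₀ hq0]
          have : 0 ≤ Real.pi * γ * x ^ 2 * s := by positivity
          nlinarith
        have h2 : x ^ 2 / q ≤ x ^ 2 := div_le_self (sq_nonneg x) hq
        have h3 : 0 ≤ 1 / Real.pi * (c * s) * R := by positivity
        calc E * (x ^ 2 / q) * R ≤ Real.exp (-(Real.pi * γ / 2 * x ^ 2) * s) * x ^ 2 * 1 := by
              gcongr
          _ ≤ _ := by linarith
      · have h1 : E * (x ^ 2 / q) ≤ 1 / Real.pi * (c * s) := by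
          set v := Real.pi * (γ * s) * x ^ 2 / q with hv
          have hve : E * v ≤ 1 := by
            rw [hE, Real.exp_neg, inv_mul_eq_div, div_le_one (Real.exp_pos _)]
            linarith [Real.add_one_le_exp v]
          have hxv : x ^ 2 / q = v / (Real.pi * (γ * s)) := by rw [hv]; field_simp
          rw [hxv, ← mul_div_assoc, div_le_iff₀ (by positivity)]
          calc E * v ≤ 1 := hve
            _ ≤ c * s * (γ * s) := h
            _ = _ := by field_simp
        have h2 : 0 ≤ x ^ 2 * Real.exp (-(Real.pi * γ / 2 * x ^ 2) * s) := by positivity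
        have h3 := mul_le_mul_of_nonneg_right h1 hR0.le
        linarith
    calc R * E * ((α + 1) * (c * s) / Real.pi + x ^ 2 / q)
        = E * ((α + 1) / Real.pi * (c * s) * R) + E * (x ^ 2 / q) * R := by ring
      _ ≤ 1 * ((α + 1) / Real.pi * (c * s) * R) + (x ^ 2 * Real.exp
          (-(Real.pi * γ / 2 * x ^ 2) * s) + 1 / Real.pi * (c * s) * R) := by gcongr
      _ = _ := by ring
  calc _ ≤ ∫⁻ s in Ioi (0 : ℝ), (ENNReal.ofReal (x ^ 2 *
          Real.exp (-(Real.pi * γ / 2 * x ^ 2) * s)) +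
        ENNReal.ofReal ((α + 2) / Real.pi) * ENNReal.ofReal (c * s *
        ((1 / (1 + c * s * (γ * s))) ^ (α + 1) / (1 + c * s * (γ * s))))) :=
        setLIntegral_mono' measurableSet_Ioi hpt
    _ ≤ ENNReal.ofReal (1 / (Real.pi * γ / 2)) + ENNReal.ofReal ((α + 2) / Real.pi) *
        ENNReal.ofReal (1 / (2 * (α + 1) * γ)) := by
        rw [lintegral_add_left (by fun_prop), lintegral_const_mul _ (by fun_prop),
          lintegral_mul_rpow_le hβ hc hγ]
        gcongr
        exact lintegral_sq_mul_exp_le (by positivity) x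
    _ = _ := by
        rw [← ENNReal.ofReal_mul (by positivity), ← ENNReal.ofReal_add (by positivity)
          (by positivity)]
        congr 1
        unfold rowConst
        field_simp

/-- The slice at time `s` of the kernel of the cutoff to the region where the frequency is below
the position. -/
def cutoffSlice (α s x y : ℝ) : ℝ≥0∞ :=
  ENNReal.ofReal (heat α s x y * (Real.pi * (y ^ 2 * gauss s y)))

/-- The kernel of the cutoff to the region where the frequency is below the position. -/
def cutoffKernel (α x y : ℝ) : ℝ≥0∞ := ∫⁻ s in Ioi 0, cutoffSlice α s x y

theorem measurable_cutoffSlice {α : ℝ} (hα : -1 / 2 < α) :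
    Measurable fun p : ℝ × ℝ × ℝ => cutoffSlice α p.1 p.2.1 p.2.2 := by
  have h1 := measurable_heat hα
  unfold cutoffSlice
  refine (h1.mul (measurable_const.mul (Measurable.mul (by fun_prop) ?_))).ennreal_ofReal
  exact measurable_gauss.comp (by fun_prop : Measurable fun p : ℝ × ℝ × ℝ => (p.1, p.2.2))

theorem measurable_cutoffKernel {α : ℝ} (hα : -1 / 2 < α) :
    Measurable fun p : ℝ × ℝ => cutoffKernel α p.1 p.2 :=
  Measurable.lintegral_prod_left' (f := fun p : ℝ × ℝ × ℝ => cutoffSlice α p.1 p.2.1 p.2.2)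
    (measurable_cutoffSlice hα)

theorem lintegral_sq_mul_gauss_le (y : ℝ) :
    ∫⁻ s in Ioi 0, ENNReal.ofReal (Real.pi * (y ^ 2 * gauss s y)) ≤ 1 := by
  have h := lintegral_sq_mul_exp_le Real.pi_pos y
  calc _ = ENNReal.ofReal Real.pi * ∫⁻ s in Ioi 0,
        ENNReal.ofReal (y ^ 2 * Real.exp (-(Real.pi * y ^ 2) * s)) := by
        rw [← lintegral_const_mul _ (by fun_prop)]
        refine lintegral_congr fun s => ?_
        rw [← ENNReal.ofReal_mul Real.pi_pos.le, gauss]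
        congr 4
        ring
    _ ≤ ENNReal.ofReal Real.pi * ENNReal.ofReal (1 / Real.pi) := by gcongr
    _ = 1 := by
        rw [← ENNReal.ofReal_mul Real.pi_pos.le, mul_one_div_cancel Real.pi_ne_zero,
          ENNReal.ofReal_one]

/-- In the first variable only the heat kernel is integrated, with mass one; what is left, `π y ^ 2
exp (-π s y ^ 2)`, has integral at most one in `s`. The kernel is not symmetric, and the other
variable needs the second moment computation. -/
theorem lintegral_cutoffKernel_fst_le {α : ℝ} (hα : -1 / 2 < α) (y : ℝ) :
    ∫⁻ x, cutoffKernel α x y ∂mu α ≤ 1 := by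
  have hm := measurable_cutoffSlice hα
  unfold cutoffKernel
  rw [lintegral_lintegral_swap (f := fun x s => cutoffSlice α s x y)
    (hm.comp (by fun_prop : Measurable fun p : ℝ × ℝ => (p.2, p.1, y))).aemeasurable]
  refine le_trans (setLIntegral_mono' measurableSet_Ioi fun s hs => ?_)
    (lintegral_sq_mul_gauss_le y)
  have hh : Measurable fun x => ENNReal.ofReal (heat α s x y) := by
    simp only [heat_comm α s _ y]
    exact (measurable_heat_apply hα s y).ennreal_ofReal
  calc ∫⁻ x, cutoffSlice α s x y ∂mu α
      = ∫⁻ x, ENNReal.ofReal (heat α s x y) *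
          ENNReal.ofReal (Real.pi * (y ^ 2 * gauss s y)) ∂mu α := by
        refine lintegral_congr fun x => ?_
        rw [cutoffSlice, ENNReal.ofReal_mul (heat_pos hα hs x y).le]
    _ = ENNReal.ofReal (Real.pi * (y ^ 2 * gauss s y)) := by
        rw [lintegral_mul_const _ hh, lintegral_heat_left hα hs, one_mul]
    _ ≤ _ := le_rfl

theorem lintegral_cutoffKernel_snd_eq {α : ℝ} (hα : -1 / 2 < α) (x : ℝ) (S : Set ℝ) :
    ∫⁻ y in S, cutoffKernel α x y ∂mu α =
      ∫⁻ s in Ioi 0, ∫⁻ y in S, cutoffSlice α s x y ∂mu α := by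
  have hm := measurable_cutoffSlice hα
  unfold cutoffKernel
  rw [lintegral_lintegral_swap (f := fun y s => cutoffSlice α s x y)
    (hm.comp (by fun_prop : Measurable fun p : ℝ × ℝ => (p.2, x, p.1))).aemeasurable]

theorem lintegral_cutoffKernel_snd_le {α : ℝ} (hα : -1 / 2 < α) (x : ℝ) :
    ∫⁻ y, cutoffKernel α x y ∂mu α ≤ ENNReal.ofReal (Real.pi * rowConst α) := by
  have h := lintegral_cutoffKernel_snd_eq hα x univ
  simp only [Measure.restrict_univ] at h
  have h1 := lintegral_lintegral_heat_mul_sq_mul_gauss_le hα one_pos one_pos x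
  simp only [one_mul, div_one] at h1
  rw [h, ENNReal.ofReal_mul Real.pi_pos.le]
  refine le_trans ?_ (mul_le_mul_right h1 _)
  rw [← lintegral_const_mul' _ _ ENNReal.ofReal_ne_top]
  refine lintegral_mono fun s => ?_
  rw [← lintegral_const_mul' _ _ ENNReal.ofReal_ne_top]
  refine lintegral_mono fun y => ?_
  rw [← ENNReal.ofReal_mul Real.pi_pos.le, cutoffSlice]
  refine le_of_eq ?_
  congr 1
  ring

theorem mu_absolutelyContinuous (α : ℝ) : mu α ≪ volume :=
  (withDensity_absolutelyContinuous _ _).trans Measure.restrict_le_self.absolutelyContinuous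

/-! ### Thin sets meet the rows of the cutoff kernel in small mass. -/

/-- The end points of consecutive intervals `[x, x + 1 / x]` covering `[2, ∞)`. -/
def grid : ℕ → ℝ
  | 0 => 2
  | n + 1 => grid n + 1 / grid n

theorem two_le_grid (n : ℕ) : 2 ≤ grid n := by
  induction n with
  | zero => exact le_rfl
  | succ n ih =>
    have : 0 < 1 / grid n := by positivity
    rw [grid]
    linarith

theorem grid_lt_succ (n : ℕ) : grid n < grid (n + 1) := by
  have := two_le_grid n
  have : 0 < 1 / grid n := by positivity
  rw [grid]
  linarith

theorem monotone_grid : Monotone grid := monotone_nat_of_le_succ fun n => (grid_lt_succ n).le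

/-- Each step raises the square by at least `2`, from the cross term of `(a + 1 / a) ^ 2`. -/
theorem natCast_le_grid_sq (n : ℕ) : (n : ℝ) ≤ grid n ^ 2 := by
  induction n with
  | zero => simp only [Nat.cast_zero]; positivity
  | succ n ih =>
    have h := two_le_grid n
    rw [grid, add_sq, mul_assoc, mul_one_div_cancel (by linarith)]
    have : 0 ≤ (1 / grid n) ^ 2 := by positivity
    push_cast
    linarith

theorem not_bddAbove_range_grid : ¬BddAbove (range grid) := by
  rintro ⟨M, hM⟩
  obtain ⟨n, hn⟩ := exists_nat_gt (M ^ 2)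
  have h1 : grid n ≤ M := hM ⟨n, rfl⟩
  have h2 := two_le_grid n
  have h3 := natCast_le_grid_sq n
  nlinarith

theorem iUnion_Ico_grid : ⋃ n, Ico (grid n) (grid (n + 1)) = Ici 2 := by
  have := iUnion_Ico_map_succ_eq_Ici (f := grid) (fun n => monotone_grid bot_le)
    not_bddAbove_range_grid
  simpa [grid] using this

/-- Integrals over the part of a thin set in `[2, ∞)` of a function that is dominated on each
interval `[x, x + 1 / x]` by the infimum of another one. -/
theorem IsThin.setLIntegral_inter_Ici_le {ε α : ℝ} {S : Set ℝ} (hS : IsThin ε α S)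
    (hSm : MeasurableSet S) {F G : ℝ → ℝ≥0∞}
    (hFG : ∀ a, 2 ≤ a → ∀ y ∈ Icc a (a + 1 / a), ∀ y' ∈ Icc a (a + 1 / a), F y ≤ G y') :
    ∫⁻ y in S ∩ Ici 2, F y ∂mu α ≤ ENNReal.ofReal ε * ∫⁻ y, G y ∂mu α := by
  have hstep : ∀ n, ∫⁻ y in S ∩ Ico (grid n) (grid (n + 1)), F y ∂mu α ≤
      ENNReal.ofReal ε * ∫⁻ y in Ico (grid n) (grid (n + 1)), G y ∂mu α := by
    intro n
    have h2 := two_le_grid n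
    have hsub : Ico (grid n) (grid (n + 1)) ⊆ Icc (grid n) (grid n + 1 / grid n) :=
      Ico_subset_Icc_self
    -- This constant separates `F` from `G` on the interval, so thinness is needed only for a
    -- constant integrand.
    set c := ⨅ y' ∈ Icc (grid n) (grid n + 1 / grid n), G y' with hc
    calc ∫⁻ y in S ∩ Ico (grid n) (grid (n + 1)), F y ∂mu α
        ≤ ∫⁻ _ in S ∩ Ico (grid n) (grid (n + 1)), c ∂mu α := by
          refine setLIntegral_mono' (hSm.inter measurableSet_Ico) fun y hy => ?_
          exact le_iInf₂ fun y' hy' => hFG _ h2 y (hsub hy.2) y' hy'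
      _ = c * mu α (S ∩ Ico (grid n) (grid (n + 1))) := setLIntegral_const _ _
      _ ≤ c * (ENNReal.ofReal ε * mu α (Icc (grid n) (grid n + 1 / grid n))) := by
          gcongr
          exact (measure_mono (inter_subset_inter_right S hsub)).trans (hS.2 _ h2)
      _ = ENNReal.ofReal ε * ∫⁻ _ in Ico (grid n) (grid (n + 1)), c ∂mu α := by
          rw [setLIntegral_const, ← measure_congr ((mu_absolutelyContinuous α).ae_eq
            (Ico_ae_eq_Icc (μ := volume) (a := grid n) (b := grid n + 1 / grid n))), mul_left_comm]
          rfl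
      _ ≤ _ := by
          refine mul_le_mul_right (setLIntegral_mono' measurableSet_Ico fun y hy => ?_) _
          exact iInf₂_le y (hsub hy)
  have hdisj : Pairwise (Function.onFun Disjoint fun n => Ico (grid n) (grid (n + 1))) := by
    simpa using monotone_grid.pairwise_disjoint_on_Ico_succ
  calc ∫⁻ y in S ∩ Ici 2, F y ∂mu α
      ≤ ∑' n, ∫⁻ y in S ∩ Ico (grid n) (grid (n + 1)), F y ∂mu α := by
        rw [← iUnion_Ico_grid, inter_iUnion]
        exact lintegral_iUnion_le _ _
    _ ≤ ∑' n, ENNReal.ofReal ε * ∫⁻ y in Ico (grid n) (grid (n + 1)), G y ∂mu α :=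
        ENNReal.tsum_le_tsum hstep
    _ = ENNReal.ofReal ε * ∫⁻ y in Ici 2, G y ∂mu α := by
        rw [ENNReal.tsum_mul_left, ← lintegral_iUnion (fun n => measurableSet_Ico) hdisj,
          iUnion_Ico_grid]
    _ ≤ _ := mul_le_mul_right (setLIntegral_le_lintegral _ _) _

theorem IsThin.measure_inter_Icc_le {ε α : ℝ} {S : Set ℝ} (hS : IsThin ε α S) :
    mu α (S ∩ Icc 0 2) ≤ ENNReal.ofReal ε * (mu α (Icc 0 1) + mu α (Icc 1 2)) := by
  have h0 := hS.1 0 le_rfl zero_le_one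
  have h1 := hS.1 1 zero_le_one le_rfl
  norm_num at h0 h1
  have hun : Icc (0 : ℝ) 2 ⊆ Icc 0 1 ∪ Icc 1 2 := by
    rw [Icc_union_Icc_eq_Icc zero_le_one one_le_two]
  calc mu α (S ∩ Icc 0 2) ≤ mu α (S ∩ Icc 0 1 ∪ S ∩ Icc 1 2) := by
        rw [← inter_union_distrib_left]
        exact measure_mono (inter_subset_inter_right S hun)
    _ ≤ mu α (S ∩ Icc 0 1) + mu α (S ∩ Icc 1 2) := measure_union_le _ _
    _ ≤ _ := by rw [mul_add]; gcongr

/-- Harnack comparison of the slices of the cutoff kernel on the intervals `[a, a + 1 / a]`. -/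
theorem cutoffSlice_le {α : ℝ} (hα : -1 / 2 < α) {δ s : ℝ} (hδ : 0 < δ) (hs : 0 < s) {x : ℝ}
    (hx : 0 ≤ x) {a y y' : ℝ} (ha : 2 ≤ a) (hy : y ∈ Icc a (a + 1 / a))
    (hy' : y' ∈ Icc a (a + 1 / a)) (hsy : δ ≤ s * y ^ 2) :
    cutoffSlice α s x y ≤
      ENNReal.ofReal (2 ^ (α + 1) * Real.exp (Real.pi * (2 / δ)) * (2 * Real.pi)) *
        ENNReal.ofReal (heat α (2 * s) x y' * (y' ^ 2 * gauss (1 / 2 * s) y')) := by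
  rw [← ENNReal.ofReal_mul (by positivity), cutoffSlice]
  refine ENNReal.ofReal_le_ofReal ?_
  have hpi := Real.pi_pos
  have ha0 : 0 < a := by linarith
  have hinv : 1 / a ≤ a / 4 := by
    rw [div_le_iff₀ ha0]; nlinarith
  have hinv0 : 0 < 1 / a := by positivity
  obtain ⟨hy1, hy2⟩ := hy
  obtain ⟨hy1', hy2'⟩ := hy'
  have hdiff : (y - y') ^ 2 ≤ (1 / a) ^ 2 := by
    refine sq_le_sq' ?_ ?_ <;> linarith
  have hysq : y ^ 2 ≤ 2 * a ^ 2 := by nlinarith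
  have hysq' : y' ^ 2 ≤ 2 * a ^ 2 := by nlinarith
  -- This is where the length `1 / a` matters: `s ≥ δ / y ^ 2 ≥ δ / (2 * a ^ 2)`, so the squared
  -- displacement is at most `2 * s / δ` and the Harnack loss depends on `δ` alone.
  have hexp : Real.pi * (y - y') ^ 2 / s ≤ Real.pi * (2 / δ) := by
    rw [mul_div_assoc]
    refine mul_le_mul_of_nonneg_left ?_ hpi.le
    calc (y - y') ^ 2 / s ≤ (1 / a) ^ 2 / s := by gcongr
      _ ≤ 2 / δ := by
        rw [div_le_div_iff₀ hs hδ]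
        calc (1 / a) ^ 2 * δ ≤ (1 / a) ^ 2 * (s * (2 * a ^ 2)) := by
              gcongr; exact hsy.trans (by gcongr)
          _ = 2 * s := by field_simp
  have hheat := heat_le_exp_mul_heat hα hs hx (by linarith : 0 ≤ y')
    (by linarith : y' ≤ 2 * y)
  have hp := heat_pos hα (by positivity : 0 < 2 * s) x y'
  have hgauss : gauss s y ≤ gauss (1 / 2 * s) y' := by
    unfold gauss
    refine Real.exp_le_exp.2 ?_
    have h1 : y' ^ 2 ≤ 2 * y ^ 2 := by nlinarith
    have h2 : 0 < Real.pi * s := by positivity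
    nlinarith
  have hg0 := gauss_pos s y
  have hsq : y ^ 2 ≤ 2 * y' ^ 2 := by nlinarith
  calc heat α s x y * (Real.pi * (y ^ 2 * gauss s y))
      ≤ (2 ^ (α + 1) * Real.exp (Real.pi * (2 / δ)) * heat α (2 * s) x y') *
        (Real.pi * (2 * y' ^ 2 * gauss (1 / 2 * s) y')) := by
        gcongr
        refine hheat.trans ?_
        gcongr
    _ = _ := by ring

/-- The part of the cutoff kernel away from the diagonal singularity. -/
def farSlice (α δ s x y : ℝ) : ℝ≥0∞ := if δ ≤ s * y ^ 2 then cutoffSlice α s x y else 0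

/-- For `s * y ^ 2 < δ` the indicator is dominated by `exp π` times the Gaussian `gauss (1 / δ *
s)`, so the short-time part is again of the type with an explicit row bound, now of size `δ`. -/
theorem cutoffSlice_le_add_farSlice {α : ℝ} (hα : -1 / 2 < α) {δ s : ℝ} (hδ : 0 < δ) (hs : 0 < s)
    (x y : ℝ) :
    cutoffSlice α s x y ≤ ENNReal.ofReal (Real.exp Real.pi * Real.pi) *
      ENNReal.ofReal (heat α s x y * (y ^ 2 * gauss (1 / δ * s) y)) + farSlice α δ s x y := by
  unfold farSlice
  split_ifs with h
  · exact le_add_self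
  · push Not at h
    rw [add_zero, ← ENNReal.ofReal_mul (by positivity), cutoffSlice]
    refine ENNReal.ofReal_le_ofReal ?_
    have hp := heat_pos hα hs x y
    have hg : gauss s y ≤ Real.exp Real.pi * gauss (1 / δ * s) y := by
      refine (gauss_le_one hs.le y).trans ?_
      unfold gauss
      rw [← Real.exp_add]
      refine Real.one_le_exp ?_
      have h1 : s * y ^ 2 / δ ≤ 1 := (div_le_one hδ).2 h.le
      have h2 : Real.pi + -(Real.pi * (1 / δ * s)) * y ^ 2 = Real.pi * (1 - s * y ^ 2 / δ) := by
        ring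
      rw [h2]
      exact mul_nonneg Real.pi_pos.le (by linarith)
    calc heat α s x y * (Real.pi * (y ^ 2 * gauss s y))
        ≤ heat α s x y * (Real.pi * (y ^ 2 * (Real.exp Real.pi * gauss (1 / δ * s) y))) := by
          gcongr
      _ = _ := by ring

/-- If `y ≤ 2` then `δ ≤ s * y ^ 2` forces `s ≥ δ / 4`, and the heat kernel is uniformly bounded at
such times. -/
theorem lintegral_farSlice_le_of_le_two {α : ℝ} (hα : -1 / 2 < α) {δ : ℝ} (hδ : 0 < δ) {x y : ℝ}
    (hx : 0 ≤ x) (hy : y ∈ Icc 0 2) :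
    ∫⁻ s in Ioi 0, farSlice α δ s x y ≤ ENNReal.ofReal (j α 0 * (4 / δ) ^ (α + 1)) := by
  have hβ : 0 < α + 1 := by linarith
  have hj := j_zero_pos hα
  have hpt : ∀ s ∈ Ioi (0 : ℝ), farSlice α δ s x y ≤
      ENNReal.ofReal (j α 0 * (4 / δ) ^ (α + 1)) *
        ENNReal.ofReal (Real.pi * (y ^ 2 * gauss s y)) := by
    intro s hs
    have hs' : 0 < s := hs
    unfold farSlice
    split_ifs with h
    · rw [cutoffSlice, ENNReal.ofReal_mul (heat_pos hα hs' x y).le]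
      gcongr
      refine (heat_le hα hs' hx hy.1).trans ?_
      have h14 : 1 / s ≤ 4 / δ := by
        rw [div_le_div_iff₀ hs' hδ]
        have : y ^ 2 ≤ 4 := by nlinarith [hy.1, hy.2]
        nlinarith
      exact mul_le_mul_of_nonneg_left (Real.rpow_le_rpow (by positivity) h14 hβ.le) hj.le
    · exact zero_le
  calc _ ≤ ∫⁻ s in Ioi 0, ENNReal.ofReal (j α 0 * (4 / δ) ^ (α + 1)) *
        ENNReal.ofReal (Real.pi * (y ^ 2 * gauss s y)) := setLIntegral_mono' measurableSet_Ioi hpt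
    _ ≤ ENNReal.ofReal (j α 0 * (4 / δ) ^ (α + 1)) * 1 := by
        rw [lintegral_const_mul' _ _ ENNReal.ofReal_ne_top]
        gcongr
        exact lintegral_sq_mul_gauss_le y
    _ = _ := mul_one _

theorem measurable_heat_mul_sq_mul_gauss {α : ℝ} (hα : -1 / 2 < α) (c γ x : ℝ) :
    Measurable fun p : ℝ × ℝ =>
      ENNReal.ofReal (heat α (c * p.2) x p.1 * (p.1 ^ 2 * gauss (γ * p.2) p.1)) := by
  have h1 := (measurable_heat hα).comp
    (by fun_prop : Measurable fun p : ℝ × ℝ => (c * p.2, x, p.1))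
  have h2 := measurable_gauss.comp (by fun_prop : Measurable fun p : ℝ × ℝ => (γ * p.2, p.1))
  exact (h1.mul ((by fun_prop : Measurable fun p : ℝ × ℝ => p.1 ^ 2).mul h2)).ennreal_ofReal

theorem measurable_heat_mul_sq_mul_gauss_left {α : ℝ} (hα : -1 / 2 < α) (c γ x y : ℝ) :
    Measurable fun s : ℝ =>
      ENNReal.ofReal (heat α (c * s) x y * (y ^ 2 * gauss (γ * s) y)) := by
  have hJ := measurable_besselJ (by linarith : 0 < α + 1)
  unfold heat gauss
  fun_prop

theorem lintegral_lintegral_heat_mul_sq_mul_gauss_le_symm {α : ℝ} (hα : -1 / 2 < α) {c γ : ℝ}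
    (hc : 0 < c) (hγ : 0 < γ) (x : ℝ) :
    ∫⁻ y, (∫⁻ s in Ioi 0, ENNReal.ofReal (heat α (c * s) x y * (y ^ 2 * gauss (γ * s) y))) ∂mu α ≤
      ENNReal.ofReal (rowConst α / γ) := by
  rw [lintegral_lintegral_swap (f := fun y s => ENNReal.ofReal
    (heat α (c * s) x y * (y ^ 2 * gauss (γ * s) y)))
    (measurable_heat_mul_sq_mul_gauss hα c γ x).aemeasurable]
  exact lintegral_lintegral_heat_mul_sq_mul_gauss_le hα hc hγ x

/-- Three contributions: short times, small by `δ` for any set; long times with `y ≤ 2`, a bounded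
integrand on a set of small measure; long times with `y ≥ 2`, by Harnack on each interval `[a, a + 1
/ a]`. -/
theorem IsThin.setLIntegral_cutoffKernel_le {ε α : ℝ} (hα : -1 / 2 < α) {S : Set ℝ}
    (hS : IsThin ε α S) (hSm : MeasurableSet S) (hS0 : S ⊆ Ici 0) {δ : ℝ} (hδ : 0 < δ) {x : ℝ}
    (hx : 0 ≤ x) :
    ∫⁻ y in S, cutoffKernel α x y ∂mu α ≤
      ENNReal.ofReal (Real.exp Real.pi * Real.pi * (rowConst α * δ)) + ENNReal.ofReal ε *
        (ENNReal.ofReal (j α 0 * (4 / δ) ^ (α + 1)) * (mu α (Icc 0 1) + mu α (Icc 1 2)) +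
          ENNReal.ofReal (2 ^ (α + 1) * Real.exp (Real.pi * (2 / δ)) * (2 * Real.pi)) *
            ENNReal.ofReal (rowConst α / (1 / 2))) := by
  set F : ℝ → ℝ≥0∞ := fun y => ∫⁻ s in Ioi 0, farSlice α δ s x y with hF
  set H : ℝ → ℝ≥0∞ := fun y => ∫⁻ s in Ioi 0,
    ENNReal.ofReal (heat α (1 * s) x y * (y ^ 2 * gauss (1 / δ * s) y)) with hH
  set G : ℝ → ℝ≥0∞ := fun y => ∫⁻ s in Ioi 0,
    ENNReal.ofReal (heat α (2 * s) x y * (y ^ 2 * gauss (1 / 2 * s) y)) with hG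
  set A := ENNReal.ofReal (2 ^ (α + 1) * Real.exp (Real.pi * (2 / δ)) * (2 * Real.pi)) with hA
  set B := ENNReal.ofReal (j α 0 * (4 / δ) ^ (α + 1)) with hB
  have hHm : Measurable H :=
    Measurable.lintegral_prod_right' (measurable_heat_mul_sq_mul_gauss hα 1 (1 / δ) x)
  have hGm : Measurable G :=
    Measurable.lintegral_prod_right' (measurable_heat_mul_sq_mul_gauss hα 2 (1 / 2) x)
  have hKle : ∀ y, cutoffKernel α x y ≤
      ENNReal.ofReal (Real.exp Real.pi * Real.pi) * H y + F y := by
    intro y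
    have hm : Measurable fun s => ENNReal.ofReal (heat α (1 * s) x y *
        (y ^ 2 * gauss (1 / δ * s) y)) :=
      measurable_heat_mul_sq_mul_gauss_left hα 1 (1 / δ) x y
    rw [hH, hF]
    simp only
    rw [← lintegral_const_mul _ hm, ← lintegral_add_left (hm.const_mul _)]
    refine setLIntegral_mono' measurableSet_Ioi fun s hs => ?_
    rw [one_mul]
    exact cutoffSlice_le_add_farSlice hα hδ hs x y
  have hnear : ∫⁻ y in S, ENNReal.ofReal (Real.exp Real.pi * Real.pi) * H y ∂mu α ≤
      ENNReal.ofReal (Real.exp Real.pi * Real.pi * (rowConst α * δ)) := by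
    rw [lintegral_const_mul _ hHm, ENNReal.ofReal_mul (p := Real.exp Real.pi * Real.pi)
      (by positivity)]
    refine mul_le_mul_right ((setLIntegral_le_lintegral _ _).trans ?_) _
    have := lintegral_lintegral_heat_mul_sq_mul_gauss_le_symm hα one_pos
      (by positivity : 0 < 1 / δ) x
    rwa [div_div_eq_mul_div, div_one] at this
  have hlow : ∫⁻ y in S ∩ Icc 0 2, F y ∂mu α ≤
      ENNReal.ofReal ε * (B * (mu α (Icc 0 1) + mu α (Icc 1 2))) := by
    calc _ ≤ ∫⁻ _ in S ∩ Icc 0 2, B ∂mu α :=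
          setLIntegral_mono' (hSm.inter measurableSet_Icc) fun y hy =>
            lintegral_farSlice_le_of_le_two hα hδ hx hy.2
      _ = B * mu α (S ∩ Icc 0 2) := setLIntegral_const _ _
      _ ≤ B * (ENNReal.ofReal ε * (mu α (Icc 0 1) + mu α (Icc 1 2))) := by
          gcongr
          exact hS.measure_inter_Icc_le
      _ = _ := mul_left_comm _ _ _
  have hhigh : ∫⁻ y in S ∩ Ici 2, F y ∂mu α ≤
      ENNReal.ofReal ε * (A * ENNReal.ofReal (rowConst α / (1 / 2))) := by
    refine (hS.setLIntegral_inter_Ici_le hSm (F := F) (G := fun y => A * G y) ?_).trans ?_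
    · intro a ha y hy y' hy'
      rw [hF, hG]
      simp only
      rw [← lintegral_const_mul' _ _ ENNReal.ofReal_ne_top]
      refine setLIntegral_mono' measurableSet_Ioi fun s hs => ?_
      unfold farSlice
      split_ifs with h
      · exact cutoffSlice_le hα hδ hs hx ha hy hy' h
      · exact zero_le
    · rw [lintegral_const_mul _ hGm]
      gcongr
      exact lintegral_lintegral_heat_mul_sq_mul_gauss_le_symm hα two_pos one_half_pos x
  have hSun : S = S ∩ Icc 0 2 ∪ S ∩ Ici 2 := by
    rw [← inter_union_distrib_left]
    refine (inter_eq_left.2 fun y hy => ?_).symm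
    rcases le_total y 2 with h | h
    · exact Or.inl ⟨hS0 hy, h⟩
    · exact Or.inr h
  calc ∫⁻ y in S, cutoffKernel α x y ∂mu α
      ≤ ∫⁻ y in S, (ENNReal.ofReal (Real.exp Real.pi * Real.pi) * H y + F y) ∂mu α :=
        lintegral_mono fun y => hKle y
    _ = (∫⁻ y in S, ENNReal.ofReal (Real.exp Real.pi * Real.pi) * H y ∂mu α) +
        ∫⁻ y in S, F y ∂mu α := lintegral_add_left (hHm.const_mul _) _
    _ ≤ (∫⁻ y in S, ENNReal.ofReal (Real.exp Real.pi * Real.pi) * H y ∂mu α) +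
        ((∫⁻ y in S ∩ Icc 0 2, F y ∂mu α) + ∫⁻ y in S ∩ Ici 2, F y ∂mu α) := by
        gcongr
        conv_lhs => rw [hSun]
        exact lintegral_union_le _ _ _
    _ ≤ _ := by
        rw [mul_add]
        gcongr

theorem exists_isThin_setLIntegral_cutoffKernel_le {α : ℝ} (hα : -1 / 2 < α) {η : ℝ}
    (hη : 0 < η) :
    ∃ ε₀ > 0, ∀ ε < ε₀, ∀ S : Set ℝ, IsThin ε α S → MeasurableSet S → S ⊆ Ici 0 → ∀ x, 0 ≤ x →
      ∫⁻ y in S, cutoffKernel α x y ∂mu α ≤ ENNReal.ofReal η := by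
  have : Fact (-1 / 2 < α) := ⟨hα⟩
  have hC := rowConst_pos hα
  have hpi := Real.pi_pos
  -- `δ` is fixed first, so that short times cost exactly `η / 2`. The factor `B` of `ε` grows with
  -- `1 / δ` but is then a constant, and the threshold for `ε` is chosen last.
  set δ := η / 2 / (Real.exp Real.pi * Real.pi * rowConst α) with hδ
  have hδ0 : 0 < δ := by positivity
  have hδη : Real.exp Real.pi * Real.pi * (rowConst α * δ) = η / 2 := by
    rw [hδ]; field_simp
  set B := ENNReal.ofReal (j α 0 * (4 / δ) ^ (α + 1)) * (mu α (Icc 0 1) + mu α (Icc 1 2)) +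
          ENNReal.ofReal (2 ^ (α + 1) * Real.exp (Real.pi * (2 / δ)) * (2 * Real.pi)) *
            ENNReal.ofReal (rowConst α / (1 / 2)) with hB
  have hBtop : B ≠ ∞ := by
    have h1 : mu α (Icc 0 1) < ∞ := isCompact_Icc.measure_lt_top
    have h2 : mu α (Icc 1 2) < ∞ := isCompact_Icc.measure_lt_top
    exact ENNReal.add_ne_top.2 ⟨ENNReal.mul_ne_top ENNReal.ofReal_ne_top
      (ENNReal.add_ne_top.2 ⟨h1.ne, h2.ne⟩),
      ENNReal.mul_ne_top ENNReal.ofReal_ne_top ENNReal.ofReal_ne_top⟩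
  have hb0 : 0 ≤ B.toReal := ENNReal.toReal_nonneg
  refine ⟨η / 2 / (B.toReal + 1), by positivity, fun ε hε S hS hSm hS0 x hx => ?_⟩
  refine (hS.setLIntegral_cutoffKernel_le hα hSm hS0 hδ0 hx).trans ?_
  rw [hδη, ← hB, ← ENNReal.ofReal_toReal hBtop]
  calc ENNReal.ofReal (η / 2) + ENNReal.ofReal ε * ENNReal.ofReal B.toReal
      ≤ ENNReal.ofReal (η / 2) + ENNReal.ofReal (η / 2 / (B.toReal + 1)) *
        ENNReal.ofReal B.toReal := by gcongr
    _ = ENNReal.ofReal (η / 2 + η / 2 / (B.toReal + 1) * B.toReal) := by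
        rw [← ENNReal.ofReal_mul (by positivity), ← ENNReal.ofReal_add (by positivity)
          (by positivity)]
    _ ≤ ENNReal.ofReal η := by
        refine ENNReal.ofReal_le_ofReal ?_
        have : η / 2 / (B.toReal + 1) * B.toReal ≤ η / 2 := by
          rw [div_mul_eq_mul_div, div_le_iff₀ (by positivity)]
          nlinarith
        linarith

/-! ### The two cutoffs dominate the identity. -/

/-- The quadratic form of the slice of the cutoff kernel at time `s`. -/
def sliceForm (α s : ℝ) (u : ℝ → ℝ≥0∞) : ℝ≥0∞ :=
  ∫⁻ p, cutoffSlice α s p.1 p.2 * (u p.1 * u p.2) ∂(mu α).prod (mu α)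

/-- The bilinear form of the cutoff kernel. -/
def cutoffForm (α : ℝ) (u v : ℝ → ℝ≥0∞) : ℝ≥0∞ :=
  ∫⁻ p, cutoffKernel α p.1 p.2 * (u p.1 * v p.2) ∂(mu α).prod (mu α)

theorem lintegral_sliceForm {α : ℝ} (hα : -1 / 2 < α) {u : ℝ → ℝ≥0∞} (hu : Measurable u) :
    ∫⁻ s in Ioi 0, sliceForm α s u = cutoffForm α u u := by
  have hm := measurable_cutoffSlice hα
  unfold sliceForm cutoffForm
  rw [lintegral_lintegral_swap (f := fun s (p : ℝ × ℝ) =>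
    cutoffSlice α s p.1 p.2 * (u p.1 * u p.2))]
  · refine lintegral_congr fun p => ?_
    rw [lintegral_mul_const, cutoffKernel]
    have hJ := measurable_besselJ (by linarith : 0 < α + 1)
    unfold cutoffSlice heat gauss
    fun_prop
  · refine Measurable.aemeasurable ?_
    exact hm.mul (by fun_prop : Measurable fun q : ℝ × ℝ × ℝ => u q.2.1 * u q.2.2)

theorem measurable_sliceForm {α : ℝ} (hα : -1 / 2 < α) {u : ℝ → ℝ≥0∞} (hu : Measurable u) :
    Measurable fun s => sliceForm α s u :=
  Measurable.lintegral_prod_right' (f := fun q : ℝ × ℝ × ℝ =>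
    cutoffSlice α q.1 q.2.1 q.2.2 * (u q.2.1 * u q.2.2))
    ((measurable_cutoffSlice hα).mul (by fun_prop))

theorem integrable_mul_mul_j {α : ℝ} (hα : -1 / 2 < α) {u v : ℝ → ℂ} (hu : Integrable u (mu α))
    (hv : Integrable v (mu α)) :
    Integrable (fun p : ℝ × ℝ => u p.1 * (v p.2 * (j α (2 * Real.pi * p.2 * p.1) : ℂ)))
      ((mu α).prod (mu α)) := by
  have h := (hu.mul_prod hv).mul_bdd (c := j α 0)
    ((measurable_j_mul hα).comp measurable_swap).aestronglyMeasurable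
    (Eventually.of_forall fun _ => norm_ofReal_j_le hα _)
  refine h.congr (Eventually.of_forall fun p => ?_)
  simp only [Function.comp_apply, Prod.fst_swap, Prod.snd_swap]
  ring

theorem integral_mul_mul_j {α : ℝ} (hα : -1 / 2 < α) {u v : ℝ → ℂ} (hu : Integrable u (mu α))
    (hv : Integrable v (mu α)) :
    ∫ p, u p.1 * (v p.2 * (j α (2 * Real.pi * p.2 * p.1) : ℂ)) ∂(mu α).prod (mu α) =
      ∫ ξ, u ξ * transform α v ξ ∂mu α := by
  rw [integral_prod _ (integrable_mul_mul_j hα hu hv)]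
  simp only [integral_const_mul, transform]

/-- Multiplication by a Gaussian becomes the heat flow. -/
theorem transform_gauss_mul {α : ℝ} (hα : -1 / 2 < α) {s : ℝ} (hs : 0 < s) {h : ℝ → ℂ}
    (hh : Integrable h (mu α)) (ξ : ℝ) :
    transform α (fun x => (gauss s x : ℂ) * h x) ξ =
      ∫ η, (heat α s ξ η : ℂ) * transform α h η ∂mu α := by
  have hH : Integrable (fun η => (heat α s ξ η : ℂ)) (mu α) := (integrable_heat hα hs ξ).ofReal
  rw [← integral_mul_mul_j hα hH hh, integral_prod_symm _ (integrable_mul_mul_j hα hH hh),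
    transform]
  congr 1
  ext x
  have h1 := congrArg (Complex.ofReal) (integral_heat_mul_j hα hs ξ x)
  rw [← integral_complex_ofReal, mul_right_comm _ ξ x] at h1
  calc (gauss s x : ℂ) * h x * (j α (2 * Real.pi * x * ξ) : ℂ)
      = ((gauss s x * j α (2 * Real.pi * x * ξ) : ℝ) : ℂ) * h x := by push_cast; ring
    _ = _ := by
      rw [← h1, ← integral_mul_const]
      congr 1
      ext η
      rw [mul_right_comm _ η x]
      push_cast
      ring

theorem enorm_ofReal_of_nonneg {r : ℝ} (hr : 0 ≤ r) : ‖(r : ℂ)‖ₑ = ENNReal.ofReal r := by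
  rw [← ofReal_norm, Complex.norm_real, Real.norm_of_nonneg hr]

theorem sq_mul_gauss_le {s : ℝ} (hs : 0 < s) (x : ℝ) :
    Real.pi * (x ^ 2 * gauss s x) ≤ 1 / s := by
  have hv : Real.pi * s * x ^ 2 * Real.exp (-(Real.pi * s * x ^ 2)) ≤ 1 := by
    rw [Real.exp_neg, ← div_eq_mul_inv, div_le_one (Real.exp_pos _)]
    linarith [Real.add_one_le_exp (Real.pi * s * x ^ 2)]
  rw [le_div_iff₀ hs, gauss, neg_mul]
  linarith

theorem integrable_gauss_mul {α : ℝ} {s : ℝ} (hs : 0 < s) {h : ℝ → ℂ} (hh : Integrable h (mu α)) :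
    Integrable (fun x => (gauss s x : ℂ) * h x) (mu α) := by
  have := measurable_gauss_right s
  refine hh.bdd_mul (c := 1) (by fun_prop) (Eventually.of_forall fun x => ?_)
  rw [Complex.norm_real, Real.norm_of_nonneg (gauss_pos s x).le]
  exact gauss_le_one hs.le x

theorem integrable_sq_mul_gauss_mul {α : ℝ} {s : ℝ} (hs : 0 < s) {h : ℝ → ℂ}
    (hh : Integrable h (mu α)) :
    Integrable (fun x => ((Real.pi * (x ^ 2 * gauss s x) : ℝ) : ℂ) * h x) (mu α) := by
  have := measurable_gauss_right s
  refine hh.bdd_mul (c := 1 / s) (by fun_prop) (Eventually.of_forall fun x => ?_)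
  have hg := gauss_pos s x
  rw [Complex.norm_real, Real.norm_of_nonneg (by positivity)]
  exact sq_mul_gauss_le hs x

theorem integrable_gauss_mul_transform {α : ℝ} (hα : -1 / 2 < α) {s : ℝ} (hs : 0 < s) {f : ℝ → ℂ}
    (hfm : Measurable f) (hf : Integrable f (mu α)) :
    Integrable (fun x => (gauss s x : ℂ) * transform α f x) (mu α) :=
  (integrable_gauss hα hs).ofReal.mul_bdd (measurable_transform hα hfm).aestronglyMeasurable
    (Eventually.of_forall fun ξ => norm_transform_le hα hf ξ)

theorem integrable_sq_mul_gauss_mul_transform {α : ℝ} (hα : -1 / 2 < α) {s : ℝ} (hs : 0 < s)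
    {f : ℝ → ℂ} (hfm : Measurable f) (hf : Integrable f (mu α)) :
    Integrable (fun x => ((Real.pi * (x ^ 2 * gauss s x) : ℝ) : ℂ) * transform α f x) (mu α) := by
  have h := (integrable_pow_mul_exp hα (by positivity : 0 < Real.pi * s) 1).const_mul Real.pi
  exact (Integrable.ofReal h).mul_bdd (measurable_transform hα hfm).aestronglyMeasurable
    (Eventually.of_forall fun ξ => norm_transform_le hα hf ξ)

/-- The Gaussian on the frequency side becomes the heat kernel between positions. This is the part
of `-G'` in which the factor `π x ^ 2` falls on the position. -/
theorem enorm_integral_gauss_mul_transform_le {α : ℝ} (hα : -1 / 2 < α) {s : ℝ} (hs : 0 < s)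
    {f : ℝ → ℂ} (hf : Integrable f (mu α)) :
    ‖∫ ξ, (gauss s ξ : ℂ) * transform α f ξ *
      transform α (fun x => ((Real.pi * (x ^ 2 * gauss s x) : ℝ) : ℂ) * conj (f x)) ξ ∂mu α‖ₑ ≤
      sliceForm α s fun x => ‖f x‖ₑ := by
  have h := integral_gauss_mul_transform_mul_conj hα hs hf (integrable_sq_mul_gauss_mul hs hf)
  have h1 : ∀ ξ, (gauss s ξ : ℂ) * transform α f ξ *
      transform α (fun x => ((Real.pi * (x ^ 2 * gauss s x) : ℝ) : ℂ) * conj (f x)) ξ =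
      (gauss s ξ : ℂ) * (transform α f ξ * conj (transform α
        (fun x => ((Real.pi * (x ^ 2 * gauss s x) : ℝ) : ℂ) * f x) ξ)) := by
    intro ξ
    rw [conj_transform, mul_assoc]
    simp only [map_mul, Complex.conj_ofReal]
  simp only [h1]
  rw [h]
  refine (enorm_integral_le_lintegral_enorm _).trans (le_of_eq ?_)
  refine lintegral_congr fun p => ?_
  have hg := gauss_pos s p.2
  have hh := heat_pos hα hs p.1 p.2
  rw [enorm_mul, enorm_mul, map_mul, enorm_mul, Complex.conj_ofReal, enorm_ofReal_of_nonneg hh.le,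
    enorm_ofReal_of_nonneg (by positivity), RCLike.enorm_conj, cutoffSlice,
    ENNReal.ofReal_mul hh.le]
  ring

theorem measurable_cutoffSlice_right {α : ℝ} (hα : -1 / 2 < α) (s : ℝ) :
    Measurable fun p : ℝ × ℝ => cutoffSlice α s p.1 p.2 := by
  have hJ := measurable_besselJ (by linarith : 0 < α + 1)
  unfold cutoffSlice heat gauss
  fun_prop

/-- The dual part of `-G'`: the factor `π ξ ^ 2` stays on the frequency, and the Gaussian in
position becomes the heat kernel between frequencies by `transform_gauss_mul`. -/
theorem enorm_integral_sq_mul_gauss_mul_transform_le {α : ℝ} (hα : -1 / 2 < α) {s : ℝ} (hs : 0 < s)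
    {f : ℝ → ℂ} (hfm : Measurable f) (hf : Integrable f (mu α)) :
    ‖∫ ξ, ((Real.pi * (ξ ^ 2 * gauss s ξ) : ℝ) : ℂ) * transform α f ξ *
      transform α (fun x => (gauss s x : ℂ) * conj (f x)) ξ ∂mu α‖ₑ ≤
      sliceForm α s fun x => ‖transform α f x‖ₑ := by
  have hF := measurable_transform hα hfm
  have hK : Measurable fun p : ℝ × ℝ => cutoffSlice α s p.1 p.2 *
      (‖transform α f p.1‖ₑ * ‖transform α f p.2‖ₑ) :=
    (measurable_cutoffSlice_right hα s).mul (by fun_prop)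
  unfold sliceForm
  rw [lintegral_prod_symm _ hK.aemeasurable]
  refine (enorm_integral_le_lintegral_enorm _).trans (lintegral_mono fun ξ => ?_)
  have hg := gauss_pos s ξ
  rw [enorm_mul, enorm_mul, transform_gauss_mul hα hs (integrable_conj hf),
    enorm_ofReal_of_nonneg (by positivity)]
  calc _ ≤ ENNReal.ofReal (Real.pi * (ξ ^ 2 * gauss s ξ)) * ‖transform α f ξ‖ₑ *
        ∫⁻ η, ‖(heat α s ξ η : ℂ) * transform α (fun x => conj (f x)) η‖ₑ ∂mu α := by
        gcongr
        exact enorm_integral_le_lintegral_enorm _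
    _ = _ := by
        rw [← lintegral_const_mul' _ _ (ENNReal.mul_ne_top ENNReal.ofReal_ne_top enorm_ne_top)]
        refine lintegral_congr fun η => ?_
        have hh := heat_pos hα hs ξ η
        rw [enorm_mul, ← conj_transform, RCLike.enorm_conj, enorm_ofReal_of_nonneg hh.le,
          cutoffSlice, heat_comm α s η ξ, ENNReal.ofReal_mul hh.le]
        ring

/-- The pairing of `e_s 𝓕 f` with `𝓕 (e_s f)`, for the Gaussian `e_s`. -/
def gaussPairing (α : ℝ) (f : ℝ → ℂ) (s : ℝ) : ℂ :=
  ∫ p, ((gauss s p.1 * gauss s p.2 : ℝ) : ℂ) * (transform α f p.1 *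
    (conj (f p.2) * (j α (2 * Real.pi * p.2 * p.1) : ℂ))) ∂(mu α).prod (mu α)

theorem integrable_gaussPairing {α : ℝ} (hα : -1 / 2 < α) {s : ℝ} (hs : 0 < s)
    {f : ℝ → ℂ} (hfm : Measurable f) (hf : Integrable f (mu α)) :
    Integrable (fun p : ℝ × ℝ => ((gauss s p.1 * gauss s p.2 : ℝ) : ℂ) * (transform α f p.1 *
      (conj (f p.2) * (j α (2 * Real.pi * p.2 * p.1) : ℂ)))) ((mu α).prod (mu α)) := by
  refine (integrable_mul_mul_j hα (integrable_gauss_mul_transform hα hs hfm hf)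
    (integrable_gauss_mul hs (integrable_conj hf))).congr (Eventually.of_forall fun p => ?_)
  push_cast
  ring

theorem gaussPairing_eq {α : ℝ} (hα : -1 / 2 < α) {s : ℝ} (hs : 0 < s)
    {f : ℝ → ℂ} (hfm : Measurable f) (hf : Integrable f (mu α)) :
    gaussPairing α f s = ∫ ξ, (gauss s ξ : ℂ) * transform α f ξ *
      transform α (fun x => (gauss s x : ℂ) * conj (f x)) ξ ∂mu α := by
  rw [← integral_mul_mul_j hα (integrable_gauss_mul_transform hα hs hfm hf)
    (integrable_gauss_mul hs (integrable_conj hf)), gaussPairing]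
  congr 1
  ext p
  push_cast
  ring

theorem gaussPairing_deriv {α : ℝ} (hα : -1 / 2 < α) {s : ℝ} (hs : 0 < s)
    {f : ℝ → ℂ} (hfm : Measurable f) (hf : Integrable f (mu α)) :
    Integrable (fun p : ℝ × ℝ => ((Real.pi * (p.1 ^ 2 + p.2 ^ 2) * (gauss s p.1 * gauss s p.2) : ℝ)
      : ℂ) * (transform α f p.1 * (conj (f p.2) * (j α (2 * Real.pi * p.2 * p.1) : ℂ))))
      ((mu α).prod (mu α)) ∧
    ‖∫ p, ((Real.pi * (p.1 ^ 2 + p.2 ^ 2) * (gauss s p.1 * gauss s p.2) : ℝ) : ℂ) *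
      (transform α f p.1 * (conj (f p.2) * (j α (2 * Real.pi * p.2 * p.1) : ℂ)))
        ∂(mu α).prod (mu α)‖ₑ ≤
      sliceForm α s (fun x => ‖f x‖ₑ) + sliceForm α s fun x => ‖transform α f x‖ₑ := by
  have u1 := integrable_gauss_mul_transform hα hs hfm hf
  have u2 := integrable_sq_mul_gauss_mul_transform hα hs hfm hf
  have v1 := integrable_gauss_mul hs (integrable_conj hf)
  have v2 := integrable_sq_mul_gauss_mul hs (integrable_conj hf)
  have i1 := integrable_mul_mul_j hα u1 v2
  have i2 := integrable_mul_mul_j hα u2 v1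
  have e : (fun p : ℝ × ℝ => ((Real.pi * (p.1 ^ 2 + p.2 ^ 2) * (gauss s p.1 * gauss s p.2) : ℝ)
      : ℂ) * (transform α f p.1 * (conj (f p.2) * (j α (2 * Real.pi * p.2 * p.1) : ℂ)))) =
      fun p => (gauss s p.1 : ℂ) * transform α f p.1 *
        (((Real.pi * (p.2 ^ 2 * gauss s p.2) : ℝ) : ℂ) * conj (f p.2) *
          (j α (2 * Real.pi * p.2 * p.1) : ℂ)) +
        ((Real.pi * (p.1 ^ 2 * gauss s p.1) : ℝ) : ℂ) * transform α f p.1 *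
        ((gauss s p.2 : ℂ) * conj (f p.2) * (j α (2 * Real.pi * p.2 * p.1) : ℂ)) := by
    ext p
    push_cast
    ring
  rw [e]
  refine ⟨i1.add i2, ?_⟩
  rw [integral_add i1 i2, integral_mul_mul_j hα u1 v2, integral_mul_mul_j hα u2 v1]
  exact (enorm_add_le _ _).trans (add_le_add (enorm_integral_gauss_mul_transform_le hα hs hf)
    (enorm_integral_sq_mul_gauss_mul_transform_le hα hs hfm hf))

theorem integral_Ioc_gauss_mul_gauss {a b : ℝ} (hab : a ≤ b) (x y : ℝ) :
    ∫ s in Ioc a b, Real.pi * (x ^ 2 + y ^ 2) * (gauss s x * gauss s y) =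
      gauss a x * gauss a y - gauss b x * gauss b y := by
  have hd : ∀ s, HasDerivAt (fun s => -(gauss s x * gauss s y))
      (Real.pi * (x ^ 2 + y ^ 2) * (gauss s x * gauss s y)) s := by
    intro s
    have h : ∀ z, HasDerivAt (fun s => gauss s z) (gauss s z * (-Real.pi * z ^ 2)) s := by
      intro z
      have h1 : HasDerivAt (fun s => -(Real.pi * s) * z ^ 2) (-Real.pi * z ^ 2) s := by
        simpa using (((hasDerivAt_id' s).const_mul Real.pi).neg.mul_const (z ^ 2))
      exact h1.exp
    convert! ((h x).mul (h y)).neg using 1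
    ring
  rw [← intervalIntegral.integral_of_le hab, intervalIntegral.integral_eq_sub_of_hasDerivAt
    (fun s _ => hd s)]
  · ring
  · refine Continuous.intervalIntegrable ?_ _ _
    have h1 := continuous_gauss_left x
    have h2 := continuous_gauss_left y
    fun_prop

/-- The fundamental theorem of calculus is applied to the product of the two Gaussians at fixed
position and frequency and then integrated by Fubini, which avoids differentiating `gaussPairing`
itself. -/
theorem enorm_gaussPairing_sub_le {α : ℝ} (hα : -1 / 2 < α) {f : ℝ → ℂ} (hfm : Measurable f)
    (hf : Integrable f (mu α)) {a b : ℝ} (ha : 0 < a) (hab : a ≤ b) :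
    ‖gaussPairing α f a - gaussPairing α f b‖ₑ ≤
      cutoffForm α (fun x => ‖f x‖ₑ) (fun x => ‖f x‖ₑ) +
        cutoffForm α (fun x => ‖transform α f x‖ₑ) (fun x => ‖transform α f x‖ₑ) := by
  have hF := measurable_transform hα hfm
  set W : ℝ × ℝ → ℂ := fun p => transform α f p.1 *
    (conj (f p.2) * (j α (2 * Real.pi * p.2 * p.1) : ℂ)) with hW
  have hWm : Measurable W := by
    have h1 := (measurable_j_mul hα).comp measurable_swap
    exact (hF.comp measurable_fst).mul
      ((Complex.continuous_conj.measurable.comp (hfm.comp measurable_snd)).mul h1)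
  have hg1 : Measurable fun q : ℝ × ℝ × ℝ => gauss q.1 q.2.1 :=
    measurable_gauss.comp (by fun_prop : Measurable fun q : ℝ × ℝ × ℝ => (q.1, q.2.1))
  have hg2 : Measurable fun q : ℝ × ℝ × ℝ => gauss q.1 q.2.2 :=
    measurable_gauss.comp (by fun_prop : Measurable fun q : ℝ × ℝ × ℝ => (q.1, q.2.2))
  set D : ℝ → ℝ × ℝ → ℝ := fun s p =>
    Real.pi * (p.1 ^ 2 + p.2 ^ 2) * (gauss s p.1 * gauss s p.2) with hD
  have hDm : Measurable fun q : ℝ × ℝ × ℝ => D q.1 q.2 := by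
    simp only [hD]
    exact Measurable.mul (by fun_prop) (hg1.mul hg2)
  have hD0 : ∀ s p, 0 ≤ D s p := fun s p => by
    have h1 := gauss_pos s p.1
    have h2 := gauss_pos s p.2
    simp only [hD]
    positivity
  have hDW := (gaussPairing_deriv hα ha hfm hf).1
  have hint : Integrable (Function.uncurry fun s p => (D s p : ℂ) * W p)
      ((volume.restrict (Ioc a b)).prod ((mu α).prod (mu α))) := by
    -- `gauss s` decreases in `s`, so on `(a, b]` the integrand is dominated by its value at `a`,
    -- which is integrable because `a > 0`.
    have h1 : Integrable (fun q : ℝ × ℝ × ℝ => (1 : ℝ) * ‖(D a q.2 : ℂ) * W q.2‖)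
        ((volume.restrict (Ioc a b)).prod ((mu α).prod (mu α))) :=
      (integrable_const (1 : ℝ)).mul_prod hDW.norm
    refine h1.mono' ?_ ?_
    · refine Measurable.aestronglyMeasurable ?_
      exact (Complex.measurable_ofReal.comp hDm).mul (hWm.comp measurable_snd)
    · have hae : ∀ᵐ q ∂(volume.restrict (Ioc a b)).prod ((mu α).prod (mu α)), q.1 ∈ Ioc a b :=
        Measure.quasiMeasurePreserving_fst.ae (ae_restrict_mem measurableSet_Ioc)
      filter_upwards [hae] with q hq
      rw [one_mul, Function.uncurry, norm_mul, norm_mul _ (W q.2), Complex.norm_real, Complex.norm_real,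
        Real.norm_of_nonneg (hD0 _ _), Real.norm_of_nonneg (hD0 _ _)]
      have hqa := hq.1.le
      have h1 := gauss_pos q.1 q.2.2
      have h2 := gauss_pos a q.2.1
      have hmono : ∀ z, gauss q.1 z ≤ gauss a z := fun z => by
        unfold gauss
        gcongr
      simp only [hD]
      have h3 := hmono q.2.1
      have h4 := hmono q.2.2
      gcongr
  have hswap := integral_integral_swap hint
  have hright : ∫ p, (∫ s in Ioc a b, (D s p : ℂ) * W p) ∂(mu α).prod (mu α) =
      gaussPairing α f a - gaussPairing α f b := by
    rw [gaussPairing, gaussPairing, ← integral_sub (integrable_gaussPairing hα ha hfm hf)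
      (integrable_gaussPairing hα (ha.trans_le hab) hfm hf)]
    congr 1
    ext p
    rw [integral_mul_const, integral_complex_ofReal, integral_Ioc_gauss_mul_gauss hab]
    push_cast
    ring
  rw [← hright, ← hswap]
  calc ‖∫ s in Ioc a b, ∫ p, (D s p : ℂ) * W p ∂(mu α).prod (mu α)‖ₑ
      ≤ ∫⁻ s in Ioc a b, ‖∫ p, (D s p : ℂ) * W p ∂(mu α).prod (mu α)‖ₑ :=
        enorm_integral_le_lintegral_enorm _
    _ ≤ ∫⁻ s in Ioc a b, (sliceForm α s (fun x => ‖f x‖ₑ) +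
          sliceForm α s fun x => ‖transform α f x‖ₑ) :=
        setLIntegral_mono' measurableSet_Ioc fun s hs =>
          (gaussPairing_deriv hα (ha.trans hs.1) hfm hf).2
    _ ≤ ∫⁻ s in Ioi 0, (sliceForm α s (fun x => ‖f x‖ₑ) +
          sliceForm α s fun x => ‖transform α f x‖ₑ) :=
        lintegral_mono_set fun s hs => ha.trans hs.1
    _ = _ := by
        rw [lintegral_add_left (measurable_sliceForm hα (by fun_prop)),
          lintegral_sliceForm hα (by fun_prop), lintegral_sliceForm hα (by fun_prop)]

theorem tendsto_gaussPairing_atTop {α : ℝ} (hα : -1 / 2 < α) {f : ℝ → ℂ} (hfm : Measurable f)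
    (hf : Integrable f (mu α)) : Tendsto (gaussPairing α f) atTop (𝓝 0) := by
  have hF := measurable_transform hα hfm
  have hWm : Measurable fun p : ℝ × ℝ => transform α f p.1 *
      (conj (f p.2) * (j α (2 * Real.pi * p.2 * p.1) : ℂ)) := by
    have h1 := (measurable_j_mul hα).comp measurable_swap
    exact (hF.comp measurable_fst).mul
      ((Complex.continuous_conj.measurable.comp (hfm.comp measurable_snd)).mul h1)
  have h0 : (0 : ℂ) = ∫ _ : ℝ × ℝ, (0 : ℂ) ∂(mu α).prod (mu α) := by simp
  rw [h0]
  refine tendsto_integral_filter_of_dominated_convergence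
    (fun p : ℝ × ℝ => ‖((gauss 1 p.1 * gauss 1 p.2 : ℝ) : ℂ) * (transform α f p.1 *
      (conj (f p.2) * (j α (2 * Real.pi * p.2 * p.1) : ℂ)))‖) ?_ ?_
    (integrable_gaussPairing hα one_pos hfm hf).norm ?_
  · refine Eventually.of_forall fun s => Measurable.aestronglyMeasurable ?_
    have := measurable_gauss_right s
    exact Measurable.mul (by fun_prop) hWm
  · filter_upwards [eventually_ge_atTop 1] with s hs
    refine Eventually.of_forall fun p => ?_
    have hmono : ∀ z, gauss s z ≤ gauss 1 z := fun z => by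
      unfold gauss
      gcongr
    have h1 := gauss_pos s p.1
    have h2 := gauss_pos s p.2
    have h3 := gauss_pos 1 p.1
    have h4 := gauss_pos 1 p.2
    rw [norm_mul, norm_mul _ (transform α f p.1 * _), Complex.norm_real, Complex.norm_real,
      Real.norm_of_nonneg (by positivity), Real.norm_of_nonneg (by positivity)]
    gcongr
    · exact hmono _
    · exact hmono _
  · have h1 := Measure.quasiMeasurePreserving_fst (μ := mu α) (ν := mu α) |>.ae (ae_mu_pos α)
    have h2 := Measure.quasiMeasurePreserving_snd (μ := mu α) (ν := mu α) |>.ae (ae_mu_pos α)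
    have hlim : ∀ z : ℝ, 0 < z → Tendsto (fun s => gauss s z) atTop (𝓝 0) := by
      intro z hz
      have : Tendsto (fun s : ℝ => -(Real.pi * z ^ 2) * s) atTop atBot :=
        tendsto_id.const_mul_atTop_of_neg (neg_lt_zero.2 (by positivity))
      refine (Real.tendsto_exp_atBot.comp this).congr fun s => ?_
      simp only [Function.comp_apply, gauss]
      congr 1
      ring
    filter_upwards [h1, h2] with p hp1 hp2
    have h3 := (hlim _ hp1).mul (hlim _ hp2)
    rw [mul_zero] at h3
    have h4 := (Complex.continuous_ofReal.tendsto 0).comp h3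
    rw [Complex.ofReal_zero] at h4
    simpa using h4.mul_const (transform α f p.1 *
      (conj (f p.2) * (j α (2 * Real.pi * p.2 * p.1) : ℂ)))

theorem enorm_gaussPairing_le {α : ℝ} (hα : -1 / 2 < α) {f : ℝ → ℂ} (hfm : Measurable f)
    (hf : Integrable f (mu α)) {a : ℝ} (ha : 0 < a) :
    ‖gaussPairing α f a‖ₑ ≤
      cutoffForm α (fun x => ‖f x‖ₑ) (fun x => ‖f x‖ₑ) +
        cutoffForm α (fun x => ‖transform α f x‖ₑ) (fun x => ‖transform α f x‖ₑ) := by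
  have h1 : Tendsto (fun b => gaussPairing α f a - gaussPairing α f b) atTop
      (𝓝 (gaussPairing α f a - 0)) :=
    tendsto_const_nhds.sub (tendsto_gaussPairing_atTop hα hfm hf)
  rw [sub_zero] at h1
  refine le_of_tendsto h1.enorm ?_
  filter_upwards [eventually_ge_atTop a] with b hb
  exact enorm_gaussPairing_sub_le hα hfm hf ha hb

/-- `conj (F f)` is the transform of `conj f`, which is split as `e_s conj f` plus a remainder. The
first piece gives `G(s)`, and the remainder tends to `0` in `L²` as `s → 0`. -/
theorem lintegral_gauss_mul_enorm_transform_sq_le {α : ℝ} (hα : -1 / 2 < α) {s : ℝ} (hs : 0 < s)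
    {f : ℝ → ℂ} (hfm : Measurable f) (hf : Integrable f (mu α)) :
    ∫⁻ ξ, ENNReal.ofReal (gauss s ξ) * ‖transform α f ξ‖ₑ ^ 2 ∂mu α ≤
      ‖gaussPairing α f s‖ₑ + ∫⁻ ξ, ‖transform α f ξ‖ₑ *
        ‖transform α (fun x => conj (f x) - (gauss s x : ℂ) * conj (f x)) ξ‖ₑ ∂mu α := by
  have hfc := integrable_conj hf
  have hgf := integrable_gauss_mul hs hfc
  have u1 := integrable_gauss_mul_transform hα hs hfm hf
  have hbd : ∀ {h : ℝ → ℂ}, Measurable h → Integrable h (mu α) →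
      Integrable (fun ξ => (gauss s ξ : ℂ) * transform α f ξ * transform α h ξ) (mu α) :=
    fun hm hh => u1.mul_bdd (measurable_transform hα hm).aestronglyMeasurable
      (Eventually.of_forall fun ξ => norm_transform_le hα hh ξ)
  have hg := measurable_gauss_right s
  have hcm : Measurable fun x => conj (f x) := Complex.continuous_conj.measurable.comp hfm
  have hgm : Measurable fun x => (gauss s x : ℂ) * conj (f x) := by fun_prop
  have e1 : ((∫ ξ, gauss s ξ * ‖transform α f ξ‖ ^ 2 ∂mu α : ℝ) : ℂ) = gaussPairing α f s +
      ∫ ξ, (gauss s ξ : ℂ) * transform α f ξ *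
        transform α (fun x => conj (f x) - (gauss s x : ℂ) * conj (f x)) ξ ∂mu α := by
    have u2 : Integrable (fun ξ => (gauss s ξ : ℂ) * transform α f ξ *
        transform α (fun x => conj (f x) - (gauss s x : ℂ) * conj (f x)) ξ) (mu α) :=
      hbd (hcm.sub hgm) (hfc.sub hgf)
    rw [gaussPairing_eq hα hs hfm hf, ← integral_add (hbd hgm hgf) u2, ← integral_complex_ofReal]
    congr 1
    ext ξ
    rw [transform_sub hα hfc hgf, ← conj_transform]
    push_cast
    rw [← Complex.ofReal_pow, ← Complex.normSq_eq_norm_sq, ← Complex.mul_conj]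
    ring
  rw [lintegral_gauss_mul_enorm_transform_sq hα hs hfm hf, ← enorm_ofReal_of_nonneg
    (integral_nonneg fun ξ => mul_nonneg (gauss_pos _ _).le (sq_nonneg _)), e1]
  refine (enorm_add_le _ _).trans (add_le_add le_rfl ?_)
  refine (enorm_integral_le_lintegral_enorm _).trans (lintegral_mono fun ξ => ?_)
  rw [enorm_mul, enorm_mul, enorm_ofReal_of_nonneg (gauss_pos s ξ).le]
  have : ENNReal.ofReal (gauss s ξ) ≤ 1 := by
    rw [← ENNReal.ofReal_one]; exact ENNReal.ofReal_le_ofReal (gauss_le_one hs.le ξ)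
  calc _ ≤ 1 * ‖transform α f ξ‖ₑ * _ := by gcongr
    _ = _ := by rw [one_mul]

theorem tendsto_lintegral_enorm_sub_gauss_mul_sq {α : ℝ} {f : ℝ → ℂ} (hfm : Measurable f)
    (hf2 : MemLp f 2 (mu α)) :
    Tendsto (fun n : ℕ => ∫⁻ x, ‖f x - (gauss (1 / ((n : ℝ) + 1)) x : ℂ) * f x‖ₑ ^ 2 ∂mu α) atTop
      (𝓝 0) := by
  have h0 : (0 : ℝ≥0∞) = ∫⁻ _, 0 ∂mu α := by simp
  rw [h0]
  refine tendsto_lintegral_of_dominated_convergence (fun x => ‖f x‖ₑ ^ 2) (fun n => ?_)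
    (fun n => Eventually.of_forall fun x => ?_) (lintegral_enorm_sq_lt_top hf2).ne
    (Eventually.of_forall fun x => ?_)
  · have := measurable_gauss_right (1 / ((n : ℝ) + 1))
    fun_prop
  · simp only
    gcongr
    have h1 := gauss_pos (1 / ((n : ℝ) + 1)) x
    have h2 := gauss_le_one (by positivity : 0 ≤ 1 / ((n : ℝ) + 1)) x
    rw [← one_sub_mul, enorm_mul, ← Complex.ofReal_one, ← Complex.ofReal_sub,
      enorm_ofReal_of_nonneg (by linarith)]
    refine mul_le_of_le_one_left' ?_
    rw [← ENNReal.ofReal_one]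
    exact ENNReal.ofReal_le_ofReal (by linarith)
  · have h2 : Tendsto (fun n : ℕ => gauss (1 / ((n : ℝ) + 1)) x) atTop (𝓝 (gauss 0 x)) :=
      ((continuous_gauss_left x).tendsto 0).comp tendsto_one_div_add_atTop_nhds_zero_nat
    have h3 := (tendsto_const_nhds (x := f x)).sub
      (((Complex.continuous_ofReal.tendsto _).comp h2).mul_const (f x))
    have h4 := (ENNReal.continuous_pow 2).tendsto _ |>.comp h3.enorm
    simpa [gauss, Function.comp_def] using h4

/-- The cutoffs to the two halves of phase space add up to the identity, as an inequality between
quadratic forms. -/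
theorem lintegral_enorm_sq_le_cutoffForm {α : ℝ} (hα : -1 / 2 < α) {f : ℝ → ℂ} (hfm : Measurable f)
    (hf : Integrable f (mu α)) (hf2 : MemLp f 2 (mu α)) :
    ∫⁻ x, ‖f x‖ₑ ^ 2 ∂mu α ≤
      cutoffForm α (fun x => ‖f x‖ₑ) (fun x => ‖f x‖ₑ) +
        cutoffForm α (fun x => ‖transform α f x‖ₑ) (fun x => ‖transform α f x‖ₑ) := by
  have hF := measurable_transform hα hfm
  have hfin := lintegral_enorm_sq_lt_top hf2
  have hcm : Measurable fun x => conj (f x) := Complex.continuous_conj.measurable.comp hfm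
  have hfc := integrable_conj hf
  have hfc2 : MemLp (fun x => conj (f x)) 2 (mu α) :=
    ⟨hcm.aestronglyMeasurable, by
      rw [eLpNorm_congr_norm_ae (g := f) (Eventually.of_forall fun x => RCLike.norm_conj _)]
      exact hf2.eLpNorm_lt_top⟩
  set N := ∫⁻ x, ‖f x‖ₑ ^ 2 ∂mu α with hN
  set Q := cutoffForm α (fun x => ‖f x‖ₑ) (fun x => ‖f x‖ₑ) +
    cutoffForm α (fun x => ‖transform α f x‖ₑ) (fun x => ‖transform α f x‖ₑ) with hQ
  set r : ℕ → ℝ → ℂ := fun n x =>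
    conj (f x) - (gauss (1 / ((n : ℝ) + 1)) x : ℂ) * conj (f x) with hr
  have hrm : ∀ n, Measurable (r n) := fun n => by
    have := measurable_gauss_right (1 / ((n : ℝ) + 1))
    simp only [hr]
    fun_prop
  have hri : ∀ n, Integrable (r n) (mu α) := fun n =>
    hfc.sub (integrable_gauss_mul (by positivity) hfc)
  have hr0 := tendsto_lintegral_enorm_sub_gauss_mul_sq hcm hfc2
  have hrfin : ∀ᶠ n in atTop, ∫⁻ x, ‖r n x‖ₑ ^ 2 ∂mu α < ∞ :=
    hr0.eventually (eventually_lt_nhds (by simp))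
  have hstep : ∀ᶠ n : ℕ in atTop, ∫⁻ ξ, ENNReal.ofReal (gauss (1 / ((n : ℝ) + 1)) ξ) *
      ‖transform α f ξ‖ₑ ^ 2 ∂mu α ≤
      Q + N ^ (1 / 2 : ℝ) * (∫⁻ x, ‖r n x‖ₑ ^ 2 ∂mu α) ^ (1 / 2 : ℝ) := by
    filter_upwards [hrfin] with n hn
    have hs : 0 < 1 / ((n : ℝ) + 1) := by positivity
    have hr2 : MemLp (r n) 2 (mu α) := by
      refine ⟨(hrm n).aestronglyMeasurable, ?_⟩
      rw [← eLpNorm_two_sq] at hn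
      by_contra h
      rw [not_lt, top_le_iff] at h
      rw [h] at hn
      simp at hn
    refine (lintegral_gauss_mul_enorm_transform_sq_le hα hs hfm hf).trans
      (add_le_add (enorm_gaussPairing_le hα hfm hf hs) ?_)
    have hrF := measurable_transform hα (hrm n)
    -- Cauchy-Schwarz, then Plancherel for both factors, turns the error into `‖f‖` times the `L²`
    -- norm of the remainder `r n`.
    have hholder := ENNReal.lintegral_mul_le_Lp_mul_Lq (mu α) Real.HolderConjugate.two_two
      (f := fun ξ => ‖transform α f ξ‖ₑ) (g := fun ξ => ‖transform α (r n) ξ‖ₑ)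
      (by fun_prop) (by fun_prop)
    simp only [Pi.mul_apply, ENNReal.rpow_ofNat] at hholder
    rwa [lintegral_enorm_transform_sq hα hfm hf hf2,
      lintegral_enorm_transform_sq hα (hrm n) (hri n) hr2] at hholder
  have h1 := tendsto_lintegral_gauss_mul (α := α) (u := fun ξ => ‖transform α f ξ‖ₑ ^ 2)
    (by fun_prop) (by simp)
  rw [lintegral_enorm_transform_sq hα hfm hf hf2] at h1
  have h2 : Tendsto (fun n : ℕ => Q + N ^ (1 / 2 : ℝ) * (∫⁻ x, ‖r n x‖ₑ ^ 2 ∂mu α) ^ (1 / 2 : ℝ))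
      atTop (𝓝 (Q + N ^ (1 / 2 : ℝ) * 0 ^ (1 / 2 : ℝ))) := by
    refine tendsto_const_nhds.add (ENNReal.Tendsto.const_mul
      ((ENNReal.continuous_rpow_const.tendsto _).comp hr0) (Or.inr ?_))
    exact ENNReal.rpow_ne_top_of_nonneg (by norm_num) hfin.ne
  rw [ENNReal.zero_rpow_of_pos (by norm_num), mul_zero, add_zero] at h2
  exact le_of_tendsto_of_tendsto h1 h2 hstep

/-! ### Schur test and absorption. -/

theorem ENNReal_mul_le_add_inv {c : ℝ≥0∞} (hc : c ≠ 0) (hc' : c ≠ ∞) (a b : ℝ≥0∞) :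
    a * b ≤ c * a ^ 2 + c⁻¹ * b ^ 2 := by
  rcases le_total (c * a) b with h | h
  · refine le_trans ?_ le_add_self
    have : a ≤ c⁻¹ * b := by
      rw [← ENNReal.div_eq_inv_mul, ENNReal.le_div_iff_mul_le (Or.inl hc) (Or.inl hc'), mul_comm]
      exact h
    calc a * b ≤ c⁻¹ * b * b := by gcongr
      _ = _ := by ring
  · refine le_trans ?_ le_self_add
    calc a * b ≤ a * (c * a) := by gcongr
      _ = _ := by ring

/-- A Schur test for the cutoff kernel. -/
theorem cutoffForm_le {α : ℝ} (hα : -1 / 2 < α) {S : Set ℝ} (hS : MeasurableSet S) {R : ℝ≥0∞}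
    (hR : ∀ x, 0 ≤ x → ∫⁻ y in S, cutoffKernel α x y ∂mu α ≤ R) {u v : ℝ → ℝ≥0∞}
    (hu : Measurable u) (hv : Measurable v) (hvS : ∀ y ∉ S, v y = 0) {c : ℝ≥0∞} (hc : c ≠ 0)
    (hc' : c ≠ ∞) :
    cutoffForm α u v ≤ c * R * ∫⁻ x, u x ^ 2 ∂mu α + c⁻¹ * ∫⁻ x, v x ^ 2 ∂mu α := by
  have hK := measurable_cutoffKernel hα
  have hi : Measurable fun p : ℝ × ℝ => S.indicator (fun y => cutoffKernel α p.1 y) p.2 := by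
    have : (fun p : ℝ × ℝ => S.indicator (fun y => cutoffKernel α p.1 y) p.2) =
        (univ ×ˢ S).indicator fun p => cutoffKernel α p.1 p.2 := by
      ext p
      by_cases h : p.2 ∈ S <;> simp [h]
    rw [this]
    exact hK.indicator (MeasurableSet.univ.prod hS)
  calc cutoffForm α u v
      ≤ ∫⁻ p, (S.indicator (fun y => cutoffKernel α p.1 y) p.2 * (c * u p.1 ^ 2) +
          cutoffKernel α p.1 p.2 * (c⁻¹ * v p.2 ^ 2)) ∂(mu α).prod (mu α) := by
        refine lintegral_mono fun p => ?_
        by_cases h : p.2 ∈ S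
        · simp only [indicator_of_mem h, ← mul_add]
          gcongr
          exact ENNReal_mul_le_add_inv hc hc' _ _
        · simp [hvS _ h]
    _ = (∫⁻ x, ∫⁻ y, S.indicator (fun y => cutoffKernel α x y) y * (c * u x ^ 2) ∂mu α ∂mu α) +
        ∫⁻ y, ∫⁻ x, cutoffKernel α x y * (c⁻¹ * v y ^ 2) ∂mu α ∂mu α := by
        have hm1 : Measurable fun p : ℝ × ℝ =>
            S.indicator (fun y => cutoffKernel α p.1 y) p.2 * (c * u p.1 ^ 2) :=
          hi.mul (by fun_prop)
        have hm2 : Measurable fun p : ℝ × ℝ => cutoffKernel α p.1 p.2 * (c⁻¹ * v p.2 ^ 2) :=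
          hK.mul (by fun_prop)
        rw [lintegral_add_left hm1, lintegral_prod _ hm1.aemeasurable,
          lintegral_prod_symm _ hm2.aemeasurable]
    _ ≤ (∫⁻ x, c * R * u x ^ 2 ∂mu α) + ∫⁻ y, c⁻¹ * v y ^ 2 ∂mu α := by
        refine add_le_add (lintegral_mono_ae ?_) (lintegral_mono fun y => ?_)
        · filter_upwards [ae_mu_pos α] with x hx
          have hx1 : Measurable fun y => S.indicator (fun y => cutoffKernel α x y) y :=
            (Measurable.of_uncurry_left (f := cutoffKernel α) hK).indicator hS
          rw [lintegral_mul_const _ hx1, lintegral_indicator hS]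
          calc _ ≤ R * (c * u x ^ 2) := by gcongr; exact hR x hx.le
            _ = _ := by ring
        · have hy1 : Measurable fun x => cutoffKernel α x y :=
            Measurable.of_uncurry_right (f := cutoffKernel α) hK
          rw [lintegral_mul_const _ hy1]
          calc _ ≤ 1 * (c⁻¹ * v y ^ 2) := by
                gcongr; exact lintegral_cutoffKernel_fst_le hα y
            _ = _ := one_mul _
    _ = _ := by
        rw [lintegral_const_mul _ (by fun_prop), lintegral_const_mul _ (by fun_prop)]

theorem restrict_compl_eq (α : ℝ) (S : Set ℝ) : (mu α).restrict Sᶜ =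
    (mu α).restrict (Ici 0 \ S) := by
  refine Measure.restrict_congr_set ?_
  filter_upwards [ae_mu_pos α] with x hx
  refine propext ⟨fun h => ⟨hx.le, h⟩, fun h => h.2⟩

/-- The quadratic form of the cutoff kernel is controlled outside of a set on which its rows are
small. -/
theorem cutoffForm_self_le {α : ℝ} (hα : -1 / 2 < α) {S : Set ℝ} (hS : MeasurableSet S)
    (hR : ∀ x, 0 ≤ x → ∫⁻ y in S, cutoffKernel α x y ∂mu α ≤ ENNReal.ofReal (1 / 64))
    {u : ℝ → ℝ≥0∞} (hu : Measurable u) :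
    cutoffForm α u u ≤ ENNReal.ofReal (3 / 8) * ∫⁻ x, u x ^ 2 ∂mu α +
      ENNReal.ofReal (8 * (Real.pi * rowConst α)) * ∫⁻ x in Ici 0 \ S, u x ^ 2 ∂mu α := by
  have hC : 0 < Real.pi * rowConst α := mul_pos Real.pi_pos (rowConst_pos hα)
  set C := Real.pi * rowConst α with hCdef
  set N := ∫⁻ x, u x ^ 2 ∂mu α with hN
  have hK := measurable_cutoffKernel hα
  have hvS : Measurable (S.indicator u) := hu.indicator hS
  have hvc : Measurable (Sᶜ.indicator u) := hu.indicator hS.compl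
  have hsplit : cutoffForm α u u = cutoffForm α u (S.indicator u) +
      cutoffForm α u (Sᶜ.indicator u) := by
    have hm : Measurable fun p : ℝ × ℝ =>
        cutoffKernel α p.1 p.2 * (u p.1 * S.indicator u p.2) := hK.mul (by fun_prop)
    unfold cutoffForm
    rw [← lintegral_add_left hm]
    refine lintegral_congr fun p => ?_
    rw [← mul_add, ← mul_add]
    congr 2
    exact (congrFun (indicator_self_add_compl S u) p.2).symm
  have hsq : ∀ (A : Set ℝ) x, A.indicator u x ^ 2 = A.indicator (fun x => u x ^ 2) x := by
    intro A x
    by_cases h : x ∈ A <;> simp [h]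
  -- With row bound `1 / 64` and weight `8` the Schur test gives `8 / 64 + 1 / 8 = 1 / 4`.
  have h8 : ENNReal.ofReal 8 ≠ 0 := by simp
  have h1 : cutoffForm α u (S.indicator u) ≤ ENNReal.ofReal (1 / 4) * N := by
    refine (cutoffForm_le hα hS hR hu hvS (fun y hy => indicator_of_notMem hy u) h8
      ENNReal.ofReal_ne_top).trans ?_
    have h2 : ∫⁻ x, S.indicator u x ^ 2 ∂mu α ≤ N :=
      lintegral_mono fun x => by rw [hsq]; exact indicator_le_self _ _ _
    calc _ ≤ ENNReal.ofReal 8 * ENNReal.ofReal (1 / 64) * N + (ENNReal.ofReal 8)⁻¹ * N := by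
          gcongr
      _ = _ := by
          rw [← add_mul, ← ENNReal.ofReal_inv_of_pos (by norm_num), ← ENNReal.ofReal_mul
            (by norm_num), ← ENNReal.ofReal_add (by norm_num) (by norm_num)]
          norm_num
  have h2 : cutoffForm α u (Sᶜ.indicator u) ≤ ENNReal.ofReal (1 / 8) * N +
      ENNReal.ofReal (8 * C) * ∫⁻ x in Ici 0 \ S, u x ^ 2 ∂mu α := by
    -- Outside `S` the rows are only bounded, by `C`; the weight `1 / (8 * C)` leaves `1 / 8` of the
    -- full norm and puts `8 * C` on the part outside `S`.
    have hc : ENNReal.ofReal (1 / (8 * C)) ≠ 0 := by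
      rw [ne_eq, ENNReal.ofReal_eq_zero, not_le]; positivity
    refine (cutoffForm_le hα MeasurableSet.univ (fun x _ => by
      rw [Measure.restrict_univ]; exact lintegral_cutoffKernel_snd_le hα x) hu hvc
      (fun y hy => absurd (mem_univ y) hy) hc ENNReal.ofReal_ne_top).trans (le_of_eq ?_)
    simp only [hsq]
    rw [lintegral_indicator hS.compl, restrict_compl_eq, ← ENNReal.ofReal_inv_of_pos
      (by positivity), ← ENNReal.ofReal_mul (by positivity), ← hCdef,
      show 1 / (8 * C) * C = 1 / 8 by field_simp, show (1 / (8 * C))⁻¹ = 8 * C by simp]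
  rw [hsplit]
  calc _ ≤ ENNReal.ofReal (1 / 4) * N + (ENNReal.ofReal (1 / 8) * N +
        ENNReal.ofReal (8 * C) * ∫⁻ x in Ici 0 \ S, u x ^ 2 ∂mu α) := add_le_add h1 h2
    _ = _ := by
        rw [← add_assoc, ← add_mul, ← ENNReal.ofReal_add (by norm_num) (by norm_num)]
        norm_num

/-- Each of the two forms costs `3 / 8` of `‖f‖ ^ 2`, the second one because the transform has the
same norm. The total `3 / 4` is below one and is absorbed. -/
theorem eLpNorm_le_of_cutoffKernel_le {α : ℝ} (hα : -1 / 2 < α) {S T : Set ℝ}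
    (hS : MeasurableSet S) (hT : MeasurableSet T)
    (hRS : ∀ x, 0 ≤ x → ∫⁻ y in S, cutoffKernel α x y ∂mu α ≤ ENNReal.ofReal (1 / 64))
    (hRT : ∀ x, 0 ≤ x → ∫⁻ y in T, cutoffKernel α x y ∂mu α ≤ ENNReal.ofReal (1 / 64))
    {f : ℝ → ℂ} (hfm : Measurable f) (hf : Integrable f (mu α)) (hf2 : MemLp f 2 (mu α)) :
    eLpNorm f 2 (mu α) ≤ ENNReal.ofReal √(32 * (Real.pi * rowConst α)) *
      (eLpNorm f 2 ((mu α).restrict (Ici 0 \ S)) +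
        eLpNorm (transform α f) 2 ((mu α).restrict (Ici 0 \ T))) := by
  have hC : 0 < Real.pi * rowConst α := mul_pos Real.pi_pos (rowConst_pos hα)
  set C := Real.pi * rowConst α with hCdef
  have hF := measurable_transform hα hfm
  have key := lintegral_enorm_sq_le_cutoffForm hα hfm hf hf2
  have k1 := cutoffForm_self_le hα hS hRS (u := fun x => ‖f x‖ₑ) (by fun_prop)
  have k2 := cutoffForm_self_le hα hT hRT (u := fun x => ‖transform α f x‖ₑ) (by fun_prop)
  rw [lintegral_enorm_transform_sq hα hfm hf hf2] at k2
  simp only [← eLpNorm_two_sq, ← hCdef] at key k1 k2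
  have hfin := hf2.eLpNorm_ne_top
  set n := eLpNorm f 2 (mu α) with hn
  set a := eLpNorm f 2 ((mu α).restrict (Ici 0 \ S)) with ha
  set b := eLpNorm (transform α f) 2 ((mu α).restrict (Ici 0 \ T)) with hb
  have h34 : n ^ 2 ≤ ENNReal.ofReal (3 / 4) * n ^ 2 + ENNReal.ofReal (8 * C) * (a ^ 2 + b ^ 2) := by
    refine (key.trans (add_le_add k1 k2)).trans (le_of_eq ?_)
    have : ENNReal.ofReal (3 / 4) = ENNReal.ofReal (3 / 8) + ENNReal.ofReal (3 / 8) := by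
      rw [← ENNReal.ofReal_add (by norm_num) (by norm_num)]; norm_num
    rw [this]
    ring
  have h14 : ENNReal.ofReal (1 / 4) * n ^ 2 ≤ ENNReal.ofReal (8 * C) * (a ^ 2 + b ^ 2) := by
    have hsum : ENNReal.ofReal (3 / 4) * n ^ 2 + ENNReal.ofReal (1 / 4) * n ^ 2 = n ^ 2 := by
      rw [← add_mul, ← ENNReal.ofReal_add (by norm_num) (by norm_num)]
      norm_num
    rw [← hsum, hsum] at h34
    -- Cancellation in `[0, ∞]` needs the a priori finiteness of `‖f‖`.
    have hne : ENNReal.ofReal (3 / 4) * n ^ 2 ≠ ∞ :=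
      ENNReal.mul_ne_top ENNReal.ofReal_ne_top (ENNReal.pow_ne_top hfin)
    refine (ENNReal.add_le_add_iff_left hne).1 ?_
    rw [hsum]
    exact h34
  have hfinal : n ^ 2 ≤ (ENNReal.ofReal √(32 * C) * (a + b)) ^ 2 := by
    calc n ^ 2 = ENNReal.ofReal 4 * (ENNReal.ofReal (1 / 4) * n ^ 2) := by
          rw [← mul_assoc, ← ENNReal.ofReal_mul (by norm_num)]; norm_num
      _ ≤ ENNReal.ofReal 4 * (ENNReal.ofReal (8 * C) * (a ^ 2 + b ^ 2)) := by gcongr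
      _ = ENNReal.ofReal (32 * C) * (a ^ 2 + b ^ 2) := by
          rw [← mul_assoc, ← ENNReal.ofReal_mul (by norm_num)]; ring_nf
      _ ≤ ENNReal.ofReal (32 * C) * (a + b) ^ 2 := by
          gcongr
          rw [add_sq, add_right_comm]
          exact le_self_add
      _ = _ := by
          rw [mul_pow, ← ENNReal.ofReal_pow (Real.sqrt_nonneg _), Real.sq_sqrt (by positivity)]
  exact (ENNReal.pow_le_pow_left_iff two_ne_zero).1 hfinal

/-! ### Null sets, passage to `L²`, and the theorem. -/

theorem IsThin.congr_ae {ε α : ℝ} {S S' : Set ℝ} (hS : IsThin ε α S) (h : S' =ᵐ[mu α] S) :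
    IsThin ε α S' := by
  refine ⟨fun x h0 h1 => ?_, fun x h2 => ?_⟩
  · rw [measure_congr (h.inter (ae_eq_refl (Icc x (x + 1))))]
    exact hS.1 x h0 h1
  · rw [measure_congr (h.inter (ae_eq_refl (Icc x (x + 1 / x))))]
    exact hS.2 x h2

theorem exists_measurableSet_ae_eq (α : ℝ) {S : Set ℝ} (hS0 : S ⊆ Ici 0)
    (hS : NullMeasurableSet S) :
    ∃ S', MeasurableSet S' ∧ S' ⊆ Ici 0 ∧ S' =ᵐ[mu α] S := by
  refine ⟨toMeasurable volume S ∩ Ici 0, (measurableSet_toMeasurable _ _).inter measurableSet_Ici,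
    inter_subset_right, ?_⟩
  have h1 := (mu_absolutelyContinuous α).ae_eq hS.toMeasurable_ae_eq
  have h2 := h1.inter (ae_eq_refl (Ici (0 : ℝ)))
  rwa [inter_eq_left.2 hS0] at h2

/-- An estimate on `L¹ ∩ L²` extends to `L²` by continuity. -/
theorem eLpNorm_le_of_forall_L1L2 {α : ℝ} (hα : -1 / 2 < α) {A B : Set ℝ} {C : ℝ≥0∞} (hC : C ≠ ∞)
    (h : ∀ h ∈ L1L2 α, eLpNorm h 2 (mu α) ≤ C * (eLpNorm h 2 ((mu α).restrict A) +
      eLpNorm (transform α h) 2 ((mu α).restrict B))) {f g : L2 α} (hfg : IsTransformL2 α f g) :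
    eLpNorm f 2 (mu α) ≤ C * (eLpNorm f 2 ((mu α).restrict A) +
      eLpNorm g 2 ((mu α).restrict B)) := by
  have hne : (𝓝[L1L2 α] f).NeBot := mem_closure_iff_nhdsWithin_neBot.1 (dense_L1L2 α f)
  set d : L2 α → ℝ≥0∞ := fun h => edist h f with hd
  set d' : L2 α → ℝ≥0∞ := fun h => eLpNorm (fun y => transform α h y - g y) 2 (mu α) with hd'
  have hd0 : Tendsto d (𝓝[L1L2 α] f) (𝓝 0) :=
    (tendsto_iff_edist_tendsto_0.1 tendsto_id).mono_left nhdsWithin_le_nhds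
  have hd0' : Tendsto d' (𝓝[L1L2 α] f) (𝓝 0) := hfg
  have hlim : Tendsto (fun h => d h + C * ((eLpNorm f 2 ((mu α).restrict A) + d h) +
      (eLpNorm g 2 ((mu α).restrict B) + d' h))) (𝓝[L1L2 α] f)
      (𝓝 (0 + C * ((eLpNorm f 2 ((mu α).restrict A) + 0) +
        (eLpNorm g 2 ((mu α).restrict B) + 0)))) :=
    hd0.add (ENNReal.Tendsto.const_mul ((tendsto_const_nhds.add hd0).add
      (tendsto_const_nhds.add hd0')) (Or.inr hC))
  simp only [zero_add, add_zero] at hlim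
  refine ge_of_tendsto hlim ?_
  filter_upwards [self_mem_nhdsWithin] with k hk
  have hkf : eLpNorm (⇑k - ⇑f) 2 (mu α) = d k := (Lp.edist_def k f).symm
  have hm : ∀ (h : L2 α) (E : Set ℝ), AEStronglyMeasurable h ((mu α).restrict E) := fun h E =>
    (Lp.aestronglyMeasurable h).restrict
  have h1 : eLpNorm f 2 (mu α) ≤ d k + eLpNorm k 2 (mu α) := by
    have := eLpNorm_sub_le (p := 2) (Lp.aestronglyMeasurable k)
      ((Lp.aestronglyMeasurable k).sub (Lp.aestronglyMeasurable f)) (by norm_num)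
    rw [sub_sub_cancel, hkf, add_comm] at this
    exact this
  have h2 : eLpNorm k 2 ((mu α).restrict A) ≤ eLpNorm f 2 ((mu α).restrict A) + d k := by
    have := eLpNorm_add_le (p := 2) (hm f A) ((hm k A).sub (hm f A)) (by norm_num)
    rw [add_sub_cancel] at this
    refine this.trans (add_le_add le_rfl ?_)
    rw [← hkf]
    exact eLpNorm_mono_measure _ Measure.restrict_le_self
  have h3 : eLpNorm (transform α k) 2 ((mu α).restrict B) ≤
      eLpNorm g 2 ((mu α).restrict B) + d' k := by
    have hT : AEStronglyMeasurable (transform α k) ((mu α).restrict B) :=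
      (aestronglyMeasurable_transform hα k).restrict
    have := eLpNorm_add_le (p := 2) (hm g B) (hT.sub (hm g B)) (by norm_num)
    rw [add_sub_cancel] at this
    exact this.trans (add_le_add le_rfl (eLpNorm_mono_measure _ Measure.restrict_le_self))
  exact h1.trans (add_le_add le_rfl ((h k hk).trans (by gcongr)))

end FourierBessel

end

theorem theorem5p3 (α : ℝ) (hα : -1 / 2 < α) :
    (∀ f : FourierBessel.L2 α,
      FourierBessel.IsTransformL2 α f (FourierBessel.transformL2 α f)) ∧
    ∃ ε₀ : ℝ, 0 < ε₀ ∧ ∀ ε : ℝ, 0 < ε → ε < ε₀ →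
      ∃ C : ℝ, 0 < C ∧ ∀ S T : Set ℝ,
        S ⊆ Set.Ici 0 → NullMeasurableSet S → FourierBessel.IsThin ε α S →
        T ⊆ Set.Ici 0 → NullMeasurableSet T → FourierBessel.IsThin ε α T →
        ∀ f : FourierBessel.L2 α,
          eLpNorm f 2 (FourierBessel.mu α) ≤
            ENNReal.ofReal C *
              (eLpNorm f 2 ((FourierBessel.mu α).restrict (Set.Ici 0 \ S)) +
                eLpNorm (FourierBessel.transformL2 α f) 2
                  ((FourierBessel.mu α).restrict (Set.Ici 0 \ T))) := by
  refine ⟨FourierBessel.isTransformL2_transformL2 hα, ?_⟩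
  -- `1 / 64` is the row bound that the absorption argument requires. Below the resulting threshold
  -- the constant no longer depends on `ε`.
  obtain ⟨ε₀, hε₀, hrow⟩ := FourierBessel.exists_isThin_setLIntegral_cutoffKernel_le hα
    (by norm_num : (0 : ℝ) < 1 / 64)
  have hC := mul_pos Real.pi_pos (FourierBessel.rowConst_pos hα)
  refine ⟨ε₀, hε₀, fun ε _ hε => ⟨√(32 * (Real.pi * FourierBessel.rowConst α)),
    Real.sqrt_pos.2 (by positivity), fun S T hS0 hSm hS hT0 hTm hT f => ?_⟩⟩
  -- The kernel estimates need measurable sets; thinness and the restricted norms see only the class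
  -- of a set modulo null sets of `mu α`.
  obtain ⟨S', hSm', hS0', hSS⟩ := FourierBessel.exists_measurableSet_ae_eq α hS0 hSm
  obtain ⟨T', hTm', hT0', hTT⟩ := FourierBessel.exists_measurableSet_ae_eq α hT0 hTm
  rw [← Measure.restrict_congr_set ((ae_eq_refl (Ici (0 : ℝ))).diff hSS),
    ← Measure.restrict_congr_set ((ae_eq_refl (Ici (0 : ℝ))).diff hTT)]
  refine FourierBessel.eLpNorm_le_of_forall_L1L2 hα ENNReal.ofReal_ne_top (fun h hh => ?_)
    (FourierBessel.isTransformL2_transformL2 hα f)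
  exact FourierBessel.eLpNorm_le_of_cutoffKernel_le hα hSm' hTm'
    (hrow ε hε S' (hS.congr_ae hSS) hSm' hS0') (hrow ε hε T' (hT.congr_ae hTT) hTm' hT0')
    (Lp.stronglyMeasurable h).measurable hh (Lp.memLp h)
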